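/- A star is a nonempty set $F$ of arcs with a common source $source(F)$; $sinks(F)$ is the set of heads of its arcs. An instance of Star Strong Connectivity (SSC) is a finite nonempty vertex set $V$ and a finite family $\mathcal C$ of (loopless) stars on $V$ such that the digraph $(V,\bigcup_{F\in\mathcal C}F)$ is strongly connected. A feasible solution is an $R\subseteq\mathcal C$ for which $(V,\bigcup_{F\in R}F)$ is strongly connected; the goal is to minimise $|R|$, and $OPT$ is the minimum. Minimum Strongly Connected Spanning Subgraph (MSCS) asks for a strongly connected spanning subgraph of a given strongly connected digraph with the fewest arcs; it is the case in which every star is a single arc. For a cut $\emptyset\subset S\subset V$ let $\partial\mathcal C(S)$ be the set of $F\in\mathcal C$ with $source(F)\in S$ and $sinks(F)\not\subseteq S$. The cut-based dual linear program maximises $\sum_S y_S$ over $y\ge 0$ indexed by the cuts, subject to $\sum_{S:\,F\in\partial\mathcal C(S)}y_S\le 1$ for every $F\in\mathcal C$. For $Q\subseteq\mathcal C$ put $source(Q)=\{source(F):F\in Q\}$. The set $Q$ is perfect if its stars have distinct sources, the digraph with vertex set $source(Q)$ and the arcs of the stars of $Q$ is strongly connected, and $sinks(F)\subseteq source(Q)$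 for all $F\in Q$. A cut $S$ is internal to $Q$ if every $F\in\partial\mathcal C(S)$ has $source(F)\in source(Q)$ and $sinks(F)\subseteq source(Q)$. Cuts $S_1,S_2$ are star-disjoint if $\partial\mathcal C(S_1)\cap\partial\mathcal C(S_2)=\emptyset$. Contracting $Q$ identifies $source(Q)$ to one vertex, deletes the arcs inside it, merges parallel arcs of a star and removes stars without remaining arcs. **Theorem.** There is a polynomial-time algorithm that, on every instance $(V,\mathcal C)$ of SSC, starts from $(V,\mathcal C)$ and, as long as the current instance has more than one vertex, finds and contracts a perfect set $Q$ of the current instance, together with either one cut internal to $Q$, where $|Q|\ge 4$, or two star-disjoint cuts internal to $Q$; it outputs these sets and cuts. The union $R$ of the contracted sets is a feasible solution with $$|R|\le \tfrac85\,OPT .$$ Moreover, let $y^1$ be the dual vector with weight $1$ on each cut consisting of a single vertex, and let $y^2$ be the dual vector with weight $1$ on each of the internal cuts found (regarded as cuts of $V$). Both are feasible for the dual program, so that the value of each is at most $OPT$, and $$|R|\le \tfrac85\Bigl(\tfrac34\sum_S y^1_S+\tfrac14\sum_S y^2_S\Bigr).$$ Consequently the same algorithm, run on the single-arc stars of a strongly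 connected digraph, is a polynomial-time $\tfrac85$-approximation algorithm for MSCS. -/

import Mathlib

/-! ### A random access machine with a step count

Programs are structured programs over natural-number registers and finitely many named arrays with
indirect addressing.  The arithmetic is addition, truncated subtraction and comparison; there is no
multiplication, so that polynomially many unit-cost steps are polynomial time in the usual sense. -/

namespace RAM

/-- The memory: registers `reg x` and array cells `arr a i`. -/
structure State where
  reg : ℕ → ℕ
  arr : ℕ → ℕ → ℕ

/-- Expressions; in `load a e` the array name `a` is fixed and the index `e` is computed. -/
inductive Expr where
  | const (k : ℕ)
  | reg (x : ℕ)
  | load (a : ℕ) (e : Expr)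
  | add (e f : Expr)
  | sub (e f : Expr)
  | lt (e f : Expr)
  | eq (e f : Expr)

def Expr.eval (s : State) : Expr → ℕ
  | .const k => k
  | .reg x => s.reg x
  | .load a e => s.arr a (e.eval s)
  | .add e f => e.eval s + f.eval s
  | .sub e f => e.eval s - f.eval s
  | .lt e f => if e.eval s < f.eval s then 1 else 0
  | .eq e f => if e.eval s = f.eval s then 1 else 0

/-- Every node of an expression costs one step. -/
def Expr.cost : Expr → ℕ
  | .const _ => 1
  | .reg _ => 1
  | .load _ e => e.cost + 1
  | .add e f => e.cost + f.cost + 1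
  | .sub e f => e.cost + f.cost + 1
  | .lt e f => e.cost + f.cost + 1
  | .eq e f => e.cost + f.cost + 1

inductive Cmd where
  | skip
  | assign (x : ℕ) (e : Expr)
  | store (a : ℕ) (i e : Expr)
  | seq (c d : Cmd)
  | ite (b : Expr) (c d : Cmd)
  | loop (b : Expr) (c : Cmd)

def State.setReg (s : State) (x k : ℕ) : State :=
  { s with reg := Function.update s.reg x k }

def State.setArr (s : State) (a i k : ℕ) : State :=
  { s with arr := Function.update s.arr a (Function.update (s.arr a) i k) }

/-- `Exec c s t s'`: started in `s`, the program `c` halts in `s'` after exactly `t` steps.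
A test succeeds if its value is nonzero; `loop b c` repeats `c` as long as `b` succeeds. -/
inductive Exec : Cmd → State → ℕ → State → Prop where
  | skip (s : State) : Exec .skip s 1 s
  | assign (x : ℕ) (e : Expr) (s : State) :
      Exec (.assign x e) s (e.cost + 1) (s.setReg x (e.eval s))
  | store (a : ℕ) (i e : Expr) (s : State) :
      Exec (.store a i e) s (i.cost + e.cost + 1) (s.setArr a (i.eval s) (e.eval s))
  | seq {c d : Cmd} {s s' s'' : State} {t t' : ℕ} :
      Exec c s t s' → Exec d s' t' s'' → Exec (.seq c d) s (t + t') s''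
  | ite_true {b : Expr} {c d : Cmd} {s s' : State} {t : ℕ} :
      b.eval s ≠ 0 → Exec c s t s' → Exec (.ite b c d) s (b.cost + 1 + t) s'
  | ite_false {b : Expr} {c d : Cmd} {s s' : State} {t : ℕ} :
      b.eval s = 0 → Exec d s t s' → Exec (.ite b c d) s (b.cost + 1 + t) s'
  | loop_true {b : Expr} {c : Cmd} {s s' s'' : State} {t t' : ℕ} :
      b.eval s ≠ 0 → Exec c s t s' → Exec (.loop b c) s' t' s'' →
        Exec (.loop b c) s (b.cost + 1 + t + t') s''
  | loop_false {b : Expr} {c : Cmd} {s : State} :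
      b.eval s = 0 → Exec (.loop b c) s (b.cost + 1) s

/-- The start state on the input word `w`: register `0` holds its length, array `0` its letters,
and everything else is `0`. -/
def start (w : List ℕ) : State where
  reg x := if x = 0 then w.length else 0
  arr a i := if a = 0 then w.getD i 0 else 0

/-- The output word of a final state: register `0` holds its length, array `1` its letters. -/
def State.output (s : State) : List ℕ :=
  (List.range (s.reg 0)).map (s.arr 1)

/-- On the input word `w`, the program halts after exactly `t` steps with the output word `o`. -/
def Cmd.Computes (c : Cmd) (w o : List ℕ) (t : ℕ) : Prop :=
  ∃ s : State, Exec c (start w) t s ∧ s.output = o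

end RAM

/-- The digraph with vertex set `W` and the arcs of `A` that have both ends in `W` is nonempty and
strongly connected. -/
def StronglyConnectedOn {V : Type*} (W : Finset V) (A : V → V → Prop) : Prop :=
  W.Nonempty ∧ ∀ u ∈ W, ∀ v ∈ W, Relation.ReflTransGen (fun a b => a ∈ W ∧ b ∈ W ∧ A a b) u v

/-- A finite vertex set together with a finite family of stars; the star `F ∈ stars` consists of the
arcs from `source F` to the elements of `sinks F`.  The underlying digraph is the union of all
stars. -/
structure StarSystem (V ι : Type*) where
  verts : Finset V
  stars : Finset ι
  source : ι → V
  sinks : ι → Finset V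

namespace StarSystem

variable {V ι : Type*} [DecidableEq V] [DecidableEq ι] (I : StarSystem V ι)

/-- The arcs of the stars in `R`. -/
def Arc (R : Finset ι) (u v : V) : Prop :=
  ∃ F ∈ R, I.source F = u ∧ v ∈ I.sinks F

/-- An instance of Star Strong Connectivity: nonempty stars without loops on the vertex set, whose
union is strongly connected. -/
structure IsInstance : Prop where
  source_mem : ∀ F ∈ I.stars, I.source F ∈ I.verts
  sinks_subset : ∀ F ∈ I.stars, I.sinks F ⊆ I.verts
  sinks_nonempty : ∀ F ∈ I.stars, (I.sinks F).Nonempty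
  source_notMem_sinks : ∀ F ∈ I.stars, I.source F ∉ I.sinks F
  stronglyConnected : StronglyConnectedOn I.verts (I.Arc I.stars)

/-- A feasible solution: a set of stars whose union is spanning and strongly connected. -/
def IsFeasible (R : Finset ι) : Prop :=
  R ⊆ I.stars ∧ StronglyConnectedOn I.verts (I.Arc R)

/-- All cuts `∅ ⊂ S ⊂ V`. -/
def cuts : Finset (Finset V) :=
  I.verts.powerset.filter fun S => S.Nonempty ∧ S ≠ I.verts

/-- The stars with an arc from `S` to its complement. -/
def crossing (S : Finset V) : Finset ι :=
  I.stars.filter fun F => I.source F ∈ S ∧ ∃ v ∈ I.sinks F, v ∈ I.verts \ S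

/-- Feasibility for the dual of the cut-based linear program: a nonnegative weight on every cut such
that the cuts crossed by any one star have total weight at most `1`. -/
def IsDualFeasible (y : Finset V → ℝ) : Prop :=
  (∀ S ∈ I.cuts, 0 ≤ y S) ∧ ∀ F ∈ I.stars, ∑ S ∈ I.cuts with F ∈ I.crossing S, y S ≤ 1

/-- The objective of the dual linear program. -/
noncomputable def dualValue (y : Finset V → ℝ) : ℝ :=
  ∑ S ∈ I.cuts, y S

/-- The set of source vertices of the stars in `Q`. -/
def sources (Q : Finset ι) : Finset V :=
  Q.image I.source

def IsQuasiperfect (Q : Finset ι) : Prop :=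
  Q ⊆ I.stars ∧ Set.InjOn I.source (Q : Set ι) ∧ StronglyConnectedOn (I.sources Q) (I.Arc Q)

def IsPerfect (Q : Finset ι) : Prop :=
  I.IsQuasiperfect Q ∧ ∀ F ∈ Q, I.sinks F ⊆ I.sources Q

def StarDisjoint (S T : Finset V) : Prop :=
  Disjoint (I.crossing S) (I.crossing T)

def IsInternal (Q : Finset ι) (S : Finset V) : Prop :=
  ∀ F ∈ I.crossing S, I.source F ∈ I.sources Q ∧ I.sinks F ⊆ I.sources Q

/-- The contraction map: every source vertex of `Q` goes to the supervertex, which is named `r`. -/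
def collapse (Q : Finset ι) (r v : V) : V :=
  if v ∈ I.sources Q then r else v

/-- Contraction of the sources of `Q` to one supervertex `r`.  Arcs inside the supervertex
disappear, parallel arcs of a star merge, and a star without remaining arcs is removed; the other
stars keep their names. -/
def contract (Q : Finset ι) (r : V) : StarSystem V ι where
  verts := I.verts.image (I.collapse Q r)
  stars := I.stars.filter fun F =>
    (((I.sinks F).image (I.collapse Q r)).erase (I.collapse Q r (I.source F))).Nonempty
  source F := I.collapse Q r (I.source F)
  sinks F := ((I.sinks F).image (I.collapse Q r)).erase (I.collapse Q r (I.source F))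

end StarSystem

/-- What the algorithm reports about one iteration: the set of stars it contracts, the name of the
supervertex, and the internal cuts it uses, all of them as lists. -/
structure Step (V ι : Type*) where
  stars : List ι
  super : V
  cuts : List (List V)

namespace StarSystem

variable {V ι : Type*} [DecidableEq V] [DecidableEq ι]

/-- The step contracts a perfect set `Q` of `I` to one of its sources, and either `Q` has at least
four stars and the step has one cut, internal to `Q`, or the step has two star-disjoint cuts, both
internal to `Q`. -/
def IsGoodStep (I : StarSystem V ι) (s : Step V ι) : Prop :=
  s.stars.Nodup ∧ I.IsPerfect s.stars.toFinset ∧ s.super ∈ I.sources s.stars.toFinset ∧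
  (∀ S ∈ s.cuts, S.toFinset ∈ I.cuts ∧ I.IsInternal s.stars.toFinset S.toFinset) ∧
  ((4 ≤ s.stars.length ∧ s.cuts.length = 1) ∨
    ∃ S T, s.cuts = [S, T] ∧ I.StarDisjoint S.toFinset T.toFinset)

/-- A complete run of the algorithm on `I`: each step is a good step of the current system, which is
then contracted, until a single vertex is left. -/
def IsRun (I : StarSystem V ι) : List (Step V ι) → Prop
  | [] => I.verts.card = 1
  | s :: l => I.verts.card ≠ 1 ∧ I.IsGoodStep s ∧
      (I.contract s.stars.toFinset s.super).IsRun l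

/-- The internal cuts of all steps of a run, pulled back to sets of vertices of `I`. -/
def internalCuts (I : StarSystem V ι) : List (Step V ι) → List (Finset V)
  | [] => []
  | s :: l => s.cuts.map List.toFinset ++
      ((I.contract s.stars.toFinset s.super).internalCuts l).map fun S =>
        I.verts.filter fun v => I.collapse s.stars.toFinset s.super v ∈ S

/-- The dual solution that gives weight `1` to each cut consisting of one vertex. -/
noncomputable def singletonDual (S : Finset V) : ℝ :=
  if S.card = 1 then 1 else 0

/-- The dual solution that gives weight `1` to each internal cut of the run. -/
noncomputable def internalDual (I : StarSystem V ι) (l : List (Step V ι)) (S : Finset V) : ℝ :=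
  ((I.internalCuts l).count S : ℝ)

end StarSystem

/-- The union of the contracted sets of a run: the solution that the algorithm computes. -/
def chosen {V ι : Type*} [DecidableEq ι] (l : List (Step V ι)) : Finset ι :=
  (l.flatMap Step.stars).toFinset

/-- A word that lists the steps of a run (each list is preceded by its length). -/
def runWord (l : List (Step ℕ ℕ)) : List ℕ :=
  l.length :: l.flatMap fun s =>
    s.stars.length :: (s.stars ++ s.super :: s.cuts.length ::
      s.cuts.flatMap fun S => S.length :: S)

/-- The system with vertices `0, …, n - 1` in which the star number `i` is the `i`-th entry
`(source, sinks)` of the list. -/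
def listedSystem (n : ℕ) (L : List (ℕ × List ℕ)) : StarSystem ℕ ℕ where
  verts := Finset.range n
  stars := Finset.range L.length
  source i := (L.getD i (0, [])).1
  sinks i := (L.getD i (0, [])).2.toFinset

/-- The input word of the same data: the number of vertices, the number of stars, and for each star
its source, the number of its sinks, and its sinks. -/
def listedWord (n : ℕ) (L : List (ℕ × List ℕ)) : List ℕ :=
  n :: L.length :: L.flatMap fun F => F.1 :: F.2.length :: F.2

/-- The set of arcs `A` on the vertices `0, …, n - 1` is strongly connected and spanning. -/
def SpansStrongly (n : ℕ) (A : Finset (ℕ × ℕ)) : Prop :=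
  StronglyConnectedOn (Finset.range n) fun u v => (u, v) ∈ A

/-- An instance of Minimum Strongly Connected Spanning Subgraph, with its arcs listed in any order:
a strongly connected loopless digraph on the vertices `0, …, n - 1`. -/
structure IsListedDigraph (n : ℕ) (E : List (ℕ × ℕ)) : Prop where
  nodup : E.Nodup
  arc_mem : ∀ a ∈ E, a.1 < n ∧ a.2 < n ∧ a.1 ≠ a.2
  stronglyConnected : SpansStrongly n E.toFinset

/-- The arcs of a digraph as stars with a single arc. -/
def arcStars (E : List (ℕ × ℕ)) : List (ℕ × List ℕ) :=
  E.map fun a => (a.1, [a.2])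

/-- The arcs of the list at the positions in `R`. -/
def pickedArcs (E : List (ℕ × ℕ)) (R : Finset ℕ) : Finset (ℕ × ℕ) :=
  R.image fun i => E.getD i (0, 0)

/-! Accounting. A good step contracting `Q` removes `|Q| - 1` vertices and reports `c` cuts, where
`c = 2`, or `c = 1` and `|Q| ≥ 4`. Since `|Q| ≥ 2`, in both cases `5|Q| ≤ 6(|Q| - 1) + 2c`. Summing
over a run that ends in one vertex gives `5|R| + 6 ≤ 6|V| + 2·(number of cuts)` (`IsRun.length_le`),
which is slightly stronger than the bound by `8/5 (3/4 y¹ + 1/4 y²)`. All stars crossing an internal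
cut disappear in the contraction, so no star crosses two reported cuts (`IsRun.countP_le_one`) and
`y²` is dual feasible; for `y¹` note that `F` crosses only one one-vertex cut, that of its source.
Weak duality does the rest.

Existence of a good step. Follow stars along a maximal path, ending in `b`; all sinks of stars at
`b` then lie on the path. Take the star at `b` with the sink farthest back, keep the stars of the
path, and complete this to one star per vertex so that every vertex reaches `b`. The set `U` reached
from `b` is closed and strongly connected, hence perfect, and it contains all sinks of all stars at
`b`, so `{b}` is an internal cut. If `|U| ≥ 4` this suffices. Otherwise delete all stars inside `U`
whose source is not `b`. If the rest is not strongly connected, a set closed under the remaining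
arcs is a second cut, crossed only by deleted stars: it is internal and star-disjoint from `{b}`.

If the rest is strongly connected, every vertex of `U` other than `b` has an ear: a star leaving `U`
and a path outside `U` back to another vertex of `U`. For `|U| = 2` or `3` a case analysis
(`exists_enlarges`) selects one star for each vertex of `U`, at least one leaving `U`, such that
every completion reaches all of `U` and hence a strictly larger perfect set, which still encloses
`b`. After finitely many enlargements a success is forced (`Enlarges.exists_determines`,
`IsTrail.exists_determines`).

Algorithm. Success is forced for every completion of a suitable seed, and a seed consists of at most
three stars, on top of either the path or nothing. So it is enough to try all triples of arcs,
complete each seed by a backward closure, compute `U` by a forward closure, and test the result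
(`search_complete`). Programs built from counting loops bounded by the input length compile to the
machine with a polynomial step bound (`exec_compile`). Contraction only renames the ends of arcs,
arcs inside the supervertex becoming loops that are ignored. -/

open Relation

set_option linter.unusedSectionVars false

/-! ### Walks: first hits, last departures, last arcs -/

section Paths

variable {V : Type*} {R : V → V → Prop}

theorem Relation.ReflTransGen.imp {R' : V → V → Prop} {u w : V} (h : ReflTransGen R u w)
    (H : ∀ a c, R a c → R' a c) : ReflTransGen R' u w := by
  induction h with
  | refl => exact .refl
  | tail _ hcd ih => exact ih.tail (H _ _ hcd)

theorem Relation.ReflTransGen.exists_first_hit {B : V → Prop} {z w : V}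
    (h : ReflTransGen R z w) (hw : B w) :
    ∃ x, B x ∧ ReflTransGen (fun a c => ¬ B a ∧ R a c) z x := by
  induction h using ReflTransGen.head_induction_on with
  | refl => exact ⟨w, hw, .refl⟩
  | @head a c hac _ ih =>
    by_cases ha : B a
    · exact ⟨a, ha, .refl⟩
    · obtain ⟨x, hx, hp⟩ := ih
      exact ⟨x, hx, .head ⟨ha, hac⟩ hp⟩

theorem Relation.ReflTransGen.exists_last_departure {v w : V}
    (h : ReflTransGen R v w) (hne : v ≠ w) :
    ∃ z, R v z ∧ ReflTransGen (fun a c => a ≠ v ∧ R a c) z w := by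
  have key : ∀ u, ReflTransGen R u w → ReflTransGen (fun a c => a ≠ v ∧ R a c) u w ∨
      ∃ z, R v z ∧ ReflTransGen (fun a c => a ≠ v ∧ R a c) z w := by
    intro u hu
    induction hu using ReflTransGen.head_induction_on with
    | refl => exact .inl .refl
    | @head a c hac _ ih =>
      rcases ih with ih | ih
      · by_cases ha : a = v
        · subst ha; exact .inr ⟨c, hac, ih⟩
        · exact .inl (.head ⟨ha, hac⟩ ih)
      · exact .inr ih
  rcases key v h with h | h
  · rcases h.cases_head with h | ⟨c, ⟨hc, _⟩, _⟩
    · exact absurd h hne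
    · exact absurd rfl hc
  · exact h

theorem Relation.ReflTransGen.exists_last_arc {u w : V} (h : ReflTransGen R u w) (hne : u ≠ w) :
    ∃ z, ReflTransGen R u z ∧ z ≠ w ∧ R z w := by
  induction h with
  | refl => exact absurd rfl hne
  | @tail c d huc hcd ih =>
    by_cases hc : c = d
    · subst hc; exact ih hne
    · exact ⟨c, huc, hc, hcd⟩

theorem Relation.ReflTransGen.mem_of_closed {P : V → Prop} {u w : V} (h : ReflTransGen R u w)
    (hu : P u) (hP : ∀ a c, P a → R a c → P c) : P w := by
  induction h with
  | refl => exact hu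
  | tail _ hcd ih => exact hP _ _ ih hcd

end Paths

/-! ### Selections, perfect choices and ears -/

namespace StarSystem

variable {V ι : Type*} [DecidableEq V] [DecidableEq ι] (I : StarSystem V ι)

/-- The arcs of the stars that a partial assignment of stars to vertices leaves available. -/
def AvailableArc (fx : V → Option ι) (u v : V) : Prop :=
  ∃ F ∈ I.stars, I.source F = u ∧ v ∈ I.sinks F ∧ (fx u = none ∨ fx u = some F)

/-- The arcs of the stars selected by `f`. -/
def SelectedArc (f : V → ι) (u v : V) : Prop :=
  v ∈ I.sinks (f u)

/-- A choice of one available star per vertex such that every vertex reaches `t`. -/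
structure IsSelection (fx : V → Option ι) (t : V) (f : V → ι) : Prop where
  mem : ∀ u ∈ I.verts, f u ∈ I.stars
  source : ∀ u ∈ I.verts, I.source (f u) = u
  compat : ∀ u ∈ I.verts, fx u = none ∨ fx u = some (f u)
  reach : ∀ u ∈ I.verts, ReflTransGen (I.SelectedArc f) u t

/-- A selection on `U` whose stars form a perfect set. -/
structure IsPerfectChoice (g : V → ι) (U : Finset V) : Prop where
  subset : U ⊆ I.verts
  mem : ∀ u ∈ U, g u ∈ I.stars
  source : ∀ u ∈ U, I.source (g u) = u
  sinks : ∀ u ∈ U, I.sinks (g u) ⊆ U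
  conn : ∀ u ∈ U, ∀ v ∈ U, ReflTransGen (I.SelectedArc g) u v

/-- The arcs of the stars that either have source `b` or are not contained in `U`. -/
def KeptArc (b : V) (U : Finset V) (u v : V) : Prop :=
  ∃ F ∈ I.stars, I.source F = u ∧ v ∈ I.sinks F ∧ (u = b ∨ u ∉ U ∨ ¬ I.sinks F ⊆ U)

/-- All stars at `b` are contained in `U`. -/
def Encloses (b : V) (U : Finset V) : Prop :=
  b ∈ U ∧ ∀ F ∈ I.stars, I.source F = b → I.sinks F ⊆ U

/-- Strong connectivity fails once the stars inside `U` with a source other than `b` are dropped.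
The set reached from `s` by kept arcs is then the second cut: only dropped stars cross it. -/
def Splits (b : V) (U : Finset V) : Prop :=
  ∃ s ∈ I.verts, ∃ v ∈ I.verts, ¬ ReflTransGen (I.KeptArc b U) s v

/-- The two alternatives of a good step. `Encloses` makes `{b}` an internal cut in both; the second
cut, needed when `U` is small, comes from `Splits`. -/
def Succeeds (b : V) (U : Finset V) : Prop :=
  I.Encloses b U ∧ (4 ≤ U.card ∨ I.Splits b U)

/-- Success is demanded of every completion of `fx`, because the program computes an arbitrary one.
The first condition ensures that its backward closure from `t` covers all vertices. -/
def Determines (b : V) (fx : V → Option ι) (t : V) : Prop :=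
  (∀ u ∈ I.verts, ReflTransGen (I.AvailableArc fx) u t) ∧
    ∀ (f : V → ι) (U : Finset V), I.IsSelection fx t f →
      (∀ v, v ∈ U ↔ ReflTransGen (I.SelectedArc f) t v) → I.Succeeds b U

/-- A star at `v` that leaves `U`, and a path outside `U` from one of its sinks to `h`. -/
def Ear (U : Finset V) (v : V) (F : ι) (h : V) : Prop :=
  F ∈ I.stars ∧ I.source F = v ∧ ¬ I.sinks F ⊆ U ∧
    ∃ z ∈ I.sinks F, ReflTransGen (fun a c => a ∉ U ∧ I.Arc I.stars a c) z h

variable {I}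

theorem KeptArc.arc {b : V} {U : Finset V} {u v : V} (h : I.KeptArc b U u v) :
    I.Arc I.stars u v := by
  obtain ⟨F, hF, hs, hv, _⟩ := h
  exact ⟨F, hF, hs, hv⟩

/-- Without a split, kept arcs lead from `v` to `w`. The star used at the last departure from `v` is
kept although `v ∈ U` and `v ≠ b`, so it leaves `U`. Stopping at the first vertex of `U` other than
`v` gives a path outside `U`, as `v` is not departed from again. -/
theorem exists_ear {b : V} {U : Finset V} (hU : U ⊆ I.verts) (hsplit : ¬ I.Splits b U) {v w : V}
    (hv : v ∈ U) (hvb : v ≠ b) (hw : w ∈ U) (hwv : w ≠ v) :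
    ∃ F, ∃ h ∈ U, h ≠ v ∧ I.Ear U v F h := by
  have hp : ReflTransGen (I.KeptArc b U) v w := by
    by_contra hc
    exact hsplit ⟨v, hU hv, w, hU hw, hc⟩
  obtain ⟨z, ⟨F, hF, hs, hz, hk⟩, hzw⟩ := hp.exists_last_departure hwv.symm
  obtain ⟨h, ⟨hhU, hhv⟩, hzh⟩ := hzw.exists_first_hit (B := fun x => x ∈ U ∧ x ≠ v) ⟨hw, hwv⟩
  refine ⟨F, h, hhU, hhv, hF, hs, ?_, z, hz, ?_⟩
  · rcases hk with hk | hk | hk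
    · exact absurd hk hvb
    · exact absurd hv hk
    · exact hk
  · refine hzh.imp ?_
    rintro a c ⟨h1, h2, h3⟩
    exact ⟨fun haU => h1 ⟨haU, h2⟩, h3.arc⟩

theorem arc_mem (hI : I.IsInstance) {u v : V} (h : I.Arc I.stars u v) :
    u ∈ I.verts ∧ v ∈ I.verts := by
  obtain ⟨F, hF, rfl, hv⟩ := h
  exact ⟨hI.source_mem F hF, hI.sinks_subset F hF hv⟩

theorem IsInstance.reach (hI : I.IsInstance) {u v : V} (hu : u ∈ I.verts) (hv : v ∈ I.verts) :
    ReflTransGen (I.Arc I.stars) u v :=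
  (hI.stronglyConnected.2 u hu v hv).imp fun _ _ h => h.2.2

/-- A path avoiding the assigned vertices is available. -/
theorem available_of_free {fx : V → Option ι} {X : Finset V} (hX : ∀ u, u ∉ X → fx u = none)
    {z h : V} (hp : ReflTransGen (fun a c => a ∉ X ∧ I.Arc I.stars a c) z h) :
    ReflTransGen (I.AvailableArc fx) z h := by
  refine hp.imp ?_
  rintro a c ⟨ha, F, hF, hs, hc⟩
  exact ⟨F, hF, hs, hc, .inl (hX a ha)⟩

/-- Any path to `t` can be cut at its first vertex in `X`; before that no star is prescribed. So
reachability of `t` has to be checked only on the vertices with prescribed stars. -/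
theorem available_all (hI : I.IsInstance) {fx : V → Option ι} {X : Finset V} {t : V}
    (hX : ∀ u, u ∉ X → fx u = none) (htX : t ∈ X) (ht : t ∈ I.verts)
    (hreach : ∀ x ∈ X, ReflTransGen (I.AvailableArc fx) x t) {u : V} (hu : u ∈ I.verts) :
    ReflTransGen (I.AvailableArc fx) u t := by
  obtain ⟨h, hh, hp⟩ := (hI.reach hu ht).exists_first_hit (B := fun x => x ∈ X) htX
  exact (available_of_free hX hp).trans (hreach h hh)

theorem IsSelection.selected_mem (hI : I.IsInstance) {fx : V → Option ι} {t : V} {f : V → ι}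
    (hf : I.IsSelection fx t f) {u v : V} (hu : u ∈ I.verts) (h : I.SelectedArc f u v) :
    v ∈ I.verts :=
  hI.sinks_subset _ (hf.mem u hu) h

theorem IsSelection.reach_mem (hI : I.IsInstance) {fx : V → Option ι} {t : V} {f : V → ι}
    (hf : I.IsSelection fx t f) {u v : V} (hu : u ∈ I.verts)
    (h : ReflTransGen (I.SelectedArc f) u v) : v ∈ I.verts :=
  h.mem_of_closed hu fun _ _ ha hac => hf.selected_mem hI ha hac

/-- The vertices that a selection reaches from its target form a perfect choice. -/
theorem IsSelection.isPerfectChoice (hI : I.IsInstance) {fx : V → Option ι} {t : V} {f : V → ι}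
    (hf : I.IsSelection fx t f) (ht : t ∈ I.verts) {U : Finset V}
    (hU : ∀ v, v ∈ U ↔ ReflTransGen (I.SelectedArc f) t v) : I.IsPerfectChoice f U := by
  have hsub : U ⊆ I.verts := fun v hv => hf.reach_mem hI ht ((hU v).1 hv)
  refine ⟨hsub, fun u hu => hf.mem u (hsub hu), fun u hu => hf.source u (hsub hu), ?_, ?_⟩
  · intro u hu v hv
    exact (hU v).2 (((hU u).1 hu).tail hv)
  · intro u hu v hv
    exact (hf.reach u (hsub hu)).trans ((hU v).1 hv)

theorem IsPerfectChoice.exists_pred {g : V → ι} {U : Finset V} (hg : I.IsPerfectChoice g U)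
    {u v : V} (hu : u ∈ U) (hv : v ∈ U) (huv : u ≠ v) : ∃ w ∈ U, w ≠ v ∧ v ∈ I.sinks (g w) := by
  obtain ⟨z, hz, hzv, ha⟩ := (hg.conn u hu v hv).exists_last_arc huv
  exact ⟨z, hz.mem_of_closed hu fun a c ha hac => hg.sinks a ha hac, hzv, ha⟩

/-! ### Enlarging a perfect set by prescribing stars on it -/

/-- The assignment of the stars `G u` to the vertices `u ∈ U`. -/
def assignOn (U : Finset V) (G : V → ι) (u : V) : Option ι :=
  if u ∈ U then some (G u) else none

theorem available_assignOn {U : Finset V} {G : V → ι} {u v : V} (hu : u ∈ U) (hG : G u ∈ I.stars)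
    (hs : I.source (G u) = u) (hv : v ∈ I.sinks (G u)) : I.AvailableArc (assignOn U G) u v :=
  ⟨G u, hG, hs, hv, .inr (by simp [assignOn, hu])⟩

theorem Ear.available {U : Finset V} {G : V → ι} {u h : V} (hu : u ∈ U)
    (he : I.Ear U u (G u) h) : ReflTransGen (I.AvailableArc (assignOn U G)) u h := by
  obtain ⟨hF, hs, _, z, hz, hp⟩ := he
  refine .head (available_assignOn hu hF hs hz) (available_of_free ?_ hp)
  intro w hw; simp [assignOn, hw]

theorem IsSelection.eq_of_assignOn {U : Finset V} {G : V → ι} {t : V} {f : V → ι}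
    (hf : I.IsSelection (assignOn U G) t f) {u : V} (hu : u ∈ U) (hv : u ∈ I.verts) :
    f u = G u := by
  have := hf.compat u hv
  simp [assignOn, hu] at this
  exact this.symm

/-- Conditions under which fixing the stars `G` on `U` forces a larger perfect set. -/
structure Enlarges (I : StarSystem V ι) (U : Finset V) (G : V → ι) (t : V) : Prop where
  target : t ∈ U
  mem : ∀ u ∈ U, G u ∈ I.stars
  source : ∀ u ∈ U, I.source (G u) = u
  leaves : ∃ u ∈ U, ¬ I.sinks (G u) ⊆ U
  reach : ∀ u ∈ U, ReflTransGen (I.AvailableArc (assignOn U G)) u t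
  covers : ∀ f, I.IsSelection (assignOn U G) t f → ∀ u ∈ U, ReflTransGen (I.SelectedArc f) t u

/-- Every completion reaches all of `U` from `t`, and then also a sink outside `U` of the prescribed
star that leaves `U`. -/
theorem Enlarges.card_lt {U : Finset V} {G : V → ι} {t : V} (h : I.Enlarges U G t)
    (hU : U ⊆ I.verts) {f : V → ι} {U' : Finset V} (hf : I.IsSelection (assignOn U G) t f)
    (hU' : ∀ v, v ∈ U' ↔ ReflTransGen (I.SelectedArc f) t v) : U ⊆ U' ∧ U.card < U'.card := by
  have hsub : U ⊆ U' := fun u hu => (hU' u).2 (h.covers f hf u hu)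
  refine ⟨hsub, Finset.card_lt_card ((Finset.ssubset_iff_of_subset hsub).2 ?_)⟩
  obtain ⟨u, hu, hl⟩ := h.leaves
  obtain ⟨x, hx, hxU⟩ := Finset.not_subset.1 hl
  refine ⟨x, (hU' x).2 ((h.covers f hf u hu).tail ?_), hxU⟩
  unfold SelectedArc
  rwa [hf.eq_of_assignOn hu (hU hu)]

theorem Encloses.mono {b : V} {U U' : Finset V} (h : I.Encloses b U) (hU : U ⊆ U') :
    I.Encloses b U' :=
  ⟨hU h.1, fun F hF hs => (h.2 F hF hs).trans hU⟩

theorem Enlarges.available (hI : I.IsInstance) {U : Finset V} {G : V → ι} {t : V}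
    (h : I.Enlarges U G t) (hU : U ⊆ I.verts) {u : V} (hu : u ∈ I.verts) :
    ReflTransGen (I.AvailableArc (assignOn U G)) u t :=
  available_all hI (X := U) (fun u hu => by simp [assignOn, hu]) h.target (hU h.target) h.reach hu

/-! ### Perfect sets with two or three vertices -/

/-- The three vertices of a perfect choice, with all stars at `b` inside. -/
structure Triangle (I : StarSystem V ι) (g : V → ι) (b x y : V) : Prop where
  bx : b ≠ x
  by' : b ≠ y
  xy : x ≠ y
  perfect : I.IsPerfectChoice g {b, x, y}
  encloses : I.Encloses b {b, x, y}
  noSplit : ¬ I.Splits b {b, x, y}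

theorem Triangle.swap {g : V → ι} {b x y : V} (h : I.Triangle g b x y) : I.Triangle g b y x := by
  have e : ({b, y, x} : Finset V) = {b, x, y} := by
    rw [Finset.pair_comm]
  exact ⟨h.by', h.bx, h.xy.symm, e ▸ h.perfect, e ▸ h.encloses, e ▸ h.noSplit⟩

theorem Triangle.mem_iff {b x y v : V} : v ∈ ({b, x, y} : Finset V) ↔ v = b ∨ v = x ∨ v = y := by
  simp

/-- Both other vertices are sinks of the star at `b`. -/
theorem Triangle.exists_enlarges_of_both {g : V → ι} {b x y : V} (h : I.Triangle g b x y)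
    (hx : x ∈ I.sinks (g b)) (hy : y ∈ I.sinks (g b)) (hb : b ∈ I.sinks (g y)) :
    ∃ G t, I.Enlarges {b, x, y} G t := by
  obtain ⟨hbx, hby, hxy, hp, henc, hns⟩ := h
  -- Only the star at `x` is exchanged. Its ear ends in `b` or `y`, and `y` leads back to `b`; the
  -- unchanged star at `b` reaches `x` and `y` directly, so the target `b` works.
  obtain ⟨F, k, hk, hkx, he⟩ := exists_ear hp.subset hns (v := x) (w := b) (by simp) hbx.symm
    (by simp) hbx
  let G := Function.update g x F
  have hGx : G x = F := by simp [G]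
  have hGb : G b = g b := by simp [G, hbx]
  have hGy : G y = g y := by simp [G, hxy.symm]
  have rb : ReflTransGen (I.AvailableArc (assignOn {b, x, y} G)) b b := .refl
  have ry : ReflTransGen (I.AvailableArc (assignOn {b, x, y} G)) y b :=
    .single (available_assignOn (by simp) (hGy ▸ hp.mem y (by simp)) (hGy ▸ hp.source y (by simp))
      (hGy ▸ hb))
  have rx : ReflTransGen (I.AvailableArc (assignOn {b, x, y} G)) x b := by
    refine (Ear.available (G := G) (by simp) (hGx ▸ he)).trans ?_
    rcases Triangle.mem_iff.1 hk with rfl | rfl | rfl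
    exacts [rb, absurd rfl hkx, ry]
  refine ⟨G, b, by simp, ?_, ?_, ⟨x, by simp, hGx ▸ he.2.2.1⟩, ?_, ?_⟩
  · intro u hu
    rcases Triangle.mem_iff.1 hu with rfl | rfl | rfl
    exacts [hGb ▸ hp.mem _ (by simp), hGx ▸ he.1, hGy ▸ hp.mem _ (by simp)]
  · intro u hu
    rcases Triangle.mem_iff.1 hu with rfl | rfl | rfl
    exacts [hGb ▸ hp.source _ (by simp), hGx ▸ he.2.1, hGy ▸ hp.source _ (by simp)]
  · intro u hu
    rcases Triangle.mem_iff.1 hu with rfl | rfl | rfl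
    exacts [rb, rx, ry]
  · intro f hf u hu
    have hfb : f b = g b := (hf.eq_of_assignOn (by simp) (hp.subset (by simp))).trans hGb
    rcases Triangle.mem_iff.1 hu with rfl | rfl | rfl
    exacts [.refl, .single (hfb ▸ hx : u ∈ I.sinks (f b)), .single (hfb ▸ hy : u ∈ I.sinks (f b))]

/-- The stars `g b ∋ x`, `g x ∋ b, y`. -/
theorem Triangle.exists_enlarges_of_path {g : V → ι} {b x y : V} (h : I.Triangle g b x y)
    (hx : x ∈ I.sinks (g b)) (hy : y ∈ I.sinks (g x)) (hb : b ∈ I.sinks (g x)) :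
    ∃ G t, I.Enlarges {b, x, y} G t := by
  obtain ⟨hbx, hby, hxy, hp, henc, hns⟩ := h
  -- Only the star at `y` is exchanged. Its ear ends in `b` or `x`, and `x` leads back to `b`; the
  -- unchanged stars still reach `x` and then `y` from `b`.
  obtain ⟨F, k, hk, hky, he⟩ := exists_ear hp.subset hns (v := y) (w := b) (by simp) hby.symm
    (by simp) hby
  let G := Function.update g y F
  have hGy : G y = F := by simp [G]
  have hGb : G b = g b := by simp [G, hby]
  have hGx : G x = g x := by simp [G, hxy]
  have rb : ReflTransGen (I.AvailableArc (assignOn {b, x, y} G)) b b := .refl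
  have rx : ReflTransGen (I.AvailableArc (assignOn {b, x, y} G)) x b :=
    .single (available_assignOn (by simp) (hGx ▸ hp.mem x (by simp)) (hGx ▸ hp.source x (by simp))
      (hGx ▸ hb))
  have ry : ReflTransGen (I.AvailableArc (assignOn {b, x, y} G)) y b := by
    refine (Ear.available (G := G) (by simp) (hGy ▸ he)).trans ?_
    rcases Triangle.mem_iff.1 hk with rfl | rfl | rfl
    exacts [rb, rx, absurd rfl hky]
  refine ⟨G, b, by simp, ?_, ?_, ⟨y, by simp, hGy ▸ he.2.2.1⟩, ?_, ?_⟩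
  · intro u hu
    rcases Triangle.mem_iff.1 hu with rfl | rfl | rfl
    exacts [hGb ▸ hp.mem _ (by simp), hGx ▸ hp.mem _ (by simp), hGy ▸ he.1]
  · intro u hu
    rcases Triangle.mem_iff.1 hu with rfl | rfl | rfl
    exacts [hGb ▸ hp.source _ (by simp), hGx ▸ hp.source _ (by simp), hGy ▸ he.2.1]
  · intro u hu
    rcases Triangle.mem_iff.1 hu with rfl | rfl | rfl
    exacts [rb, rx, ry]
  · intro f hf u hu
    have hfb : f b = g b := (hf.eq_of_assignOn (by simp) (hp.subset (by simp))).trans hGb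
    have hfx : f x = g x := (hf.eq_of_assignOn (by simp) (hp.subset (by simp))).trans hGx
    have r1 : ReflTransGen (I.SelectedArc f) b x := .single (hfb ▸ hx : x ∈ I.sinks (f b))
    rcases Triangle.mem_iff.1 hu with rfl | rfl | rfl
    exacts [.refl, r1, r1.tail (hfx ▸ hy : u ∈ I.sinks (f x))]

/-- The stars form the cycle `b`, `x`, `y`, and an ear leads from `x` to `y`. -/
theorem Triangle.exists_enlarges_of_ear_xy {g : V → ι} {b x y : V} (h : I.Triangle g b x y)
    (hx : x ∈ I.sinks (g b)) (hb : b ∈ I.sinks (g y)) {F : ι}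
    (he : I.Ear {b, x, y} x F y) : ∃ G t, I.Enlarges {b, x, y} G t := by
  obtain ⟨hbx, hby, hxy, hp, henc, hns⟩ := h
  -- The target is `y` here: the unchanged stars at `y` and `b` lead from `y` to `b` to `x`, and the
  -- ear closes the cycle.
  let G := Function.update g x F
  have hGx : G x = F := by simp [G]
  have hGb : G b = g b := by simp [G, hbx]
  have hGy : G y = g y := by simp [G, hxy.symm]
  have rx : ReflTransGen (I.AvailableArc (assignOn {b, x, y} G)) x y :=
    Ear.available (G := G) (by simp) (hGx ▸ he)
  have rb : ReflTransGen (I.AvailableArc (assignOn {b, x, y} G)) b y :=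
    .head (available_assignOn (by simp) (hGb ▸ hp.mem b (by simp)) (hGb ▸ hp.source b (by simp))
      (hGb ▸ hx)) rx
  refine ⟨G, y, by simp, ?_, ?_, ⟨x, by simp, hGx ▸ he.2.2.1⟩, ?_, ?_⟩
  · intro u hu
    rcases Triangle.mem_iff.1 hu with rfl | rfl | rfl
    exacts [hGb ▸ hp.mem _ (by simp), hGx ▸ he.1, hGy ▸ hp.mem _ (by simp)]
  · intro u hu
    rcases Triangle.mem_iff.1 hu with rfl | rfl | rfl
    exacts [hGb ▸ hp.source _ (by simp), hGx ▸ he.2.1, hGy ▸ hp.source _ (by simp)]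
  · intro u hu
    rcases Triangle.mem_iff.1 hu with rfl | rfl | rfl
    exacts [rb, rx, .refl]
  · intro f hf u hu
    have hfb : f b = g b := (hf.eq_of_assignOn (by simp) (hp.subset (by simp))).trans hGb
    have hfy : f y = g y := (hf.eq_of_assignOn (by simp) (hp.subset (by simp))).trans hGy
    have r1 : ReflTransGen (I.SelectedArc f) y b := .single (hfy ▸ hb : b ∈ I.sinks (f y))
    rcases Triangle.mem_iff.1 hu with rfl | rfl | rfl
    exacts [r1, r1.tail (hfb ▸ hx : u ∈ I.sinks (f b)), .refl]

/-- The stars form the cycle `b`, `x`, `y`, and an ear leads from `y` to `b`. -/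
theorem Triangle.exists_enlarges_of_ear_yb {g : V → ι} {b x y : V} (h : I.Triangle g b x y)
    (hx : x ∈ I.sinks (g b)) (hy : y ∈ I.sinks (g x)) {F : ι}
    (he : I.Ear {b, x, y} y F b) : ∃ G t, I.Enlarges {b, x, y} G t := by
  obtain ⟨hbx, hby, hxy, hp, henc, hns⟩ := h
  -- The unchanged stars lead from `b` to `x` to `y`, and the ear closes the cycle.
  let G := Function.update g y F
  have hGy : G y = F := by simp [G]
  have hGb : G b = g b := by simp [G, hby]
  have hGx : G x = g x := by simp [G, hxy]
  have ry : ReflTransGen (I.AvailableArc (assignOn {b, x, y} G)) y b :=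
    Ear.available (G := G) (by simp) (hGy ▸ he)
  have rx : ReflTransGen (I.AvailableArc (assignOn {b, x, y} G)) x b :=
    .head (available_assignOn (by simp) (hGx ▸ hp.mem x (by simp)) (hGx ▸ hp.source x (by simp))
      (hGx ▸ hy)) ry
  refine ⟨G, b, by simp, ?_, ?_, ⟨y, by simp, hGy ▸ he.2.2.1⟩, ?_, ?_⟩
  · intro u hu
    rcases Triangle.mem_iff.1 hu with rfl | rfl | rfl
    exacts [hGb ▸ hp.mem _ (by simp), hGx ▸ hp.mem _ (by simp), hGy ▸ he.1]
  · intro u hu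
    rcases Triangle.mem_iff.1 hu with rfl | rfl | rfl
    exacts [hGb ▸ hp.source _ (by simp), hGx ▸ hp.source _ (by simp), hGy ▸ he.2.1]
  · intro u hu
    rcases Triangle.mem_iff.1 hu with rfl | rfl | rfl
    exacts [.refl, rx, ry]
  · intro f hf u hu
    have hfb : f b = g b := (hf.eq_of_assignOn (by simp) (hp.subset (by simp))).trans hGb
    have hfx : f x = g x := (hf.eq_of_assignOn (by simp) (hp.subset (by simp))).trans hGx
    have r1 : ReflTransGen (I.SelectedArc f) b x := .single (hfb ▸ hx : x ∈ I.sinks (f b))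
    rcases Triangle.mem_iff.1 hu with rfl | rfl | rfl
    exacts [.refl, r1, r1.tail (hfx ▸ hy : u ∈ I.sinks (f x))]

/-- No ear leads from `x` to `y`: then some star at `b` contains `y`. -/
theorem Triangle.exists_star_at {g : V → ι} {b x y : V} (h : I.Triangle g b x y)
    (hxy : ∀ F, ¬ I.Ear {b, x, y} x F y) : ∃ F ∈ I.stars, I.source F = b ∧ y ∈ I.sinks F := by
  obtain ⟨hbx, hby, hne, hp, henc, hns⟩ := h
  by_contra hno
  have hxv : x ∈ I.verts := hp.subset (by simp)
  have hyv : y ∈ I.verts := hp.subset (by simp)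
  have hpath : ReflTransGen (I.KeptArc b {b, x, y}) x y := by
    by_contra hc
    exact hns ⟨x, hxv, y, hyv, hc⟩
  obtain ⟨z, ⟨F, hF, hs, hz, hk⟩, hzy⟩ := hpath.exists_last_departure hne
  -- Read the kept path backwards from `y`. It cannot pass through `b`: the stars at `b` stay in
  -- `{b, x, y}`, and the next vertex would be `b` again, `x` (no longer departed from), or `y`
  -- (excluded by assumption). So it runs outside `{b, x, y}`, and the last departure from `x`
  -- yields a forbidden ear from `x` to `y`.
  have key : ∀ w, ReflTransGen (fun a c => a ≠ x ∧ I.KeptArc b {b, x, y} a c) w y →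
      (w = b → False) ∧
        ReflTransGen (fun a c => a ∉ ({b, x, y} : Finset V) ∧ I.Arc I.stars a c) w y := by
    intro w hw
    induction hw using ReflTransGen.head_induction_on with
    | refl => exact ⟨fun h => hby h.symm, .refl⟩
    | @head a c hac _ ih =>
      have hab : a ≠ b := by
        rintro rfl
        obtain ⟨hax, F', hF', hs', hc', _⟩ := hac
        rcases Triangle.mem_iff.1 (henc.2 F' hF' hs' hc') with rfl | rfl | rfl
        · exact ih.1 rfl
        · rcases ih.2.cases_head with h | ⟨c', ⟨h, _⟩, _⟩
          · exact hne h
          · simp at h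
        · exact hno ⟨F', hF', hs', hc'⟩
      refine ⟨hab, ?_⟩
      by_cases hay : a = y
      · subst hay; exact .refl
      · exact .head ⟨by simp [hab, hac.1, hay], hac.2.arc⟩ ih.2
  refine hxy F ⟨hF, hs, ?_, z, hz, (key z hzy).2⟩
  rcases hk with hk | hk | hk
  · exact absurd hk.symm hbx
  · simp at hk
  · exact hk

/-- Ears from `x` to `b` and from `y` to `x` only. -/
theorem Triangle.exists_enlarges_of_two_ears {g : V → ι} {b x y : V} (hI : I.IsInstance)
    (h : I.Triangle g b x y) {Fx Fy Fb : ι}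
    (hFb : Fb ∈ I.stars) (hsb : I.source Fb = b) (hy : y ∈ I.sinks Fb)
    (hex : I.Ear {b, x, y} x Fx b) (hey : I.Ear {b, x, y} y Fy x)
    (hyb : ∀ F, ¬ I.Ear {b, x, y} y F b) : ∃ G t, I.Enlarges {b, x, y} G t := by
  obtain ⟨hbx, hby, hxy, hp, henc, hns⟩ := h
  let G : V → ι := fun u => if u = b then Fb else if u = x then Fx else Fy
  have hGb : G b = Fb := by simp [G]
  have hGx : G x = Fx := by simp [G, hbx.symm]
  have hGy : G y = Fy := by simp [G, hby.symm, hxy.symm]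
  have rx : ReflTransGen (I.AvailableArc (assignOn {b, x, y} G)) x b :=
    Ear.available (G := G) (by simp) (hGx ▸ hex)
  have ry : ReflTransGen (I.AvailableArc (assignOn {b, x, y} G)) y b :=
    (Ear.available (G := G) (by simp) (hGy ▸ hey)).trans rx
  refine ⟨G, b, by simp, ?_, ?_, ⟨x, by simp, hGx ▸ hex.2.2.1⟩, ?_, ?_⟩
  · intro u hu
    rcases Triangle.mem_iff.1 hu with rfl | rfl | rfl
    exacts [hGb ▸ hFb, hGx ▸ hex.1, hGy ▸ hey.1]
  · intro u hu
    rcases Triangle.mem_iff.1 hu with rfl | rfl | rfl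
    exacts [hGb ▸ hsb, hGx ▸ hex.2.1, hGy ▸ hey.2.1]
  · intro u hu
    rcases Triangle.mem_iff.1 hu with rfl | rfl | rfl
    exacts [.refl, rx, ry]
  · intro f hf u hu
    have hfb : f b = Fb := (hf.eq_of_assignOn (by simp) (hp.subset (by simp))).trans hGb
    have hfy : f y = Fy := (hf.eq_of_assignOn (by simp) (hp.subset (by simp))).trans hGy
    have r1 : ReflTransGen (I.SelectedArc f) b y := .single (hfb ▸ hy : y ∈ I.sinks (f b))
    have hyv : y ∈ I.verts := hp.subset (by simp)
    -- An arbitrary completion need not follow the ear from `y` to `x`. But after the last departure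
    -- from `y` its path to `b` must meet `x` before `b`, since otherwise it would be an ear from
    -- `y` to `b`.
    have r2 : ReflTransGen (I.SelectedArc f) y x := by
      obtain ⟨z, hz, hzb⟩ := (hf.reach y hyv).exists_last_departure hby.symm
      obtain ⟨k, hk, hzk⟩ := hzb.exists_first_hit (B := fun v => v = b ∨ v = x) (.inl rfl)
      have hzk' : ReflTransGen (I.SelectedArc f) z k := hzk.imp fun _ _ h => h.2.2
      rcases hk with rfl | rfl
      · refine absurd ⟨hey.1, hey.2.1, hey.2.2.1, z, hfy ▸ hz, ?_⟩ (hyb Fy)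
        have hzv : z ∈ I.verts := hf.selected_mem hI hyv hz
        clear hzb hz hzk'
        induction hzk using ReflTransGen.head_induction_on with
        | refl => exact .refl
        | @head a c hac _ ih =>
          have hcv := hf.selected_mem hI hzv hac.2.2
          refine .head ⟨?_, f a, hf.mem a hzv, hf.source a hzv, hac.2.2⟩ (ih hcv)
          have h1 := hac.1
          have h2 := hac.2.1
          simp only [Triangle.mem_iff]
          tauto
      · exact .head hz hzk'
    rcases Triangle.mem_iff.1 hu with rfl | rfl | rfl
    exacts [.refl, r1.trans r2, r1]

/-- An ear from `x` to `y` or from `y` to `b` gives the enlargement by itself. If there are none,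
every ear at `x` ends in `b`, every ear at `y` ends in `x`, and some star at `b` contains `y`; these
three stars form a cycle in the opposite direction. -/
theorem Triangle.exists_enlarges_of_cycle {g : V → ι} {b x y : V} (hI : I.IsInstance)
    (h : I.Triangle g b x y) (hx : x ∈ I.sinks (g b)) (hy : y ∈ I.sinks (g x))
    (hb : b ∈ I.sinks (g y)) : ∃ G t, I.Enlarges {b, x, y} G t := by
  by_cases h1 : ∃ F, I.Ear {b, x, y} x F y
  · obtain ⟨F, he⟩ := h1
    exact h.exists_enlarges_of_ear_xy hx hb he
  by_cases h2 : ∃ F, I.Ear {b, x, y} y F b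
  · obtain ⟨F, he⟩ := h2
    exact h.exists_enlarges_of_ear_yb hx hy he
  push Not at h1 h2
  obtain ⟨Fb, hFb, hsb, hyF⟩ := h.exists_star_at h1
  obtain ⟨Fx, k, hk, hkx, hex⟩ := exists_ear h.perfect.subset h.noSplit (v := x) (w := b) (by simp)
    h.bx.symm (by simp) h.bx
  obtain ⟨Fy, l, hl, hly, hey⟩ := exists_ear h.perfect.subset h.noSplit (v := y) (w := b) (by simp)
    h.by'.symm (by simp) h.by'
  have hkb : k = b := by
    rcases Triangle.mem_iff.1 hk with h | h | h
    exacts [h, absurd h hkx, absurd (h ▸ hex) (h1 Fx)]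
  have hlx : l = x := by
    rcases Triangle.mem_iff.1 hl with h | h | h
    exacts [absurd (h ▸ hey) (h2 Fy), h, absurd h hly]
  subst hkb hlx
  exact h.exists_enlarges_of_two_ears hI hFb hsb hyF hex hey h2

/-- If `y` is also a sink of `g b`, either `x` or `y` enters `b`, and exchanging the names reduces
to one case. Otherwise `y` is entered from `x`, and `b` is entered from `x` or only from `y`: a path
with a return, or a directed triangle. -/
theorem Triangle.exists_enlarges_of_mem {g : V → ι} {b x y : V} (hI : I.IsInstance)
    (h : I.Triangle g b x y) (hx : x ∈ I.sinks (g b)) : ∃ G t, I.Enlarges {b, x, y} G t := by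
  have hp := h.perfect
  by_cases hyb : y ∈ I.sinks (g b)
  · obtain ⟨w, hw, hwb, hbw⟩ := hp.exists_pred (u := x) (v := b) (by simp) (by simp) h.bx.symm
    rcases Triangle.mem_iff.1 hw with e | e | e
    · exact absurd e hwb
    · obtain ⟨G, t, hG⟩ := h.swap.exists_enlarges_of_both hyb hx (e ▸ hbw)
      rw [Finset.pair_comm] at hG
      exact ⟨G, t, hG⟩
    · exact h.exists_enlarges_of_both hx hyb (e ▸ hbw)
  · obtain ⟨w, hw, hwy, hyw⟩ := hp.exists_pred (u := x) (v := y) (by simp) (by simp) h.xy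
    have hyx : y ∈ I.sinks (g x) := by
      rcases Triangle.mem_iff.1 hw with e | e | e
      exacts [absurd (e ▸ hyw) hyb, e ▸ hyw, absurd e hwy]
    by_cases hbx : b ∈ I.sinks (g x)
    · exact h.exists_enlarges_of_path hx hyx hbx
    · obtain ⟨w, hw, hwb, hbw⟩ := hp.exists_pred (u := x) (v := b) (by simp) (by simp) h.bx.symm
      have hby : b ∈ I.sinks (g y) := by
        rcases Triangle.mem_iff.1 hw with e | e | e
        exacts [absurd e hwb, absurd (e ▸ hbw) hbx, e ▸ hbw]
      exact h.exists_enlarges_of_cycle hI hx hyx hby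

theorem Triangle.exists_enlarges {g : V → ι} {b x y : V} (hI : I.IsInstance)
    (h : I.Triangle g b x y) : ∃ G t, I.Enlarges {b, x, y} G t := by
  have hb : b ∈ ({b, x, y} : Finset V) := by simp
  obtain ⟨v, hv⟩ := hI.sinks_nonempty _ (h.perfect.mem b hb)
  rcases Triangle.mem_iff.1 (h.perfect.sinks b hb hv) with e | e | e
  · subst e
    have := hI.source_notMem_sinks _ (h.perfect.mem v hb)
    rw [h.perfect.source v hb] at this
    exact absurd hv this
  · exact h.exists_enlarges_of_mem hI (e ▸ hv)
  · obtain ⟨G, t, hG⟩ := h.swap.exists_enlarges_of_mem hI (e ▸ hv)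
    rw [Finset.pair_comm] at hG
    exact ⟨G, t, hG⟩

/-- The case of a perfect set with two vertices. -/
theorem exists_enlarges_pair {g : V → ι} {a b : V} (hI : I.IsInstance) (hab : a ≠ b)
    (hp : I.IsPerfectChoice g {b, a}) (hns : ¬ I.Splits b {b, a}) :
    ∃ G t, I.Enlarges {b, a} G t := by
  -- The ear at `a` can only end in `b`, and the star at `b` has the single sink `a`. So `a` is
  -- exchanged for the star of the ear and `b` keeps its star.
  obtain ⟨F, k, hk, hka, he⟩ := exists_ear hp.subset hns (v := a) (w := b) (by simp) hab
    (by simp) hab.symm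
  have hkb : k = b := by
    rcases Finset.mem_insert.1 hk with h | h
    exacts [h, absurd (Finset.mem_singleton.1 h) hka]
  subst hkb
  have hb : k ∈ ({k, a} : Finset V) := by simp
  obtain ⟨v, hv⟩ := hI.sinks_nonempty _ (hp.mem k hb)
  have hva : v = a := by
    rcases Finset.mem_insert.1 (hp.sinks k hb hv) with h | h
    · have := hI.source_notMem_sinks _ (hp.mem k hb)
      rw [hp.source k hb] at this
      exact absurd (h ▸ hv) this
    · exact Finset.mem_singleton.1 h
  subst hva
  let G := Function.update g v F
  have hGa : G v = F := by simp [G]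
  have hGb : G k = g k := by simp [G, hab.symm]
  refine ⟨G, k, hb, ?_, ?_, ⟨v, by simp, hGa ▸ he.2.2.1⟩, ?_, ?_⟩
  · intro u hu
    rcases Finset.mem_insert.1 hu with h | h
    · rw [h, hGb]; exact hp.mem k hb
    · rw [Finset.mem_singleton.1 h, hGa]; exact he.1
  · intro u hu
    rcases Finset.mem_insert.1 hu with h | h
    · rw [h, hGb]; exact hp.source k hb
    · rw [Finset.mem_singleton.1 h, hGa]; exact he.2.1
  · intro u hu
    rcases Finset.mem_insert.1 hu with h | h
    · rw [h]
    · rw [Finset.mem_singleton.1 h]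
      exact Ear.available (G := G) (by simp) (hGa ▸ he)
  · intro f hf u hu
    have hfb : f k = g k := (hf.eq_of_assignOn hb (hp.subset hb)).trans hGb
    rcases Finset.mem_insert.1 hu with h | h
    · rw [h]
    · rw [Finset.mem_singleton.1 h]
      exact .single (hfb ▸ hv : v ∈ I.sinks (f k))

theorem IsPerfectChoice.one_lt_card (hI : I.IsInstance) {g : V → ι} {U : Finset V}
    (hp : I.IsPerfectChoice g U) {b : V} (hb : b ∈ U) : 1 < U.card := by
  obtain ⟨v, hv⟩ := hI.sinks_nonempty _ (hp.mem b hb)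
  refine Finset.one_lt_card.2 ⟨b, hb, v, hp.sinks b hb hv, ?_⟩
  rintro rfl
  have := hI.source_notMem_sinks _ (hp.mem b hb)
  rw [hp.source b hb] at this
  exact this hv

/-- A perfect set has at least two vertices because stars are nonempty and loopless, so only the
sizes two and three remain. -/
theorem exists_enlarges (hI : I.IsInstance) {g : V → ι} {U : Finset V} {b : V}
    (hp : I.IsPerfectChoice g U) (henc : I.Encloses b U) (hcard : U.card < 4)
    (hns : ¬ I.Splits b U) : ∃ G t, I.Enlarges U G t := by
  have h1 := hp.one_lt_card hI henc.1
  have he := Finset.card_erase_add_one henc.1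
  rcases (by omega : U.card = 2 ∨ U.card = 3) with h | h
  · obtain ⟨a, ha⟩ := Finset.card_eq_one.1 (by omega : (U.erase b).card = 1)
    have hab : a ≠ b := (Finset.mem_erase.1 (ha ▸ Finset.mem_singleton_self a)).1
    have hU : U = {b, a} := by rw [← Finset.insert_erase henc.1, ha]
    subst hU
    exact exists_enlarges_pair hI hab hp hns
  · obtain ⟨x, y, hxy, ha⟩ := Finset.card_eq_two.1 (by omega : (U.erase b).card = 2)
    have hx : x ≠ b := (Finset.mem_erase.1 (ha ▸ (by simp : x ∈ ({x, y} : Finset V)))).1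
    have hy : y ≠ b := (Finset.mem_erase.1 (ha ▸ (by simp : y ∈ ({x, y} : Finset V)))).1
    have hU : U = {b, x, y} := by rw [← Finset.insert_erase henc.1, ha]
    subst hU
    exact Triangle.exists_enlarges hI ⟨hx.symm, hy.symm, hxy, hp, henc, hns⟩

/-! ### Seeds of three stars -/

/-- The stars `F₁`, `F₂`, `F₃` are assigned to their sources, the earlier ones with priority; the
other vertices keep the assignment `base`. -/
def seed (I : StarSystem V ι) (base : V → Option ι) (F₁ F₂ F₃ : ι) (u : V) : Option ι :=
  if u = I.source F₁ then some F₁ else if u = I.source F₂ then some F₂ else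
    if u = I.source F₃ then some F₃ else base u

/-- A prescription on at most three vertices is described by three stars, repeated if necessary,
with the star of the target first. This is what makes enumeration of triples sufficient. -/
theorem assignOn_eq_seed {U : Finset V} {G : V → ι} {t : V} (ht : t ∈ U) (hU : U.card < 4)
    (hs : ∀ u ∈ U, I.source (G u) = u) :
    ∃ x ∈ U, ∃ y ∈ U, assignOn U G = I.seed (fun _ => none) (G t) (G x) (G y) := by
  have key : ∃ x y, U = {t, x, y} := by
    have he := Finset.card_erase_add_one ht
    rcases (by omega : (U.erase t).card = 0 ∨ (U.erase t).card = 1 ∨ (U.erase t).card = 2)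
      with h | h | h
    · refine ⟨t, t, ?_⟩
      rw [← Finset.insert_erase ht, Finset.card_eq_zero.1 h]
      simp
    · obtain ⟨a, ha⟩ := Finset.card_eq_one.1 h
      refine ⟨a, a, ?_⟩
      rw [← Finset.insert_erase ht, ha]
      simp
    · obtain ⟨x, y, -, ha⟩ := Finset.card_eq_two.1 h
      refine ⟨x, y, ?_⟩
      rw [← Finset.insert_erase ht, ha]
  obtain ⟨x, y, rfl⟩ := key
  refine ⟨x, by simp, y, by simp, ?_⟩
  funext u
  simp only [assignOn, seed, hs t (by simp), hs x (by simp), hs y (by simp), Finset.mem_insert,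
    Finset.mem_singleton]
  by_cases h1 : u = t
  · simp [h1]
  by_cases h2 : u = x
  · subst h2; simp [h1]
  by_cases h3 : u = y
  · subst h3; simp [h1, h2]
  · simp [h1, h2, h3]

/-- If some completion of the prescription fails, its reached set is a larger perfect set that still
encloses `b`, has fewer than four vertices and does not split, so it can be enlarged again. The
number `n` bounds the remaining enlargements. -/
theorem Enlarges.exists_determines (hI : I.IsInstance) {b : V} (n : ℕ) :
    ∀ {U : Finset V} {G : V → ι} {t : V}, U ⊆ I.verts → U.card < 4 → 4 ≤ U.card + n →
      I.Encloses b U → I.Enlarges U G t → ∃ F₁ ∈ I.stars, ∃ F₂ ∈ I.stars, ∃ F₃ ∈ I.stars,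
        I.Determines b (I.seed (fun _ => none) F₁ F₂ F₃) (I.source F₁) := by
  induction n with
  | zero => intro U G t _ h1 h2; omega
  | succ n ih =>
    intro U G t hU hc hn henc h
    obtain ⟨x, hx, y, hy, hseed⟩ := assignOn_eq_seed h.target hc h.source
    by_cases hd : I.Determines b (assignOn U G) t
    · refine ⟨G t, h.mem t h.target, G x, h.mem x hx, G y, h.mem y hy, ?_⟩
      rwa [← hseed, h.source t h.target]
    · have hd' : ∃ (f : V → ι) (U' : Finset V), I.IsSelection (assignOn U G) t f ∧
          (∀ v, v ∈ U' ↔ ReflTransGen (I.SelectedArc f) t v) ∧ ¬ I.Succeeds b U' := by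
        by_contra hno
        push Not at hno
        exact hd ⟨fun u hu => h.available hI hU hu, hno⟩
      obtain ⟨f, U', hf, hU', hfail⟩ := hd'
      obtain ⟨hsub, hlt⟩ := h.card_lt hU hf hU'
      have henc' := henc.mono hsub
      have hp := hf.isPerfectChoice hI (hU h.target) hU'
      have hc' : U'.card < 4 := by
        by_contra hc'
        exact hfail ⟨henc', .inl (by omega)⟩
      have hns : ¬ I.Splits b U' := fun hs => hfail ⟨henc', .inr hs⟩
      obtain ⟨G', t', h'⟩ := exists_enlarges hI hp henc' hc' hns
      exact ih hp.subset hc' (by omega) henc' h'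

/-! ### Maximal paths and the existence of a determining seed -/

/-- A path of assigned stars that ends in `b` and cannot be continued. -/
structure IsTrail (I : StarSystem V ι) (fx : V → Option ι) (b : V) (p : ℕ → V) (k : ℕ) : Prop where
  last : p k = b
  mem : ∀ i ≤ k, p i ∈ I.verts
  step : ∀ i < k, ∃ F ∈ I.stars, fx (p i) = some F ∧ I.source F = p i ∧ p (i + 1) ∈ I.sinks F
  support : ∀ u, fx u ≠ none → ∃ i < k, p i = u
  free : fx b = none
  maximal : ∀ F ∈ I.stars, I.source F = b → ∀ v ∈ I.sinks F, ∃ i ≤ k, p i = v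

theorem IsTrail.exists_farthest (hI : I.IsInstance) {fx : V → Option ι} {b : V} {p : ℕ → V} {k : ℕ}
    (h : I.IsTrail fx b p k) (hcard : I.verts.card ≠ 1) :
    ∃ F ∈ I.stars, I.source F = b ∧ ∃ j ≤ k, p j ∈ I.sinks F ∧
      ∀ F' ∈ I.stars, I.source F' = b → ∀ v ∈ I.sinks F', ∃ i, j ≤ i ∧ i ≤ k ∧ p i = v := by
  classical
  have hb : b ∈ I.verts := h.last ▸ h.mem k le_rfl
  -- As there is a second vertex, `b` has an out-neighbour, and by maximality it lies on the path.
  -- The least such index is the one farthest back.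
  have hex : ∃ j, j ≤ k ∧ ∃ F ∈ I.stars, I.source F = b ∧ p j ∈ I.sinks F := by
    have hpos : 0 < I.verts.card := Finset.card_pos.2 ⟨b, hb⟩
    obtain ⟨w, hw, hwb⟩ := Finset.exists_mem_ne (by omega : 1 < I.verts.card) b
    rcases (hI.reach hb hw).cases_head with e | ⟨c, ⟨F, hF, hs, hc⟩, -⟩
    · exact absurd e.symm hwb
    · obtain ⟨i, hi, rfl⟩ := h.maximal F hF hs c hc
      exact ⟨i, hi, F, hF, hs, hc⟩
  obtain ⟨hj, F, hF, hs, hmem⟩ := Nat.find_spec hex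
  refine ⟨F, hF, hs, Nat.find hex, hj, hmem, ?_⟩
  intro F' hF' hs' v hv
  obtain ⟨i, hi, rfl⟩ := h.maximal F' hF' hs' v hv
  exact ⟨i, Nat.find_min' hex ⟨hi, F', hF', hs', hv⟩, hi, rfl⟩

/-- The path together with the star at `b` that reaches farthest back is tried first. If a
completion of it fails, the set it reaches still encloses `b`, and enlarging that set leads to a
seed that needs no path. -/
theorem IsTrail.exists_determines (hI : I.IsInstance) {fx : V → Option ι} {b : V} {p : ℕ → V}
    {k : ℕ} (h : I.IsTrail fx b p k) (hcard : I.verts.card ≠ 1) :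
    ∃ base, (base = fx ∨ base = fun _ => none) ∧ ∃ F₁ ∈ I.stars, ∃ F₂ ∈ I.stars, ∃ F₃ ∈ I.stars,
      I.Determines b (I.seed base F₁ F₂ F₃) (I.source F₁) := by
  have hb : b ∈ I.verts := h.last ▸ h.mem k le_rfl
  obtain ⟨F, hF, hs, j, hj, hpj, hfar⟩ := h.exists_farthest hI hcard
  by_cases hd : I.Determines b (I.seed fx F F F) (I.source F)
  · exact ⟨fx, .inl rfl, F, hF, F, hF, F, hF, hd⟩
  have hseed : ∀ u, u ≠ b → I.seed fx F F F u = fx u := by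
    intro u hu; simp [seed, hs, hu]
  have hseedb : I.seed fx F F F b = some F := by simp [seed, hs]
  have hne : ∀ i < k, p i ≠ b := by
    intro i hi e
    obtain ⟨F', -, hF', -⟩ := h.step i hi
    rw [e, h.free] at hF'
    cases hF'
  have hreach : ∀ m i, i + m = k → ReflTransGen (I.AvailableArc (I.seed fx F F F)) (p i) b := by
    intro m
    induction m with
    | zero =>
      intro i hi
      obtain rfl : i = k := by omega
      rw [h.last]
    | succ m ih =>
      intro i hi
      obtain ⟨F', hF', hfx, hs', hsink⟩ := h.step i (by omega)
      refine .head ⟨F', hF', hs', hsink, .inr ?_⟩ (ih (i + 1) (by omega))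
      rw [hseed _ (hne i (by omega)), hfx]
  have hall : ∀ u ∈ I.verts, ReflTransGen (I.AvailableArc (I.seed fx F F F)) u b := by
    intro u hu
    refine available_all hI (X := (Finset.range (k + 1)).image p) ?_ ?_ hb ?_ hu
    · intro u hu
      simp only [Finset.mem_image, Finset.mem_range, not_exists, not_and] at hu
      have hub : u ≠ b := fun e => hu k (by omega) (by rw [h.last, e])
      rw [hseed u hub]
      by_contra hc
      obtain ⟨i, hi, hiu⟩ := h.support u hc
      exact hu i (by omega) hiu
    · exact Finset.mem_image.2 ⟨k, by simp, h.last⟩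
    · intro x hx
      obtain ⟨i, hi, rfl⟩ := Finset.mem_image.1 hx
      exact hreach (k - i) i (by have := Finset.mem_range.1 hi; omega)
  have hd' : ∃ (f : V → ι) (U : Finset V), I.IsSelection (I.seed fx F F F) b f ∧
      (∀ v, v ∈ U ↔ ReflTransGen (I.SelectedArc f) b v) ∧ ¬ I.Succeeds b U := by
    by_contra hno
    push Not at hno
    exact hd ⟨hs.symm ▸ hall, hs.symm ▸ hno⟩
  obtain ⟨f, U, hf, hU, hfail⟩ := hd'
  have hp := hf.isPerfectChoice hI hb hU
  have hfb : f b = F := by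
    have := hf.compat b hb
    rw [hseedb] at this
    exact Eq.symm (by simpa using this)
  -- The completion must use the prescribed stars, so from `b` it reaches `p j` and then the rest of
  -- the path. By the choice of `j` this part contains every sink of every star at `b`.
  have hpU : ∀ m, j + m ≤ k → p (j + m) ∈ U := by
    intro m
    induction m with
    | zero => intro _; exact (hU _).2 (.single (hfb ▸ hpj : p j ∈ I.sinks (f b)))
    | succ m ih =>
      intro hm
      obtain ⟨F', hF', hfx, hs', hsink⟩ := h.step (j + m) (by omega)
      refine hp.sinks _ (ih (by omega)) ?_
      have := hf.compat _ (h.mem (j + m) (by omega))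
      rw [hseed _ (hne _ (by omega)), hfx] at this
      have e : F' = f (p (j + m)) := by simpa using this
      exact e ▸ hsink
  have henc : I.Encloses b U := by
    refine ⟨(hU b).2 .refl, fun F' hF' hs' v hv => ?_⟩
    obtain ⟨i, hji, hik, rfl⟩ := hfar F' hF' hs' v hv
    obtain ⟨m, rfl⟩ := Nat.exists_eq_add_of_le hji
    exact hpU m hik
  have hc : U.card < 4 := by
    by_contra hc
    exact hfail ⟨henc, .inl (by omega)⟩
  have hns : ¬ I.Splits b U := fun hs => hfail ⟨henc, .inr hs⟩
  obtain ⟨G, t, hG⟩ := exists_enlarges hI hp henc hc hns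
  obtain ⟨F₁, h1, F₂, h2, F₃, h3, hdet⟩ :=
    hG.exists_determines hI 4 hp.subset hc (by omega) henc
  exact ⟨_, .inr rfl, F₁, h1, F₂, h2, F₃, h3, hdet⟩

/-! ### Good steps from perfect choices -/

theorem IsPerfectChoice.sources_image {g : V → ι} {U : Finset V} (hp : I.IsPerfectChoice g U) :
    I.sources (U.image g) = U := by
  ext v
  simp only [sources, Finset.mem_image]
  constructor
  · rintro ⟨F, ⟨u, hu, rfl⟩, rfl⟩
    rwa [hp.source u hu]
  · intro hv
    exact ⟨g v, ⟨v, hv, rfl⟩, hp.source v hv⟩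

theorem IsPerfectChoice.isPerfect {g : V → ι} {U : Finset V} (hp : I.IsPerfectChoice g U)
    (hU : U.Nonempty) : I.IsPerfect (U.image g) := by
  refine ⟨⟨?_, ?_, ?_⟩, ?_⟩
  · intro F hF
    obtain ⟨u, hu, rfl⟩ := Finset.mem_image.1 hF
    exact hp.mem u hu
  · intro F hF F' hF' e
    obtain ⟨u, hu, rfl⟩ := Finset.mem_image.1 (Finset.mem_coe.1 hF)
    obtain ⟨u', hu', rfl⟩ := Finset.mem_image.1 (Finset.mem_coe.1 hF')
    rw [hp.source u hu, hp.source u' hu'] at e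
    rw [e]
  · rw [hp.sources_image]
    refine ⟨hU, fun u hu v hv => ?_⟩
    have : ∀ w, ReflTransGen (I.SelectedArc g) u w → w ∈ U ∧
        ReflTransGen (fun a c => a ∈ U ∧ c ∈ U ∧ I.Arc (U.image g) a c) u w := by
      intro w hw
      induction hw with
      | refl => exact ⟨hu, .refl⟩
      | @tail c d _ hcd ih =>
        have hd := hp.sinks c ih.1 hcd
        exact ⟨hd, ih.2.tail ⟨ih.1, hd, g c, Finset.mem_image_of_mem g ih.1, hp.source c ih.1, hcd⟩⟩
    exact (this v (hp.conn u hu v hv)).2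
  · intro F hF
    obtain ⟨u, hu, rfl⟩ := Finset.mem_image.1 hF
    rw [hp.sources_image]
    exact hp.sinks u hu

theorem singleton_mem_cuts {b : V} (hb : b ∈ I.verts) (hcard : I.verts.card ≠ 1) :
    {b} ∈ I.cuts := by
  simp only [cuts, Finset.mem_filter, Finset.mem_powerset, Finset.singleton_subset_iff,
    Finset.singleton_nonempty, true_and]
  refine ⟨hb, ?_⟩
  intro e
  exact hcard (by rw [← e]; simp)

theorem Encloses.isInternal {b : V} {g : V → ι} {U : Finset V} (hp : I.IsPerfectChoice g U)
    (h : I.Encloses b U) : I.IsInternal (U.image g) {b} := by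
  intro F hF
  simp only [crossing, Finset.mem_filter, Finset.mem_singleton] at hF
  rw [hp.sources_image, hF.2.1]
  exact ⟨h.1, h.2 F hF.1 hF.2.1⟩

/-- A set closed under the kept arcs is crossed only by stars inside `U` with source other than
`b`. -/
theorem crossing_of_closed {b : V} {U T : Finset V}
    (hT : ∀ a c, a ∈ T → I.KeptArc b U a c → c ∈ T) {F : ι} (hF : F ∈ I.crossing T) :
    I.source F ≠ b ∧ I.source F ∈ U ∧ I.sinks F ⊆ U := by
  simp only [crossing, Finset.mem_filter, Finset.mem_sdiff] at hF
  obtain ⟨hF, hs, v, hv, -, hvT⟩ := hF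
  by_contra hc
  refine hvT (hT _ v hs ⟨F, hF, rfl, hv, ?_⟩)
  tauto

theorem isInternal_of_closed {b : V} {g : V → ι} {U T : Finset V} (hp : I.IsPerfectChoice g U)
    (hT : ∀ a c, a ∈ T → I.KeptArc b U a c → c ∈ T) : I.IsInternal (U.image g) T := by
  intro F hF
  rw [hp.sources_image]
  exact (crossing_of_closed hT hF).2

theorem starDisjoint_of_closed {b : V} {U T : Finset V}
    (hT : ∀ a c, a ∈ T → I.KeptArc b U a c → c ∈ T) : I.StarDisjoint {b} T := by
  unfold StarDisjoint
  refine Finset.disjoint_left.2 fun F hF hF' => ?_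
  simp only [crossing, Finset.mem_filter, Finset.mem_singleton] at hF
  exact (crossing_of_closed hT hF').1 hF.2.1

/-! ### Contraction -/

theorem collapse_of_mem {Q : Finset ι} {r v : V} (h : v ∈ I.sources Q) : I.collapse Q r v = r := by
  simp [collapse, h]

theorem collapse_of_notMem {Q : Finset ι} {r v : V} (h : v ∉ I.sources Q) :
    I.collapse Q r v = v := by
  simp [collapse, h]

theorem mem_contract_stars {Q : Finset ι} {r : V} {F : ι} :
    F ∈ (I.contract Q r).stars ↔ F ∈ I.stars ∧
      ∃ v ∈ I.sinks F, I.collapse Q r v ≠ I.collapse Q r (I.source F) := by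
  unfold contract
  rw [Finset.mem_filter]
  simp only [Finset.Nonempty, Finset.mem_erase, Finset.mem_image]
  constructor
  · rintro ⟨h, x, hx, v, hv, rfl⟩
    exact ⟨h, v, hv, hx⟩
  · rintro ⟨h, v, hv, hx⟩
    exact ⟨h, _, hx, v, hv, rfl⟩

theorem mem_contract_sinks {Q : Finset ι} {r x : V} {F : ι} :
    x ∈ (I.contract Q r).sinks F ↔
      x ≠ I.collapse Q r (I.source F) ∧ ∃ v ∈ I.sinks F, I.collapse Q r v = x := by
  simp [contract]

theorem contract_source {Q : Finset ι} {r : V} {F : ι} :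
    (I.contract Q r).source F = I.collapse Q r (I.source F) := rfl

theorem mem_contract_verts {Q : Finset ι} {r x : V} :
    x ∈ (I.contract Q r).verts ↔ ∃ v ∈ I.verts, I.collapse Q r v = x := by
  simp [contract]

theorem contract_arc {Q : Finset ι} {r : V} {R : Finset ι} {x y : V} (hxy : x ≠ y) :
    (I.contract Q r).Arc R x y ↔
      ∃ u v, I.Arc R u v ∧ I.collapse Q r u = x ∧ I.collapse Q r v = y := by
  constructor
  · rintro ⟨F, hF, hs, hy⟩
    obtain ⟨-, v, hv, hvy⟩ := mem_contract_sinks.1 hy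
    exact ⟨_, v, ⟨F, hF, rfl, hv⟩, hs, hvy⟩
  · rintro ⟨u, v, ⟨F, hF, rfl, hv⟩, hx, hy⟩
    refine ⟨F, hF, hx, mem_contract_sinks.2 ⟨?_, v, hv, hy⟩⟩
    rw [hx]; exact hxy.symm

theorem contract_arc_stars {Q : Finset ι} {r : V} {x y : V} (hxy : x ≠ y) :
    (I.contract Q r).Arc (I.contract Q r).stars x y ↔
      ∃ u v, I.Arc I.stars u v ∧ I.collapse Q r u = x ∧ I.collapse Q r v = y := by
  rw [← contract_arc hxy]
  constructor
  · rintro ⟨F, hF, h⟩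
    exact ⟨F, (mem_contract_stars.1 hF).1, h⟩
  · rintro ⟨F, hF, hs, hy⟩
    refine ⟨F, mem_contract_stars.2 ⟨hF, ?_⟩, hs, hy⟩
    obtain ⟨h1, v, hv, hvy⟩ := mem_contract_sinks.1 hy
    exact ⟨v, hv, hvy ▸ h1⟩

theorem sources_subset (hI : I.IsInstance) {Q : Finset ι} (hQ : Q ⊆ I.stars) :
    I.sources Q ⊆ I.verts := by
  intro v hv
  obtain ⟨F, hF, rfl⟩ := Finset.mem_image.1 hv
  exact hI.source_mem F (hQ hF)

theorem contract_isInstance (hI : I.IsInstance) (Q : Finset ι) (r : V) :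
    (I.contract Q r).IsInstance where
  source_mem F hF :=
    mem_contract_verts.2 ⟨_, hI.source_mem F (mem_contract_stars.1 hF).1, rfl⟩
  sinks_subset F hF x hx := by
    obtain ⟨-, v, hv, rfl⟩ := mem_contract_sinks.1 hx
    exact mem_contract_verts.2 ⟨v, hI.sinks_subset F (mem_contract_stars.1 hF).1 hv, rfl⟩
  sinks_nonempty F hF := by
    obtain ⟨-, v, hv, hne⟩ := mem_contract_stars.1 hF
    exact ⟨_, mem_contract_sinks.2 ⟨hne, v, hv, rfl⟩⟩
  source_notMem_sinks F hF hc := (mem_contract_sinks.1 hc).1 rfl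
  stronglyConnected := by
    refine ⟨hI.stronglyConnected.1.image _, ?_⟩
    intro x hx y hy
    obtain ⟨u, hu, rfl⟩ := mem_contract_verts.1 hx
    obtain ⟨v, hv, rfl⟩ := mem_contract_verts.1 hy
    have := hI.stronglyConnected.2 u hu v hv
    induction this with
    | refl => exact .refl
    | @tail c d _ hcd ih =>
      have hc := (mem_contract_verts (Q := Q) (r := r)).2 ⟨c, hcd.1, rfl⟩
      have hd := (mem_contract_verts (Q := Q) (r := r)).2 ⟨d, hcd.2.1, rfl⟩
      by_cases e : I.collapse Q r c = I.collapse Q r d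
      · exact e ▸ ih hcd.1 hc
      · exact (ih hcd.1 hc).tail ⟨hc, hd, (contract_arc_stars e).2 ⟨c, d, hcd.2.2, rfl, rfl⟩⟩

theorem contract_card (hI : I.IsInstance) {Q : Finset ι} {r : V} (hQ : I.IsQuasiperfect Q)
    (hr : r ∈ I.sources Q) : (I.contract Q r).verts.card + Q.card = I.verts.card + 1 := by
  have hsub := sources_subset hI hQ.1
  have hcard : (I.sources Q).card = Q.card := Finset.card_image_of_injOn hQ.2.1
  have e : (I.contract Q r).verts = insert r (I.verts \ I.sources Q) := by
    ext x
    rw [mem_contract_verts, Finset.mem_insert, Finset.mem_sdiff]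
    constructor
    · rintro ⟨v, hv, rfl⟩
      by_cases h : v ∈ I.sources Q
      · exact .inl (collapse_of_mem h)
      · rw [collapse_of_notMem h]; exact .inr ⟨hv, h⟩
    · rintro (rfl | ⟨hx, h⟩)
      · exact ⟨x, hsub hr, collapse_of_mem hr⟩
      · exact ⟨x, hx, collapse_of_notMem h⟩
  rw [e, Finset.card_insert_of_notMem (by simp [hr]), Finset.card_sdiff_of_subset hsub, hcard]
  have := Finset.card_le_card hsub
  omega

theorem IsPerfect.two_le_card (hI : I.IsInstance) {Q : Finset ι} (hQ : I.IsPerfect Q)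
    {r : V} (hr : r ∈ I.sources Q) : 2 ≤ Q.card := by
  have hcard : (I.sources Q).card = Q.card := Finset.card_image_of_injOn hQ.1.2.1
  obtain ⟨F, hF, rfl⟩ := Finset.mem_image.1 hr
  obtain ⟨v, hv⟩ := hI.sinks_nonempty F (hQ.1.1 hF)
  rw [← hcard]
  refine Finset.one_lt_card.2 ⟨_, hr, v, hQ.2 F hF hv, ?_⟩
  rintro rfl
  exact hI.source_notMem_sinks F (hQ.1.1 hF) hv

/-- A feasible solution of the contracted system lifts. -/
theorem isFeasible_union (hI : I.IsInstance) {Q R : Finset ι} {r : V} (hQ : I.IsQuasiperfect Q)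
    (hr : r ∈ I.sources Q) (hR : (I.contract Q r).IsFeasible R) : I.IsFeasible (Q ∪ R) := by
  have hRsub : R ⊆ I.stars := fun F hF => (mem_contract_stars.1 (hR.1 hF)).1
  have hsub := sources_subset hI hQ.1
  refine ⟨Finset.union_subset hQ.1 hRsub, hI.stronglyConnected.1, ?_⟩
  have hQpath : ∀ u ∈ I.sources Q, ∀ v ∈ I.sources Q,
      ReflTransGen (fun a c => a ∈ I.verts ∧ c ∈ I.verts ∧ I.Arc (Q ∪ R) a c) u v := by
    intro u hu v hv
    refine (hQ.2.2.2 u hu v hv).imp ?_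
    rintro a c ⟨ha, hc, F, hF, h⟩
    exact ⟨hsub ha, hsub hc, F, Finset.mem_union_left _ hF, h⟩
  -- Two vertices with the same image are equal or are both sources of `Q`. Each arc of the
  -- contracted solution lifts to an arc between fibres, and these connections join consecutive
  -- lifted arcs.
  have hfib : ∀ u v, I.collapse Q r u = I.collapse Q r v →
      ReflTransGen (fun a c => a ∈ I.verts ∧ c ∈ I.verts ∧ I.Arc (Q ∪ R) a c) u v := by
    intro u v huv
    by_cases hu : u ∈ I.sources Q <;> by_cases hv : v ∈ I.sources Q
    · exact hQpath u hu v hv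
    · rw [collapse_of_mem hu, collapse_of_notMem hv] at huv
      exact absurd (huv ▸ hr) hv
    · rw [collapse_of_mem hv, collapse_of_notMem hu] at huv
      exact absurd (huv ▸ hr) hu
    · rw [collapse_of_notMem hu, collapse_of_notMem hv] at huv
      rw [huv]
  intro u hu v hv
  have hp := hR.2.2 _ (mem_contract_verts.2 ⟨u, hu, rfl⟩) _ (mem_contract_verts.2 ⟨v, hv, rfl⟩)
  generalize hx : I.collapse Q r u = x at hp
  generalize hy : I.collapse Q r v = y at hp
  induction hp using ReflTransGen.head_induction_on generalizing u with
  | refl => exact hfib u v (hx.trans hy.symm)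
  | @head x z hxz _ ih =>
    obtain ⟨-, -, F, hF, hs, hz⟩ := hxz
    obtain ⟨-, w, hw, rfl⟩ := mem_contract_sinks.1 hz
    have hwv := hI.sinks_subset F (hRsub hF) hw
    exact (hfib u (I.source F) (hx.trans hs.symm)).trans
      (.head ⟨hI.source_mem F (hRsub hF), hwv, F, Finset.mem_union_right _ hF, rfl, hw⟩
        (ih w hwv rfl))

/-! ### Runs -/

theorem IsRun.isFeasible {l : List (Step V ι)} : ∀ {I : StarSystem V ι}, I.IsInstance →
    I.IsRun l → I.IsFeasible (chosen l) := by
  induction l with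
  | nil =>
    intro I hI hl
    refine ⟨by simp [chosen], hI.stronglyConnected.1, ?_⟩
    intro u hu v hv
    obtain ⟨a, ha⟩ := Finset.card_eq_one.1 (show I.verts.card = 1 from hl)
    rw [ha, Finset.mem_singleton] at hu hv
    rw [hu, hv]
  | cons s l ih =>
    intro I hI hl
    obtain ⟨-, ⟨-, hQ, hr, -⟩, hrun⟩ := hl
    have := isFeasible_union hI hQ.1 hr (ih (contract_isInstance hI _ _) hrun)
    simpa [chosen, List.toFinset_append] using this

/-- The constants come from `5q ≤ 6(q - 1) + 2c`, which is tight for `q = 4`, `c = 1` and for `q =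
2`, `c = 2`. Contraction lowers the number of vertices by `q - 1`, and the final vertex accounts for
the `6` on the left. -/
theorem IsRun.length_le {l : List (Step V ι)} : ∀ {I : StarSystem V ι}, I.IsInstance →
    I.IsRun l →
      5 * (l.flatMap Step.stars).length + 6 ≤ 6 * I.verts.card + 2 * (I.internalCuts l).length := by
  induction l with
  | nil =>
    intro I hI hl
    have : I.verts.card = 1 := hl
    simp [this]
  | cons s l ih =>
    intro I hI hl
    obtain ⟨-, ⟨hnd, hQ, hr, -, hc⟩, hrun⟩ := hl
    have h1 := ih (contract_isInstance hI _ _) hrun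
    have h2 := contract_card hI hQ.1 hr
    have h3 := hQ.two_le_card hI hr
    rw [List.toFinset_card_of_nodup hnd] at h2 h3
    simp only [List.flatMap_cons, List.length_append, internalCuts, List.length_map]
    rcases hc with ⟨h4, h5⟩ | ⟨S, T, h5, -⟩
    · omega
    · rw [h5]
      simp only [List.length_cons, List.length_nil]
      omega

theorem pullback_mem_cuts {Q : Finset ι} {r : V} {S : Finset V}
    (hS : S ∈ (I.contract Q r).cuts) :
    (I.verts.filter fun v => I.collapse Q r v ∈ S) ∈ I.cuts := by
  simp only [cuts, Finset.mem_filter, Finset.mem_powerset] at hS ⊢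
  obtain ⟨hsub, ⟨x, hx⟩, hne⟩ := hS
  refine ⟨Finset.filter_subset _ _, ?_, ?_⟩
  · obtain ⟨v, hv, rfl⟩ := mem_contract_verts.1 (hsub hx)
    exact ⟨v, Finset.mem_filter.2 ⟨hv, hx⟩⟩
  · intro e
    refine hne (hsub.antisymm fun y hy => ?_)
    obtain ⟨v, hv, rfl⟩ := mem_contract_verts.1 hy
    rw [← e] at hv
    exact (Finset.mem_filter.1 hv).2

theorem IsRun.internalCuts_mem {l : List (Step V ι)} : ∀ {I : StarSystem V ι}, I.IsRun l →
    ∀ S ∈ I.internalCuts l, S ∈ I.cuts := by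
  induction l with
  | nil => intro I _ S hS; simp [internalCuts] at hS
  | cons s l ih =>
    intro I hl S hS
    obtain ⟨-, ⟨-, -, -, hcut, -⟩, hrun⟩ := hl
    simp only [internalCuts, List.mem_append, List.mem_map] at hS
    rcases hS with ⟨S', hS', rfl⟩ | ⟨S', hS', rfl⟩
    · exact (hcut S' hS').1
    · exact pullback_mem_cuts (ih hrun S' hS')

theorem mem_crossing {S : Finset V} {F : ι} :
    F ∈ I.crossing S ↔ F ∈ I.stars ∧ I.source F ∈ S ∧ ∃ v ∈ I.sinks F, v ∈ I.verts ∧ v ∉ S := by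
  simp [crossing]

/-- The source and the witnessing sink have images on different sides of `S`, so this arc does not
become a loop and the star survives. -/
theorem crossing_pullback {Q : Finset ι} {r : V} {S : Finset V} {F : ι}
    (h : F ∈ I.crossing (I.verts.filter fun v => I.collapse Q r v ∈ S)) :
    F ∈ (I.contract Q r).crossing S := by
  obtain ⟨hF, hs, v, hv, hvV, hvS⟩ := mem_crossing.1 h
  have hs' := (Finset.mem_filter.1 hs).2
  have hv' : I.collapse Q r v ∉ S := fun hc => hvS (Finset.mem_filter.2 ⟨hvV, hc⟩)
  have hne : I.collapse Q r v ≠ I.collapse Q r (I.source F) := fun e => hv' (e ▸ hs')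
  exact mem_crossing.2 ⟨mem_contract_stars.2 ⟨hF, v, hv, hne⟩, hs', _,
    mem_contract_sinks.2 ⟨hne, v, hv, rfl⟩, mem_contract_verts.2 ⟨v, hvV, rfl⟩, hv'⟩

/-- The source and all sinks of the star are identified, so it loses all its arcs. Hence it can
cross no later cut. -/
theorem IsInternal.notMem_contract {Q : Finset ι} {r : V} {S : Finset V} {F : ι}
    (hS : I.IsInternal Q S) (hF : F ∈ I.crossing S) : F ∉ (I.contract Q r).stars := by
  intro hc
  obtain ⟨-, v, hv, hne⟩ := mem_contract_stars.1 hc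
  obtain ⟨h1, h2⟩ := hS F hF
  exact hne (by rw [collapse_of_mem h1, collapse_of_mem (h2 hv)])

theorem IsGoodStep.countP_le_one {s : Step V ι} (hs : I.IsGoodStep s) (F : ι) :
    (s.cuts.map List.toFinset).countP (fun S => F ∈ I.crossing S) ≤ 1 := by
  obtain ⟨-, -, -, -, h⟩ := hs
  rcases h with ⟨-, h⟩ | ⟨S, T, h, hd⟩
  · refine List.countP_le_length.trans ?_
    simp [h]
  · rw [h]
    have : ¬ (F ∈ I.crossing S.toFinset ∧ F ∈ I.crossing T.toFinset) := fun hc =>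
      Finset.disjoint_left.1 hd hc.1 hc.2
    by_cases h1 : F ∈ I.crossing S.toFinset <;> by_cases h2 : F ∈ I.crossing T.toFinset <;>
      simp_all

/-- Within one step, `F` crosses at most one of the cuts. If it crosses one, it is absent from the
contracted system and crosses none of the later cuts; otherwise the count for the rest of the run
applies, since crossing a pulled-back cut implies crossing the cut itself. -/
theorem IsRun.countP_le_one {l : List (Step V ι)} (F : ι) : ∀ {I : StarSystem V ι}, I.IsRun l →
    (I.internalCuts l).countP (fun S => F ∈ I.crossing S) ≤ 1 := by
  induction l with
  | nil => intro I _; simp [internalCuts]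
  | cons s l ih =>
    intro I hl
    obtain ⟨-, hgood, hrun⟩ := hl
    have h1 := hgood.countP_le_one F
    have h2 := ih hrun
    rw [internalCuts, List.countP_append]
    have h3 : (((I.contract s.stars.toFinset s.super).internalCuts l).map fun S =>
        I.verts.filter fun v => I.collapse s.stars.toFinset s.super v ∈ S).countP
          (fun S => F ∈ I.crossing S) ≤
        ((I.contract s.stars.toFinset s.super).internalCuts l).countP
          (fun S => F ∈ (I.contract s.stars.toFinset s.super).crossing S) := by
      rw [List.countP_map]
      refine List.countP_mono_left fun S _ hS => ?_
      simp only [Function.comp, decide_eq_true_eq] at hS ⊢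
      exact crossing_pullback hS
    by_cases h4 : (s.cuts.map List.toFinset).countP (fun S => F ∈ I.crossing S) = 0
    · omega
    · obtain ⟨S, hS, hFS⟩ := List.countP_pos_iff.1 (Nat.pos_of_ne_zero h4)
      obtain ⟨S', hS', rfl⟩ := List.mem_map.1 hS
      have hint := (hgood.2.2.2.1 S' hS').2
      have hno := hint.notMem_contract (r := s.super) (by simpa using hFS)
      have h5 : ((I.contract s.stars.toFinset s.super).internalCuts l).countP
          (fun S => F ∈ (I.contract s.stars.toFinset s.super).crossing S) = 0 := by
        refine List.countP_eq_zero.2 fun S _ hS => hno ?_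
        exact (mem_crossing.1 (by simpa using hS)).1
      omega

/-! ### Dual solutions -/

theorem sum_count_eq_countP {α : Type*} [DecidableEq α] (A : Finset α) (l : List α) :
    ∑ S ∈ A, (l.count S : ℝ) = (l.countP (fun S => S ∈ A) : ℝ) := by
  induction l with
  | nil => simp
  | cons a l ih =>
    simp only [List.count_cons, List.countP_cons, Nat.cast_add, Finset.sum_add_distrib, ih]
    congr 1
    by_cases ha : a ∈ A <;> simp [ha]

theorem IsRun.internalDual_feasible {l : List (Step V ι)} (hl : I.IsRun l) :
    I.IsDualFeasible (I.internalDual l) := by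
  refine ⟨fun S _ => Nat.cast_nonneg _, fun F _ => ?_⟩
  unfold internalDual
  rw [sum_count_eq_countP]
  have : (I.internalCuts l).countP (fun S => S ∈ I.cuts.filter fun S => F ∈ I.crossing S) ≤ 1 := by
    refine le_trans (List.countP_mono_left fun S _ hS => ?_) (hl.countP_le_one F)
    simp only [decide_eq_true_eq, Finset.mem_filter] at hS ⊢
    exact hS.2
  exact_mod_cast this

theorem IsRun.internalDual_value {l : List (Step V ι)} (hl : I.IsRun l) :
    I.dualValue (I.internalDual l) = (I.internalCuts l).length := by
  unfold dualValue internalDual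
  rw [sum_count_eq_countP]
  congr 1
  refine List.countP_eq_length.2 fun S hS => ?_
  simpa using hl.internalCuts_mem S hS

/-- A star crosses a cut only if its source lies in it, so the only possible one-vertex cut is the
source itself. -/
theorem singletonDual_feasible : I.IsDualFeasible (singletonDual) := by
  refine ⟨fun S _ => by unfold singletonDual; split_ifs <;> norm_num, fun F _ => ?_⟩
  unfold singletonDual
  rw [← Finset.sum_filter, Finset.sum_const, nsmul_eq_mul, mul_one]
  have : (((I.cuts.filter fun S => F ∈ I.crossing S).filter fun S => S.card = 1)).card ≤ 1 := by
    refine Finset.card_le_one.2 ?_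
    have key : ∀ S ∈ ((I.cuts.filter fun S => F ∈ I.crossing S).filter fun S => S.card = 1),
        S = {I.source F} := by
      intro S hS
      simp only [Finset.mem_filter] at hS
      obtain ⟨a, rfl⟩ := Finset.card_eq_one.1 hS.2
      have := (mem_crossing.1 hS.1.2).2.1
      rw [Finset.mem_singleton.1 this]
    intro S hS T hT
    rw [key S hS, key T hT]
  exact_mod_cast this

/-- Cuts are proper subsets, so with a single vertex there are none and the value would be `0`, not
`1`. -/
theorem singletonDual_value (hcard : I.verts.card ≠ 1) :
    I.dualValue singletonDual = I.verts.card := by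
  unfold dualValue singletonDual
  rw [← Finset.sum_filter, Finset.sum_const, nsmul_eq_mul, mul_one]
  congr 1
  have : (I.cuts.filter fun S => S.card = 1) = I.verts.image fun v => {v} := by
    ext S
    simp only [Finset.mem_filter, Finset.mem_image]
    constructor
    · rintro ⟨hS, h1⟩
      obtain ⟨a, rfl⟩ := Finset.card_eq_one.1 h1
      simp only [cuts, Finset.mem_filter, Finset.mem_powerset, Finset.singleton_subset_iff] at hS
      exact ⟨a, hS.1, rfl⟩
    · rintro ⟨v, hv, rfl⟩
      exact ⟨singleton_mem_cuts hv hcard, Finset.card_singleton v⟩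
  rw [this, Finset.card_image_of_injective _ Finset.singleton_injective]

theorem IsFeasible.exists_crossing {R : Finset ι} (hR : I.IsFeasible R) {S : Finset V}
    (hS : S ∈ I.cuts) : ∃ F ∈ R, F ∈ I.crossing S := by
  simp only [cuts, Finset.mem_filter, Finset.mem_powerset] at hS
  obtain ⟨hsub, ⟨u, hu⟩, hne⟩ := hS
  obtain ⟨v, hv, hvS⟩ : ∃ v ∈ I.verts, v ∉ S := by
    by_contra hc
    push Not at hc
    exact hne (hsub.antisymm hc)
  by_contra hno
  push Not at hno
  refine hvS ((hR.2.2 u (hsub hu) v hv).mem_of_closed hu ?_)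
  rintro a c ha ⟨-, hc, F, hF, rfl, hcF⟩
  by_contra hcS
  exact hno F hF (mem_crossing.2 ⟨hR.1 hF, ha, c, hcF, hc, hcS⟩)

/-- Weak duality. -/
theorem IsDualFeasible.value_le {y : Finset V → ℝ} (hy : I.IsDualFeasible y) {R : Finset ι}
    (hR : I.IsFeasible R) : I.dualValue y ≤ R.card := by
  calc I.dualValue y ≤ ∑ S ∈ I.cuts, ∑ F ∈ R, if F ∈ I.crossing S then y S else 0 := by
        refine Finset.sum_le_sum fun S hS => ?_
        obtain ⟨F, hF, hFS⟩ := hR.exists_crossing hS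
        refine le_trans (by rw [if_pos hFS]) (Finset.single_le_sum (f := fun F =>
          if F ∈ I.crossing S then y S else 0) (fun F _ => ?_) hF)
        split_ifs
        exacts [hy.1 S hS, le_rfl]
    _ = ∑ F ∈ R, ∑ S ∈ I.cuts with F ∈ I.crossing S, y S := by
        rw [Finset.sum_comm]
        exact Finset.sum_congr rfl fun F _ => (Finset.sum_filter _ _).symm
    _ ≤ ∑ F ∈ R, (1 : ℝ) := Finset.sum_le_sum fun F hF => hy.2 F (hR.1 hF)
    _ = R.card := by simp

theorem IsRun.card_chosen_le {l : List (Step V ι)} (hI : I.IsInstance) (hl : I.IsRun l) :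
    ((chosen l).card : ℝ) ≤ 8 / 5 * (3 / 4 * I.dualValue singletonDual +
      1 / 4 * I.dualValue (I.internalDual l)) := by
  cases l with
  | nil =>
    have h1 : 0 ≤ I.dualValue singletonDual :=
      Finset.sum_nonneg fun S hS => singletonDual_feasible.1 S hS
    rw [hl.internalDual_value]
    simp only [chosen, List.flatMap_nil, List.toFinset_nil, Finset.card_empty, internalCuts,
      List.length_nil, Nat.cast_zero]
    linarith
  | cons s l =>
    have h1 := hl.length_le hI
    have h2 : (chosen (s :: l)).card ≤ ((s :: l).flatMap Step.stars).length :=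
      List.toFinset_card_le _
    rw [hl.internalDual_value, singletonDual_value hl.1]
    have h1' : (5 * ((s :: l).flatMap Step.stars).length + 6 : ℝ) ≤
        6 * I.verts.card + 2 * (I.internalCuts (s :: l)).length := by exact_mod_cast h1
    have h2' : ((chosen (s :: l)).card : ℝ) ≤ ((s :: l).flatMap Step.stars).length := by
      exact_mod_cast h2
    -- Here `8/5 · 3/4 = 6/5` and `8/5 · 1/4 = 2/5`, so one fifth of the counting inequality is more
    -- than enough.
    linarith

theorem IsRun.card_chosen_le_feasible {l : List (Step V ι)} (hI : I.IsInstance) (hl : I.IsRun l)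
    {R : Finset ι} (hR : I.IsFeasible R) : ((chosen l).card : ℝ) ≤ 8 / 5 * (R.card : ℝ) := by
  have h1 := hl.card_chosen_le hI
  have h2 := (singletonDual_feasible (I := I)).value_le hR
  have h3 := hl.internalDual_feasible.value_le hR
  linarith

end StarSystem

/-! ### Programs with counting loops: meaning, frame rules and running time -/

namespace RAM

/-- Programs whose only loops are counting loops over `0, …, K - 1`, where `K` is the value of
register `0`. -/
inductive Prog where
  | skip
  | assign (x : ℕ) (e : Expr)
  | store (a : ℕ) (i e : Expr)
  | seq (p q : Prog)
  | ite (b : Expr) (p q : Prog)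
  | count (x : ℕ) (p : Prog)

namespace Prog

/-- The state after the program has run. -/
def den : Prog → State → State
  | skip, s => s
  | assign x e, s => s.setReg x (e.eval s)
  | store a i e, s => s.setArr a (i.eval s) (e.eval s)
  | seq p q, s => q.den (p.den s)
  | ite b p q, s => if b.eval s = 0 then q.den s else p.den s
  | count x p, s =>
      Nat.rec (s.setReg x 0) (fun i s' => (p.den s').setReg x (i + 1)) (s.reg 0)

/-- The registers that a program may write. -/
def regs : Prog → List ℕ
  | skip => []
  | assign x _ => [x]
  | store _ _ _ => []
  | seq p q => p.regs ++ q.regs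
  | ite _ p q => p.regs ++ q.regs
  | count x p => x :: p.regs

/-- The arrays that a program may write. -/
def arrs : Prog → List ℕ
  | skip => []
  | assign _ _ => []
  | store a _ _ => [a]
  | seq p q => p.arrs ++ q.arrs
  | ite _ p q => p.arrs ++ q.arrs
  | count _ p => p.arrs

/-- Register `0` is never written, and a loop body does not write the loop counter. -/
def WellFormed : Prog → Prop
  | skip => True
  | assign x _ => x ≠ 0
  | store _ _ _ => True
  | seq p q => p.WellFormed ∧ q.WellFormed
  | ite _ p q => p.WellFormed ∧ q.WellFormed
  | count x p => x ≠ 0 ∧ x ∉ p.regs ∧ p.WellFormed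

def compile : Prog → Cmd
  | skip => .skip
  | assign x e => .assign x e
  | store a i e => .store a i e
  | seq p q => .seq p.compile q.compile
  | ite b p q => .ite b p.compile q.compile
  | count x p => .seq (.assign x (.const 0)) (.loop (.lt (.reg x) (.reg 0))
      (.seq p.compile (.assign x (.add (.reg x) (.const 1)))))

/-- A bound for the number of steps as a polynomial in `K`. -/
noncomputable def time : Prog → Polynomial ℕ
  | skip => 1
  | assign _ e => Polynomial.C (e.cost + 1)
  | store _ i e => Polynomial.C (i.cost + e.cost + 1)
  | seq p q => p.time + q.time
  | ite b p q => Polynomial.C (b.cost + 1) + p.time + q.time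
  | count _ p => Polynomial.X * (p.time + 8) + 6

/-- Together with `den_arr` this is the frame rule. For a concrete program the list of written
registers is concrete, so most of the later side conditions are closed by `decide`. -/
theorem den_reg {p : Prog} : ∀ {s : State} {x : ℕ}, x ∉ p.regs → (p.den s).reg x = s.reg x := by
  induction p with
  | skip => intro s x _; rfl
  | assign y e =>
    intro s x hx
    simp only [regs, List.mem_singleton] at hx
    simp [den, State.setReg, hx]
  | store a i e => intro s x _; rfl
  | seq p q ihp ihq =>
    intro s x hx
    simp only [regs, List.mem_append, not_or] at hx
    simp only [den]
    rw [ihq hx.2, ihp hx.1]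
  | ite b p q ihp ihq =>
    intro s x hx
    simp only [regs, List.mem_append, not_or] at hx
    simp only [den]
    split_ifs
    exacts [ihq hx.2, ihp hx.1]
  | count y p ih =>
    intro s x hx
    simp only [regs, List.mem_cons, not_or] at hx
    simp only [den]
    generalize s.reg 0 = k
    induction k with
    | zero => simp [State.setReg, hx.1]
    | succ k ihk =>
      simp only [State.setReg, Function.update_of_ne hx.1]
      rw [ih hx.2]; exact ihk

theorem den_arr {p : Prog} : ∀ {s : State} {a : ℕ}, a ∉ p.arrs → (p.den s).arr a = s.arr a := by
  induction p with
  | skip => intro s x _; rfl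
  | assign y e => intro s x _; rfl
  | store a i e =>
    intro s x hx
    simp only [arrs, List.mem_singleton] at hx
    simp [den, State.setArr, hx]
  | seq p q ihp ihq =>
    intro s x hx
    simp only [arrs, List.mem_append, not_or] at hx
    simp only [den]
    rw [ihq hx.2, ihp hx.1]
  | ite b p q ihp ihq =>
    intro s x hx
    simp only [arrs, List.mem_append, not_or] at hx
    simp only [den]
    split_ifs
    exacts [ihq hx.2, ihp hx.1]
  | count y p ih =>
    intro s x hx
    simp only [den]
    generalize s.reg 0 = k
    induction k with
    | zero => rfl
    | succ k ihk =>
      simp only [State.setReg]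
      rw [ih hx]; exact ihk

theorem WellFormed.zero_notMem {p : Prog} (h : p.WellFormed) : 0 ∉ p.regs := by
  induction p with
  | skip => simp [regs]
  | assign y e => simpa [regs] using Ne.symm h
  | store a i e => simp [regs]
  | seq p q ihp ihq => simpa [regs] using ⟨ihp h.1, ihq h.2⟩
  | ite b p q ihp ihq => simpa [regs] using ⟨ihp h.1, ihq h.2⟩
  | count y p ih => simpa [regs] using ⟨Ne.symm h.1, ih h.2.2⟩

/-- The induction rule for counting loops. -/
theorem count_induct {p : Prog} {x : ℕ} {s : State} (P : ℕ → State → Prop)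
    (hwf : (count x p).WellFormed) (h0 : P 0 (s.setReg x 0))
    (hstep : ∀ i s', i < s.reg 0 → s'.reg x = i → s'.reg 0 = s.reg 0 →
      (∀ y, y ∉ x :: p.regs → s'.reg y = s.reg y) → (∀ a, a ∉ p.arrs → s'.arr a = s.arr a) →
      P i s' → P (i + 1) ((p.den s').setReg x (i + 1))) :
    P (s.reg 0) ((count x p).den s) := by
  have key : ∀ k ≤ s.reg 0, ∀ s', s' = Nat.rec (motive := fun _ => State) (s.setReg x 0)
      (fun i s' => (p.den s').setReg x (i + 1)) k → s'.reg x = k ∧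
      (∀ y, y ∉ x :: p.regs → s'.reg y = s.reg y) ∧ (∀ a, a ∉ p.arrs → s'.arr a = s.arr a) ∧
      P k s' := by
    intro k
    induction k with
    | zero =>
      rintro - s' rfl
      refine ⟨by simp [State.setReg], fun y hy => ?_, fun a _ => rfl, h0⟩
      simp only [List.mem_cons, not_or] at hy
      simp [State.setReg, hy.1]
    | succ k ih =>
      rintro hk s' rfl
      obtain ⟨h1, h2, h3, h4⟩ := ih (by omega) _ rfl
      refine ⟨by simp [State.setReg], fun y hy => ?_, fun a ha => ?_, ?_⟩
      · rw [← h2 y hy]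
        simp only [List.mem_cons, not_or] at hy
        simp only [State.setReg, Function.update_of_ne hy.1]
        exact den_reg hy.2
      · rw [← h3 a ha]
        exact den_arr ha
      · refine hstep k _ (by omega) h1 (h2 0 ?_) h2 h3 h4
        simp only [List.mem_cons, not_or]
        exact ⟨Ne.symm hwf.1, hwf.2.2.zero_notMem⟩
  exact (key (s.reg 0) le_rfl _ rfl).2.2.2

/-- The compiled loop reads the counter and register `0` afresh in each round. Well-formedness keeps
the body from changing either, so there are exactly `K` rounds, and the time of every subprogram is
evaluated at the same `K`. -/
theorem exec_compile {p : Prog} : p.WellFormed → ∀ s : State,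
    ∃ t ≤ p.time.eval (s.reg 0), Exec p.compile s t (p.den s) := by
  induction p with
  | skip => intro _ s; exact ⟨1, by simp [time], .skip s⟩
  | assign x e => intro _ s; exact ⟨_, by simp [time], .assign x e s⟩
  | store a i e => intro _ s; exact ⟨_, by simp [time], .store a i e s⟩
  | seq p q ihp ihq =>
    intro h s
    obtain ⟨t, ht, hp⟩ := ihp h.1 s
    obtain ⟨t', ht', hq⟩ := ihq h.2 (p.den s)
    rw [den_reg h.1.zero_notMem] at ht'
    exact ⟨t + t', by simpa [time] using Nat.add_le_add ht ht', .seq hp hq⟩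
  | ite b p q ihp ihq =>
    intro h s
    by_cases hb : b.eval s = 0
    · obtain ⟨t, ht, hq⟩ := ihq h.2 s
      refine ⟨b.cost + 1 + t, ?_, ?_⟩
      · simp only [time, Polynomial.eval_add, Polynomial.eval_C]; omega
      · rw [show (ite b p q).den s = q.den s by simp [den, hb]]
        exact .ite_false hb hq
    · obtain ⟨t, ht, hp⟩ := ihp h.1 s
      refine ⟨b.cost + 1 + t, ?_, ?_⟩
      · simp only [time, Polynomial.eval_add, Polynomial.eval_C]; omega
      · rw [show (ite b p q).den s = p.den s by simp [den, hb]]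
        exact .ite_true hb hp
  | count x p ih =>
    intro h s
    set T := p.time.eval (s.reg 0) with hT
    have hx0 : (0 : ℕ) ≠ x := Ne.symm h.1
    let body : Cmd := .seq p.compile (.assign x (.add (.reg x) (.const 1)))
    let σ : ℕ → State := fun k => Nat.rec (motive := fun _ => State) (s.setReg x 0)
      (fun i s' => (p.den s').setReg x (i + 1)) k
    have hσ : ∀ k, (σ k).reg x = k ∧ (σ k).reg 0 = s.reg 0 := by
      intro k
      induction k with
      | zero => simp [σ, State.setReg, hx0]
      | succ k ihk =>
        refine ⟨by simp [σ, State.setReg], ?_⟩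
        simp only [σ, State.setReg, Function.update_of_ne hx0]
        rw [den_reg h.2.2.zero_notMem]
        exact ihk.2
    -- Each round costs `4` for the test and `4` for the increment besides the body; the final
    -- failing test costs another `4`. Initialising the counter costs `2`, which explains the `6` in
    -- `time`.
    have hloop : ∀ m k, k + m = s.reg 0 → ∃ t ≤ m * (T + 8) + 4,
        Exec (.loop (.lt (.reg x) (.reg 0)) body) (σ k) t (σ (s.reg 0)) := by
      intro m
      induction m with
      | zero =>
        intro k hk
        obtain rfl : k = s.reg 0 := by omega
        refine ⟨_, ?_, .loop_false ?_⟩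
        · simp [Expr.cost]
        · simp [Expr.eval, (hσ (s.reg 0)).1, (hσ (s.reg 0)).2]
      | succ m ihm =>
        intro k hk
        obtain ⟨t, ht, hrest⟩ := ihm (k + 1) (by omega)
        obtain ⟨t', ht', hp⟩ := ih h.2.2 (σ k)
        rw [(hσ k).2] at ht'
        have hxk : (p.den (σ k)).reg x = k := by rw [den_reg h.2.1, (hσ k).1]
        have hbody : Exec body (σ k) (t' + 4) (σ (k + 1)) := by
          refine .seq hp ?_
          have := Exec.assign x (.add (.reg x) (.const 1)) (p.den (σ k))
          simp only [Expr.eval, Expr.cost, hxk] at this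
          exact this
        refine ⟨_, ?_, .loop_true ?_ hbody hrest⟩
        · simp only [Expr.cost]
          have : (m + 1) * (T + 8) = m * (T + 8) + (T + 8) := by ring
          omega
        · have : k < s.reg 0 := by omega
          simp [Expr.eval, (hσ k).1, (hσ k).2, this]
    obtain ⟨t, ht, hex⟩ := hloop (s.reg 0) 0 (by omega)
    refine ⟨2 + t, ?_, .seq (.assign x (.const 0) s) hex⟩
    have : (count x p).time.eval (s.reg 0) = s.reg 0 * (T + 8) + 6 := by
      simp [time, hT]
    omega

/-! ### Closure of a marked set -/

/-- Repeatedly marks in `A` the vertex `dst` if `src` is marked and `cond` holds for the arc `y`;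
when a vertex is marked, `val` is recorded in `B`. -/
def close (x y A B : ℕ) (cond src dst val : Expr) : Prog :=
  count x (count y (ite cond (ite (.load A src) (ite (.load A dst) skip
    (seq (store A dst (.const 1)) (store B dst val))) skip) skip))

/-- What `close` maintains: marked vertices stay marked, and each of them is linked by recorded
arcs to a vertex that was marked in the beginning. -/
structure CloseInv (A B : ℕ) (c : ℕ → Prop) (u w f : ℕ → ℕ) (s s' : State) : Prop where
  mono : ∀ v, s.arr A v ≠ 0 → s'.arr A v ≠ 0
  link : ∀ v < s.reg 0, s'.arr A v ≠ 0 → ∃ a < s.reg 0, s.arr A a ≠ 0 ∧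
    ReflTransGen (fun b a => s'.arr A b ≠ 0 ∧ ∃ e < s.reg 0, c e ∧ w e = b ∧ u e = a ∧
      s'.arr B b = f e) v a
  frame : ∀ v, s.arr A v ≠ 0 ∨ s'.arr A v = 0 → s'.arr B v = s.arr B v

/-- The new vertex was unmarked, so no record of a marked vertex is overwritten and all old links
survive. The new link goes along `e` to `u e`, which was already marked. -/
theorem CloseInv.mark {A B : ℕ} {c : ℕ → Prop} {u w f : ℕ → ℕ} {s s' s'' : State}
    (h : CloseInv A B c u w f s s') {e : ℕ} (he : e < s.reg 0) (hc : c e)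
    (hu : u e < s.reg 0) (hsrc : s'.arr A (u e) ≠ 0) (hdst : s'.arr A (w e) = 0)
    (hA : s''.arr A = Function.update (s'.arr A) (w e) 1)
    (hB : s''.arr B = Function.update (s'.arr B) (w e) (f e)) :
    CloseInv A B c u w f s s'' := by
  have hm : ∀ v, s'.arr A v ≠ 0 → s''.arr A v ≠ 0 ∧ s''.arr B v = s'.arr B v := by
    intro v hv
    have : v ≠ w e := fun e' => hv (e' ▸ hdst)
    rw [hA, hB, Function.update_of_ne this, Function.update_of_ne this]
    exact ⟨hv, rfl⟩
  have hold : ∀ v < s.reg 0, s'.arr A v ≠ 0 → ∃ a < s.reg 0, s.arr A a ≠ 0 ∧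
    ReflTransGen (fun b a => s''.arr A b ≠ 0 ∧ ∃ e < s.reg 0, c e ∧ w e = b ∧ u e = a ∧
      s''.arr B b = f e) v a := by
    intro v hv hv'
    obtain ⟨a, ha, ha', hp⟩ := h.link v hv hv'
    refine ⟨a, ha, ha', hp.imp ?_⟩
    rintro x y ⟨hx, e', he', hc', h1, h2, h3⟩
    exact ⟨(hm x hx).1, e', he', hc', h1, h2, (hm x hx).2.trans h3⟩
  refine ⟨fun v hv => (hm v (h.mono v hv)).1, ?_, ?_⟩
  · intro v hv hv'
    by_cases hvw : v = w e
    · obtain ⟨a, ha, ha', hp⟩ := hold (u e) hu hsrc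
      refine ⟨a, ha, ha', .head ⟨hv', e, he, hc, hvw.symm, rfl, ?_⟩ hp⟩
      rw [hB, hvw, Function.update_self]
    · rw [hA, Function.update_of_ne hvw] at hv'
      exact hold v hv hv'
  · intro v hv
    have hvw : v ≠ w e := by
      rintro rfl
      rcases hv with hv | hv
      · exact h.mono _ hv hdst
      · rw [hA, Function.update_self] at hv; exact one_ne_zero hv
    rw [hB, Function.update_of_ne hvw]
    rw [hA, Function.update_of_ne hvw] at hv
    exact h.frame v hv

section Close

variable {x y A B : ℕ} {cond src dst val : Expr} {c : ℕ → Prop} {u w f : ℕ → ℕ} {s : State}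

/-- The expressions of `close` evaluate as described, whatever `close` changes. -/
def CloseSpec (x y A B : ℕ) (cond src dst val : Expr) (c : ℕ → Prop) (u w f : ℕ → ℕ)
    (s : State) : Prop :=
  ∀ s' : State, (∀ z, z ≠ x → z ≠ y → s'.reg z = s.reg z) →
    (∀ a, a ≠ A → a ≠ B → s'.arr a = s.arr a) → s'.reg y < s.reg 0 →
    (cond.eval s' ≠ 0 ↔ c (s'.reg y)) ∧ src.eval s' = u (s'.reg y) ∧ dst.eval s' = w (s'.reg y) ∧
      val.eval s' = f (s'.reg y)

theorem close_wellFormed (hx : x ≠ 0) (hy : y ≠ 0) (hxy : x ≠ y) :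
    (close x y A B cond src dst val).WellFormed := by
  simp [close, WellFormed, regs, hx, hy, hxy]

/-- One scan over the arcs handles every arc whose `u`-end was marked when the scan began, because
marks are never removed. If the marked set was closed at the beginning, the scan marks nothing. -/
theorem close_round (hx : x ≠ 0) (hy : y ≠ 0) (hxy : x ≠ y) (hAB : A ≠ B)
    (hspec : CloseSpec x y A B cond src dst val c u w f s)
    (hu : ∀ e < s.reg 0, u e < s.reg 0) {s₀ : State} (h0 : s₀.reg 0 = s.reg 0)
    (hr : ∀ z, z ≠ x → z ≠ y → s₀.reg z = s.reg z)
    (ha : ∀ a, a ≠ A → a ≠ B → s₀.arr a = s.arr a) (hinv : CloseInv A B c u w f s s₀)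
    {s₁ : State} (hs₁ : s₁ = (count y (ite cond (ite (.load A src) (ite (.load A dst) skip
      (seq (store A dst (.const 1)) (store B dst val))) skip) skip)).den s₀) :
    CloseInv A B c u w f s s₁ ∧ (∀ v, s₀.arr A v ≠ 0 → s₁.arr A v ≠ 0) ∧
      (∀ e < s.reg 0, c e → s₀.arr A (u e) ≠ 0 → s₁.arr A (w e) ≠ 0) ∧
      ((∀ e < s.reg 0, c e → s₀.arr A (u e) ≠ 0 → s₀.arr A (w e) ≠ 0) → s₁.arr A = s₀.arr A) := by
  have hwf := (close_wellFormed (A := A) (B := B) (cond := cond) (src := src) (dst := dst)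
    (val := val) hx hy hxy).2.2
  subst hs₁
  have := count_induct (s := s₀) (P := fun j s' => CloseInv A B c u w f s s' ∧
    (∀ v, s₀.arr A v ≠ 0 → s'.arr A v ≠ 0) ∧
    (∀ e < j, c e → s₀.arr A (u e) ≠ 0 → s'.arr A (w e) ≠ 0) ∧
    ((∀ e < s.reg 0, c e → s₀.arr A (u e) ≠ 0 → s₀.arr A (w e) ≠ 0) → s'.arr A = s₀.arr A))
    hwf ⟨⟨hinv.1, hinv.2, hinv.3⟩, fun v hv => hv, fun e he => absurd he (by omega), fun _ => rfl⟩ ?_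
  · rwa [h0] at this
  intro j s' hj hyj _ hr' ha' ⟨hI, hmono, hdone, hstable⟩
  rw [h0] at hj
  have hr'' : ∀ z, z ≠ x → z ≠ y → s'.reg z = s.reg z := by
    intro z hzx hzy
    rw [hr' z (by simp [regs, hzy]), hr z hzx hzy]
  have ha'' : ∀ a, a ≠ A → a ≠ B → s'.arr a = s.arr a := by
    intro a haA haB
    rw [ha' a (by simp [arrs, haA, haB]), ha a haA haB]
  obtain ⟨hc, hsrc, hdst, hval⟩ := hspec s' hr'' ha'' (by omega)
  rw [hyj] at hc hsrc hdst hval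
  have same : ∀ s'' : State, s''.arr A = s'.arr A → s''.arr B = s'.arr B →
      (c j → s₀.arr A (u j) ≠ 0 → s'.arr A (w j) ≠ 0) →
      CloseInv A B c u w f s s'' ∧ (∀ v, s₀.arr A v ≠ 0 → s''.arr A v ≠ 0) ∧
        (∀ e < j + 1, c e → s₀.arr A (u e) ≠ 0 → s''.arr A (w e) ≠ 0) ∧
        ((∀ e < s.reg 0, c e → s₀.arr A (u e) ≠ 0 → s₀.arr A (w e) ≠ 0) →
          s''.arr A = s₀.arr A) := by
    intro s'' hA hB hj'
    refine ⟨⟨?_, ?_, ?_⟩, ?_, ?_, ?_⟩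
    · rw [hA]; exact hI.1
    · rw [hA, hB]; exact hI.2
    · rw [hA, hB]; exact hI.3
    · rw [hA]; exact hmono
    · rw [hA]
      intro e he hce hue
      rcases Nat.lt_succ_iff_lt_or_eq.1 he with h | rfl
      exacts [hdone e h hce hue, hj' hce hue]
    · rw [hA]; exact hstable
  simp only [den]
  split_ifs with h1 h2 h3
  · exact same _ rfl rfl fun hcj => absurd h1 (hc.2 hcj)
  · refine same _ rfl rfl fun _ h => absurd ?_ (hmono _ h)
    simpa [Expr.eval, hsrc] using h2
  · have hd : s'.arr A (w j) = 0 := by simpa [Expr.eval, hdst] using h3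
    have hs : s'.arr A (u j) ≠ 0 := by simpa [Expr.eval, hsrc] using h2
    have hcj := hc.1 h1
    have hspec2 := hspec (s'.setArr A (dst.eval s') 1) hr''
      (by intro a haA haB; simp [State.setArr, haA, ha'' a haA haB]) (by
        simp only [State.setArr]; omega)
    have e1 : (Expr.const 1).eval s' = 1 := rfl
    rw [e1]
    generalize hs2 : s'.setArr A (dst.eval s') 1 = s2 at hspec2 ⊢
    have hr2 : s2.reg y = j := by rw [← hs2]; exact hyj
    rw [hr2] at hspec2
    obtain ⟨-, -, hdst2, hval2⟩ := hspec2
    rw [hdst2, hval2]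
    have hA : ((s2.setArr B (w j) (f j)).setReg y (j + 1)).arr A =
        Function.update (s'.arr A) (w j) 1 := by
      simp [← hs2, State.setReg, State.setArr, hAB, hdst]
    have hB : ((s2.setArr B (w j) (f j)).setReg y (j + 1)).arr B =
        Function.update (s'.arr B) (w j) (f j) := by
      simp [← hs2, State.setReg, State.setArr, hAB.symm]
    generalize ((s2.setArr B (w j) (f j)).setReg y (j + 1)) = s3 at hA hB ⊢
    refine ⟨hI.mark hj hcj (hu j hj) hs hd hA hB, ?_, ?_, ?_⟩
    · intro v hv
      rw [hA]
      by_cases hvw : v = w j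
      · rw [hvw, Function.update_self]; exact one_ne_zero
      · rw [Function.update_of_ne hvw]; exact hmono v hv
    · intro e he hce hue
      rw [hA]
      by_cases hvw : w e = w j
      · rw [hvw, Function.update_self]; exact one_ne_zero
      · rw [Function.update_of_ne hvw]
        rcases Nat.lt_succ_iff_lt_or_eq.1 he with h | rfl
        exacts [hdone e h hce hue, absurd rfl hvw]
    · intro hcl
      have := hstable hcl
      rw [this] at hd hs
      exact absurd hd (hcl j hj hcj hs)
  · refine same _ rfl rfl fun _ _ => ?_
    simpa [Expr.eval, hdst] using h3

/-- After `close`, exactly the vertices reachable from the marked ones are marked. -/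
theorem close_spec (hx : x ≠ 0) (hy : y ≠ 0) (hxy : x ≠ y) (hAB : A ≠ B)
    (hspec : CloseSpec x y A B cond src dst val c u w f s)
    (hu : ∀ e < s.reg 0, u e < s.reg 0) (hw : ∀ e < s.reg 0, w e < s.reg 0)
    {s' : State} (hs' : s' = (close x y A B cond src dst val).den s) :
    CloseInv A B c u w f s s' ∧
      (∀ e < s.reg 0, c e → s'.arr A (u e) ≠ 0 → s'.arr A (w e) ≠ 0) := by
  subst hs'
  have hwf := close_wellFormed (A := A) (B := B) (cond := cond) (src := src) (dst := dst)
    (val := val) hx hy hxy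
  let M : State → Finset ℕ := fun s' => (Finset.range (s.reg 0)).filter fun v => s'.arr A v ≠ 0
  let C : State → Prop := fun s' => ∀ e < s.reg 0, c e → s'.arr A (u e) ≠ 0 → s'.arr A (w e) ≠ 0
  -- After `j` rounds the marked set is closed or has at least `j` elements: a round that starts
  -- with an open set marks something new. After `K` rounds the second case means that all numbers
  -- below `K` are marked, so the set is closed anyway.
  have := count_induct (s := s) (P := fun j s' => CloseInv A B c u w f s s' ∧
    (C s' ∨ j ≤ (M s').card)) hwf
    ⟨⟨fun v hv => hv, fun v hv hv' => ⟨v, hv, hv', .refl⟩, fun _ _ => rfl⟩, .inr (Nat.zero_le _)⟩ ?_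
  · obtain ⟨hI, h | h⟩ := this
    · exact ⟨hI, h⟩
    · refine ⟨hI, fun e he _ _ => ?_⟩
      have : M ((close x y A B cond src dst val).den s) = Finset.range (s.reg 0) :=
        Finset.eq_of_subset_of_card_le (Finset.filter_subset _ _) (by rw [Finset.card_range]; exact h)
      have hmem := Finset.mem_range.2 (hw e he)
      rw [← this] at hmem
      exact (Finset.mem_filter.1 hmem).2
  intro j s₀ hj hxj h0 hr ha ⟨hI, hor⟩
  obtain ⟨g1, g2, g3, g4⟩ := close_round hx hy hxy hAB hspec hu (s₀ := s₀) h0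
    (fun z h1 h2 => hr z (by simp [regs, h1, h2])) (fun a h1 h2 => ha a (by simp [arrs, h1, h2]))
    hI rfl
  generalize Prog.den _ s₀ = s₁ at g1 g2 g3 g4 ⊢
  refine ⟨⟨g1.1, g1.2, g1.3⟩, ?_⟩
  by_cases hC : C s₀
  · left
    intro e he hc hue
    have := g4 hC
    simp only [State.setReg, this] at hue ⊢
    exact hC e he hc hue
  · have hor' := hor.resolve_left hC
    by_cases hC' : C s₁
    · exact .inl hC'
    · right
      have hlt : M s₀ ⊂ M s₁ := by
        refine (Finset.ssubset_iff_of_subset ?_).2 ?_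
        · intro v hv
          obtain ⟨h1, h2⟩ := Finset.mem_filter.1 hv
          exact Finset.mem_filter.2 ⟨h1, g2 v h2⟩
        · simp only [C] at hC
          push Not at hC
          obtain ⟨e, he, hce, hue, hwe⟩ := hC
          refine ⟨w e, Finset.mem_filter.2 ⟨Finset.mem_range.2 (hw e he), g3 e he hce hue⟩, ?_⟩
          simp [M, hwe]
      have := Finset.card_lt_card hlt
      exact (by omega : j + 1 ≤ (M s₁).card)

end Close

end Prog

open Prog

/-! ### The program

Registers: `1`–`5` parser (position, mode, remaining sinks, source, star), `6` iteration, `7` number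
of cuts found, `8` end of the path, `9` next vertex, `10`–`14` counters of the search, `15`
supervertex, `16`–`18` counters (round, arc, vertex), `19` test flag, `20` size of the perfect set,
`21` test flag, `22` output position, `23` number of steps, `24` length of a list.

Arrays: `0` input, `1` output, `2` star, `3` source and `4` sink of an arc, `5` vertices of the
current system, `6` vertices on the path, `7` stars on the path, `8` vertices with a path to the
supervertex, `9` vertex set of the perfect set, `10` second cut, `11` kept stars, `12` assigned
stars, `13` selected stars, `14` scratch. A star `F` is stored as `F + 1`. -/

abbrev arcStar : Expr := .load 2 (.reg 17)
abbrev arcTail : Expr := .load 3 (.reg 17)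
abbrev arcHead : Expr := .load 4 (.reg 17)

/-- Starts the path at some vertex of the current system. -/
def pathInit : Prog :=
  .seq (.count 18 (.seq (.store 6 (.reg 18) (.const 0)) (.seq (.store 7 (.reg 18) (.const 0))
    (.ite (.load 5 (.reg 18)) (.assign 8 (.reg 18)) .skip)))) (.store 6 (.reg 8) (.const 1))

/-- Looks for an arc from the end of the path to a new vertex. -/
def pathScan : Prog :=
  .count 17 (.ite (.eq arcTail (.reg 8)) (.ite (.load 6 arcHead) .skip
    (.seq (.store 7 (.reg 8) (.add arcStar (.const 1))) (.assign 9 arcHead))) .skip)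

def pathGrow : Prog :=
  .count 16 (.seq (.assign 9 (.reg 8)) (.seq pathScan
    (.seq (.assign 8 (.reg 9)) (.store 6 (.reg 8) (.const 1)))))

def path : Prog := .seq pathInit pathGrow

/-! ### Arcs in arrays and the maximal path -/

/-- The arrays of `s` represent the system `I`: the arcs that are not loops are those of `I`. -/
structure Represents (s : State) (I : StarSystem ℕ ℕ) : Prop where
  verts : ∀ v, v ∈ I.verts ↔ v < s.reg 0 ∧ s.arr 5 v ≠ 0
  arcs : ∀ F u v, u ≠ v → ((∃ e < s.reg 0, s.arr 2 e = F ∧ s.arr 3 e = u ∧ s.arr 4 e = v) ↔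
    F ∈ I.stars ∧ I.source F = u ∧ v ∈ I.sinks F)
  star_lt : ∀ e < s.reg 0, s.arr 2 e < s.reg 0
  tail_lt : ∀ e < s.reg 0, s.arr 3 e < s.reg 0
  head_lt : ∀ e < s.reg 0, s.arr 4 e < s.reg 0

theorem Represents.congr {s s' : State} {I : StarSystem ℕ ℕ} (h : Represents s I)
    (h0 : s'.reg 0 = s.reg 0) (h2 : s'.arr 2 = s.arr 2) (h3 : s'.arr 3 = s.arr 3)
    (h4 : s'.arr 4 = s.arr 4) (h5 : s'.arr 5 = s.arr 5) : Represents s' I := by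
  refine ⟨?_, ?_, ?_, ?_, ?_⟩ <;> simp only [h0, h2, h3, h4, h5]
  exacts [h.verts, h.arcs, h.star_lt, h.tail_lt, h.head_lt]

theorem Represents.vert_lt {s : State} {I : StarSystem ℕ ℕ} (h : Represents s I) {v : ℕ}
    (hv : v ∈ I.verts) : v < s.reg 0 := ((h.verts v).1 hv).1

theorem Represents.arc_of {s : State} {I : StarSystem ℕ ℕ} (h : Represents s I) {e : ℕ}
    (he : e < s.reg 0) (hne : s.arr 3 e ≠ s.arr 4 e) : s.arr 2 e ∈ I.stars ∧
      I.source (s.arr 2 e) = s.arr 3 e ∧ s.arr 4 e ∈ I.sinks (s.arr 2 e) :=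
  (h.arcs _ _ _ hne).1 ⟨e, he, rfl, rfl, rfl⟩

theorem Represents.exists_arc {s : State} {I : StarSystem ℕ ℕ} (hI : I.IsInstance)
    (h : Represents s I) {F v : ℕ} (hF : F ∈ I.stars) (hv : v ∈ I.sinks F) :
    I.source F ≠ v ∧ ∃ e < s.reg 0, s.arr 2 e = F ∧ s.arr 3 e = I.source F ∧ s.arr 4 e = v := by
  have hne : I.source F ≠ v := fun e => hI.source_notMem_sinks F hF (e ▸ hv)
  exact ⟨hne, (h.arcs _ _ _ hne).2 ⟨hF, rfl, hv⟩⟩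

/-- The partial assignment of stars stored in the array `a`. -/
def assigned (s : State) (a u : ℕ) : Option ℕ :=
  if u < s.reg 0 then Nat.ppred (s.arr a u) else none

theorem ppred_eq_some {n m : ℕ} : Nat.ppred n = some m ↔ n = m + 1 := by
  cases n <;> simp [Nat.ppred, eq_comm]

theorem ppred_eq_none {n : ℕ} : Nat.ppred n = none ↔ n = 0 := by
  cases n <;> simp [Nat.ppred]

theorem ite_one_zero_eq_zero {p : Prop} [Decidable p] : (if p then 1 else 0) = 0 ↔ ¬ p := by
  by_cases h : p <;> simp [h]

theorem pathInit_spec {s : State} {I : StarSystem ℕ ℕ} (hI : I.IsInstance) (h : Represents s I) :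
    (pathInit.den s).reg 8 ∈ I.verts ∧ (∀ v < s.reg 0, (pathInit.den s).arr 7 v = 0) ∧
      ∀ v < s.reg 0, (pathInit.den s).arr 6 v ≠ 0 ↔ v = (pathInit.den s).reg 8 := by
  have key := count_induct (x := 18) (s := s) (p := .seq (.store 6 (.reg 18) (.const 0))
    (.seq (.store 7 (.reg 18) (.const 0)) (.ite (.load 5 (.reg 18)) (.assign 8 (.reg 18)) .skip)))
    (P := fun j s' => (∀ v < j, s'.arr 6 v = 0 ∧ s'.arr 7 v = 0) ∧
      ((∃ v < j, s.arr 5 v ≠ 0) → s'.reg 8 < j ∧ s.arr 5 (s'.reg 8) ≠ 0))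
    (by simp [WellFormed, regs]) (by simp) (by
      intro j s' hj hx _ _ ha ⟨h1, h2⟩
      have h5 : s'.arr 5 = s.arr 5 := ha 5 (by decide)
      constructor
      · intro v hv
        have : v = j ∨ v < j := by omega
        simp only [den, Expr.eval, State.setReg, State.setArr, hx]
        split_ifs <;> rcases this with rfl | hlt <;>
          simp_all [Function.update_apply]
      · simp only [den, Expr.eval, State.setReg, State.setArr, hx]
        rintro ⟨v, hv, hv5⟩
        split_ifs with h6
        · simp [h5] at h6
          have : v < j := by
            rcases Nat.lt_succ_iff_lt_or_eq.1 hv with h | rfl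
            exacts [h, absurd h6 hv5]
          have := h2 ⟨v, this, hv5⟩
          simp only [ne_eq, Nat.reduceEqDiff, not_false_eq_true,
            Function.update_of_ne]
          exact ⟨by omega, this.2⟩
        · simp [h5] at h6
          simp [h6])
  obtain ⟨v, hv⟩ := hI.stronglyConnected.1
  obtain ⟨k1, k2⟩ := key
  obtain ⟨k2, k3⟩ := k2 ⟨v, (h.verts v).1 hv⟩
  unfold pathInit
  simp only [den]
  simp only [den] at k1 k2 k3
  generalize Nat.rec (motive := fun _ => State) _ _ _ = s' at k1 k2 k3 ⊢
  refine ⟨(h.verts _).2 ⟨k2, k3⟩, ?_, ?_⟩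
  · intro v hv
    simpa [State.setArr] using (k1 v hv).2
  · intro v hv
    simp only [State.setArr, Expr.eval, Function.update_self]
    by_cases e : v = s'.reg 8
    · simp [e]
    · simp [e, (k1 v hv).1]

/-- If several arcs qualify, each overwrites both the star and the next vertex, so that at the end
both come from the same arc. -/
theorem pathScan_spec {s : State} :
    (∀ a, a ≠ 7 → (pathScan.den s).arr a = s.arr a) ∧
    (((pathScan.den s).reg 9 = s.reg 9 ∧ (pathScan.den s).arr 7 = s.arr 7 ∧
        ∀ e < s.reg 0, s.arr 3 e = s.reg 8 → s.arr 6 (s.arr 4 e) ≠ 0) ∨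
      ∃ e < s.reg 0, s.arr 3 e = s.reg 8 ∧ s.arr 6 (s.arr 4 e) = 0 ∧
        (pathScan.den s).reg 9 = s.arr 4 e ∧
        (pathScan.den s).arr 7 = Function.update (s.arr 7) (s.reg 8) (s.arr 2 e + 1)) := by
  refine ⟨fun a ha => den_arr (by simp [pathScan, arrs, ha]), ?_⟩
  refine count_induct (x := 17) (s := s) (P := fun j s' => (s'.reg 9 = s.reg 9 ∧
        s'.arr 7 = s.arr 7 ∧ ∀ e < j, s.arr 3 e = s.reg 8 → s.arr 6 (s.arr 4 e) ≠ 0) ∨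
      ∃ e < j, s.arr 3 e = s.reg 8 ∧ s.arr 6 (s.arr 4 e) = 0 ∧ s'.reg 9 = s.arr 4 e ∧
        s'.arr 7 = Function.update (s.arr 7) (s.reg 8) (s.arr 2 e + 1))
    (by simp [WellFormed, regs]) (by simp [State.setReg]) ?_
  intro j s' hj hx _ hr ha hor
  have h2 : s'.arr 2 = s.arr 2 := ha 2 (by decide)
  have h3 : s'.arr 3 = s.arr 3 := ha 3 (by decide)
  have h4 : s'.arr 4 = s.arr 4 := ha 4 (by decide)
  have h6 : s'.arr 6 = s.arr 6 := ha 6 (by decide)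
  have h8 : s'.reg 8 = s.reg 8 := hr 8 (by decide)
  have lift : (s.arr 3 j = s.reg 8 → s.arr 6 (s.arr 4 j) ≠ 0) →
      ((s'.setReg 17 (j + 1)).reg 9 = s.reg 9 ∧ (s'.setReg 17 (j + 1)).arr 7 = s.arr 7 ∧
        ∀ e < j + 1, s.arr 3 e = s.reg 8 → s.arr 6 (s.arr 4 e) ≠ 0) ∨
      ∃ e < j + 1, s.arr 3 e = s.reg 8 ∧ s.arr 6 (s.arr 4 e) = 0 ∧
        (s'.setReg 17 (j + 1)).reg 9 = s.arr 4 e ∧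
        (s'.setReg 17 (j + 1)).arr 7 = Function.update (s.arr 7) (s.reg 8) (s.arr 2 e + 1) := by
    intro hj'
    rcases hor with ⟨a1, a2, a3⟩ | ⟨e, he, a⟩
    · refine .inl ⟨by simpa [State.setReg] using a1, a2, fun e he => ?_⟩
      rcases Nat.lt_succ_iff_lt_or_eq.1 he with h | rfl
      exacts [a3 e h, hj']
    · exact .inr ⟨e, by omega, by simpa [State.setReg] using a⟩
  simp only [den, Expr.eval, hx, h2, h3, h4, h6, h8, ite_one_zero_eq_zero, ite_not]
  split_ifs with c1 c2
  · refine .inr ⟨j, by omega, c1, c2, ?_, ?_⟩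
    · simp [State.setReg, State.setArr, hx, h4]
    · rcases hor with ⟨-, a2, -⟩ | ⟨e, -, -, -, -, a2⟩ <;> simp [State.setReg, State.setArr, a2]
  · exact lift fun _ => c2
  · exact lift fun e => absurd e c1

/-- The path that `pathGrow` has built. -/
structure PathInv (s : State) (I : StarSystem ℕ ℕ) (p : ℕ → ℕ) (k : ℕ) (s' : State) : Prop where
  last : p k = s'.reg 8
  mem : ∀ i ≤ k, p i ∈ I.verts
  inj : ∀ i ≤ k, ∀ j ≤ k, p i = p j → i = j
  step : ∀ i < k, ∃ F ∈ I.stars, s'.arr 7 (p i) = F + 1 ∧ I.source F = p i ∧ p (i + 1) ∈ I.sinks F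
  support : ∀ u < s.reg 0, s'.arr 7 u ≠ 0 → ∃ i < k, p i = u
  visited : ∀ u < s.reg 0, s'.arr 6 u ≠ 0 ↔ ∃ i ≤ k, p i = u

theorem pathGrow_spec {s : State} {I : StarSystem ℕ ℕ} (hI : I.IsInstance) (h : Represents s I)
    (hb : s.reg 8 ∈ I.verts) (h7 : ∀ v < s.reg 0, s.arr 7 v = 0)
    (h6 : ∀ v < s.reg 0, s.arr 6 v ≠ 0 ↔ v = s.reg 8) :
    ∃ p k, PathInv s I p k (pathGrow.den s) ∧ ∀ e < s.reg 0, s.arr 3 e = (pathGrow.den s).reg 8 →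
      (pathGrow.den s).arr 6 (s.arr 4 e) ≠ 0 := by
  have key := count_induct (x := 16) (s := s) (p := .seq (.assign 9 (.reg 8)) (.seq pathScan
    (.seq (.assign 8 (.reg 9)) (.store 6 (.reg 8) (.const 1)))))
    (P := fun j s' => ∃ p k, PathInv s I p k s' ∧ (j ≤ k ∨
      ∀ e < s.reg 0, s.arr 3 e = s'.reg 8 → s'.arr 6 (s.arr 4 e) ≠ 0))
    (by simp [WellFormed, regs, pathScan])
    ⟨fun _ => s.reg 8, 0, ⟨by simp [State.setReg], fun _ _ => hb, by omega, by omega,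
      fun u hu hc => absurd (h7 u hu) hc, fun u hu => by
        simp only [State.setReg]
        rw [h6 u hu]
        constructor
        · rintro rfl; exact ⟨0, le_rfl, rfl⟩
        · rintro ⟨_, _, e⟩; exact e.symm⟩, .inl le_rfl⟩ ?_
  · obtain ⟨p, k, hP, hk | hm⟩ := key
    -- A path of length at least `K` would have more than `K` distinct vertices, all below `K`. So
    -- after `K` rounds the path has become maximal.
    · exfalso
      have hcard : (Finset.range (s.reg 0)).card < (Finset.range (s.reg 0 + 1)).card := by simp
      obtain ⟨i, hi, j, hj, hij, e⟩ := Finset.exists_ne_map_eq_of_card_lt_of_maps_to hcard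
        (f := p) (fun i hi => by
          have := Finset.mem_range.1 (Finset.mem_coe.1 hi)
          exact Finset.mem_coe.2 (Finset.mem_range.2 (h.vert_lt (hP.mem i (by omega)))))
      have := Finset.mem_range.1 hi
      have := Finset.mem_range.1 hj
      exact hij (hP.inj i (by omega) j (by omega) e)
    · exact ⟨p, k, hP, hm⟩
  intro j s₀ hj hx h0 hr ha ⟨p, k, hP, hor⟩
  have a2 : s₀.arr 2 = s.arr 2 := ha 2 (by decide)
  have a3 : s₀.arr 3 = s.arr 3 := ha 3 (by decide)
  have a4 : s₀.arr 4 = s.arr 4 := ha 4 (by decide)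
  obtain ⟨g1, g2⟩ := pathScan_spec (s := s₀.setReg 9 (s₀.reg 8))
  have g3 : (pathScan.den (s₀.setReg 9 (s₀.reg 8))).reg 8 = s₀.reg 8 := by
    rw [den_reg (by decide)]; simp [State.setReg]
  simp only [den, Expr.eval]
  generalize pathScan.den (s₀.setReg 9 (s₀.reg 8)) = s₁ at g1 g2 g3 ⊢
  simp only [State.setReg] at g1 g2
  simp only [State.setReg, State.setArr, Function.update_self, g1 6 (by decide)]
  simp only [Function.update_self, ne_eq, Nat.reduceEqDiff,
    not_false_eq_true, Function.update_of_ne, a2, a3, a4, h0] at g2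
  have hlast := hP.last
  have hcur : s₀.reg 8 < s.reg 0 := hlast ▸ h.vert_lt (hP.mem k le_rfl)
  rcases g2 with ⟨b1, b2, b3⟩ | ⟨e, he, b1, b2, b3, b4⟩
  -- No continuation was found: register `9` still equals the end of the path, so the end stays in
  -- place and is merely marked again.
  · have hvis : Function.update (s₀.arr 6) (s₁.reg 9) 1 = Function.update (s₀.arr 6) (s₀.reg 8) 1 := by
      rw [b1]
    have h68 : ∀ v, Function.update (s₀.arr 6) (s₁.reg 9) 1 v ≠ 0 ↔ s₀.arr 6 v ≠ 0 := by
      intro v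
      rw [b1]
      by_cases e : v = s₀.reg 8
      · subst e
        simp only [Function.update_self, ne_eq, one_ne_zero, not_false_eq_true, true_iff]
        exact (hP.visited _ hcur).2 ⟨k, le_rfl, hlast⟩
      · rw [Function.update_of_ne e]
    refine ⟨p, k, ⟨?_, hP.mem, hP.inj, ?_, ?_, ?_⟩, .inr ?_⟩
    · simpa [b1] using hlast
    · simpa [b2] using hP.step
    · simpa [b2] using hP.support
    · intro u hu
      simpa using (h68 u).trans (hP.visited u hu)
    · intro e he he'
      have := (h68 _).2 (b3 e he (by simpa [b1] using he'))
      simpa using this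
  -- The tail is on the path and the head is not, so this entry is not one of the dummy loops.
  · have hne : s.arr 3 e ≠ s.arr 4 e := by
      intro hc
      have := (hP.visited _ hcur).2 ⟨k, le_rfl, hlast⟩
      rw [← b1, hc] at this
      exact this b2
    obtain ⟨c1, c2, c3⟩ := h.arc_of he hne
    have hw : s.arr 4 e < s.reg 0 := h.head_lt e he
    have hnew : ∀ i ≤ k, p i ≠ s.arr 4 e := fun i hi hc =>
      (hP.visited _ hw).2 ⟨i, hi, hc⟩ b2
    refine ⟨fun i => if i ≤ k then p i else s.arr 4 e, k + 1, ⟨?_, ?_, ?_, ?_, ?_, ?_⟩, ?_⟩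
    · simp [b3]
    · intro i hi
      split_ifs with hik
      · exact hP.mem i hik
      · exact hI.sinks_subset _ c1 c3
    · intro i hi j hj
      split_ifs with h1 h2 h2
      · exact hP.inj i h1 j h2
      · intro hc; exact absurd hc (hnew i h1)
      · intro hc; exact absurd hc.symm (hnew j h2)
      · intro _; omega
    · intro i hi
      have hik : i ≤ k := by omega
      simp only [hik, if_true]
      rcases Nat.lt_succ_iff_lt_or_eq.1 hi with hlt | rfl
      · have hne' : p i ≠ s₀.reg 8 := by
          rw [← hlast]; intro hc
          have := hP.inj i hik k le_rfl hc
          omega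
        obtain ⟨F, d1, d2, d3, d4⟩ := hP.step i hlt
        refine ⟨F, d1, ?_, d3, ?_⟩
        · simpa [b4, Function.update_of_ne hne'] using d2
        · simpa [show i + 1 ≤ k by omega] using d4
      · refine ⟨_, c1, ?_, ?_, ?_⟩
        · simp [hlast, b4]
        · rw [c2, b1, hlast]
        · simpa using c3
    · intro u hu
      simp only [ne_eq, Nat.reduceEqDiff, not_false_eq_true,
        Function.update_of_ne, b4]
      by_cases hu' : u = s₀.reg 8
      · intro _
        exact ⟨k, by omega, by simp [hlast, hu']⟩
      · rw [Function.update_of_ne hu']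
        intro hc
        obtain ⟨i, hi, rfl⟩ := hP.support u hu hc
        exact ⟨i, by omega, by simp [hi.le]⟩
    · intro u hu
      simp only [Function.update_self, b3]
      by_cases hu' : u = s.arr 4 e
      · simp only [hu', Function.update_self, ne_eq, one_ne_zero, not_false_eq_true, true_iff]
        exact ⟨k + 1, le_rfl, by simp⟩
      · rw [Function.update_of_ne hu', hP.visited u hu]
        constructor
        · rintro ⟨i, hi, rfl⟩
          exact ⟨i, by omega, by simp [hi]⟩
        · rintro ⟨i, hi, hc⟩
          split_ifs at hc with h1
          · exact ⟨i, h1, hc⟩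
          · exact absurd hc.symm hu'
    · rcases hor with hor | hor
      · exact .inl (by omega)
      · exact absurd b2 (hor e he b1)

theorem path_spec {s : State} {I : StarSystem ℕ ℕ} (hI : I.IsInstance) (h : Represents s I) :
    ∃ p k, I.IsTrail (assigned (path.den s) 7) ((path.den s).reg 8) p k := by
  obtain ⟨h1, h2, h3⟩ := pathInit_spec hI h
  have hs0 : (pathInit.den s).reg 0 = s.reg 0 := den_reg (by decide)
  have hrep : Represents (pathInit.den s) I := h.congr hs0 (den_arr (by decide))
    (den_arr (by decide)) (den_arr (by decide)) (den_arr (by decide))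
  simp only [path, den]
  generalize pathInit.den s = s₁ at h1 h2 h3 hs0 hrep ⊢
  rw [← hs0] at h2 h3
  obtain ⟨p, k, hP, hmax⟩ := pathGrow_spec hI hrep h1 h2 h3
  have h0 : (pathGrow.den s₁).reg 0 = s₁.reg 0 := den_reg (by decide)
  have hlt : ∀ i ≤ k, p i < (pathGrow.den s₁).reg 0 := fun i hi => by
    rw [h0]; exact hrep.vert_lt (hP.mem i hi)
  refine ⟨p, k, hP.last, hP.mem, ?_, ?_, ?_, ?_⟩
  · intro i hi
    obtain ⟨F, d1, d2, d3⟩ := hP.step i hi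
    refine ⟨F, d1, ?_, d3⟩
    rw [assigned, if_pos (hlt i hi.le), ppred_eq_some, d2]
  · intro u hu
    unfold assigned at hu
    split_ifs at hu with h'
    · exact hP.support u (h0 ▸ h') fun hc => hu (ppred_eq_none.2 hc)
    · exact absurd rfl hu
  · have hk := hlt k le_rfl
    rw [hP.last] at hk
    rw [assigned, if_pos hk, ppred_eq_none]
    by_contra hc
    obtain ⟨i, hi, e⟩ := hP.support _ (h0 ▸ hk) hc
    have := hP.inj i hi.le k le_rfl (e.trans hP.last.symm)
    omega
  · intro F hF hs v hv
    obtain ⟨hne, e, he, e1, e2, e3⟩ := hrep.exists_arc hI hF hv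
    have := hmax e he (e2.trans hs)
    rw [e3] at this
    exact (hP.visited v (hrep.vert_lt (hI.sinks_subset F hF hv))).1 this

/-! ### The candidate determined by three stars -/

def prepReset : Prog :=
  .count 18 (.seq (.store 8 (.reg 18) (.const 0)) (.seq (.store 9 (.reg 18) (.const 0))
    (.seq (.store 11 (.reg 18) (.const 0)) (.seq (.store 13 (.reg 18) (.const 0))
      (.ite (.reg 10) (.store 12 (.reg 18) (.load 7 (.reg 18)))
        (.store 12 (.reg 18) (.const 0)))))))

def assignStar (x : ℕ) : Prog :=
  .store 12 (.load 3 (.reg x)) (.add (.load 2 (.reg x)) (.const 1))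

/-- Assigns the stars of the arcs in the registers `11`, `12`, `13`. -/
def prepSeed : Prog :=
  .seq (assignStar 13) (.seq (assignStar 12) (.seq (assignStar 11)
    (.seq (.assign 15 (.load 3 (.reg 11))) (.seq (.store 8 (.reg 15) (.const 1))
      (.seq (.store 13 (.reg 15) (.load 12 (.reg 15))) (.store 9 (.reg 15) (.const 1)))))))

/-- Selects stars so that the vertices marked in array `8` reach the supervertex. -/
def prepMark : Prog :=
  close 16 17 8 13 (.lt (.eq arcTail arcHead) (.add (.eq (.load 12 arcTail) (.const 0))
    (.eq (.load 12 arcTail) (.add arcStar (.const 1))))) arcHead arcTail (.add arcStar (.const 1))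

/-- Marks in array `9` the vertices reached from the supervertex by selected stars. -/
def prepReach : Prog :=
  close 16 17 9 14 (.lt (.eq arcTail arcHead) (.eq (.load 13 arcTail) (.add arcStar (.const 1))))
    arcTail arcHead (.const 0)

def prepKeep : Prog :=
  .count 17 (.ite (.eq arcTail arcHead) .skip (.ite (.add (.eq arcTail (.reg 8))
    (.add (.eq (.load 9 arcTail) (.const 0)) (.eq (.load 9 arcHead) (.const 0))))
      (.store 11 arcStar (.const 1)) .skip))

/-- Counts the perfect set and tests whether it is closed and encloses the end of the path. -/
def prepTest : Prog :=
  .seq (.assign 19 (.const 1)) (.seq (.assign 20 (.const 0))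
    (.seq (.count 18 (.ite (.load 9 (.reg 18)) (.seq (.assign 20 (.add (.reg 20) (.const 1)))
      (.ite (.load 8 (.reg 18)) .skip (.assign 19 (.const 0)))) .skip))
    (.seq (.count 17 (.ite (.eq arcTail (.reg 8)) (.ite (.load 9 arcHead) .skip
      (.assign 19 (.const 0))) .skip))
    (.ite (.load 9 (.reg 8)) .skip (.assign 19 (.const 0))))))

theorem prepReset_spec {s : State} : ∀ v < s.reg 0,
    (prepReset.den s).arr 8 v = 0 ∧ (prepReset.den s).arr 9 v = 0 ∧
    (prepReset.den s).arr 11 v = 0 ∧ (prepReset.den s).arr 13 v = 0 ∧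
    (prepReset.den s).arr 12 v = if s.reg 10 = 0 then 0 else s.arr 7 v := by
  refine count_induct (x := 18) (s := s) (P := fun j s' => ∀ v < j, s'.arr 8 v = 0 ∧ s'.arr 9 v = 0 ∧
    s'.arr 11 v = 0 ∧ s'.arr 13 v = 0 ∧ s'.arr 12 v = if s.reg 10 = 0 then 0 else s.arr 7 v)
    (by simp [WellFormed, regs]) (by simp) ?_
  intro j s' hj hx _ hr ha hP v hv
  have h7 : s'.arr 7 = s.arr 7 := ha 7 (by decide)
  have h10 : s'.reg 10 = s.reg 10 := hr 10 (by decide)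
  have hv' : v = j ∨ (v ≠ j ∧ v < j) := by omega
  rcases hv' with rfl | ⟨hne, hlt⟩
  · by_cases c : s.reg 10 = 0 <;>
      simp [den, Expr.eval, State.setReg, State.setArr, hx, h7, h10, c]
  · have := hP v hlt
    by_cases c : s.reg 10 = 0 <;>
      simp_all [den, Expr.eval, State.setReg, State.setArr]

/-- The situation after the reset and the assignment of the three stars. -/
structure Seeded (I : StarSystem ℕ ℕ) (fx : ℕ → Option ℕ) (F t : ℕ) (s : State) : Prop where
  target : s.reg 15 = t
  fx : ∀ u, assigned s 12 u = fx u
  mark : ∀ v < s.reg 0, s.arr 8 v ≠ 0 ↔ v = t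
  reached : ∀ v < s.reg 0, s.arr 9 v ≠ 0 ↔ v = t
  kept : ∀ v < s.reg 0, s.arr 11 v = 0
  self : s.arr 13 t = F + 1
  other : ∀ v < s.reg 0, v ≠ t → s.arr 13 v = 0

theorem prepSeed_spec {s : State} {I : StarSystem ℕ ℕ} (h : Represents s I)
    {base : ℕ → Option ℕ} (hbase : ∀ u, base u = if s.reg 10 = 0 then none else assigned s 7 u)
    (h1 : s.reg 11 < s.reg 0) (h2 : s.reg 12 < s.reg 0) (h3 : s.reg 13 < s.reg 0)
    (n1 : s.arr 3 (s.reg 11) ≠ s.arr 4 (s.reg 11)) (n2 : s.arr 3 (s.reg 12) ≠ s.arr 4 (s.reg 12))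
    (n3 : s.arr 3 (s.reg 13) ≠ s.arr 4 (s.reg 13)) :
    Seeded I (I.seed base (s.arr 2 (s.reg 11)) (s.arr 2 (s.reg 12)) (s.arr 2 (s.reg 13)))
      (s.arr 2 (s.reg 11)) (s.arr 3 (s.reg 11)) (prepSeed.den (prepReset.den s)) := by
  have hres := prepReset_spec (s := s)
  have r0 : (prepReset.den s).reg 0 = s.reg 0 := den_reg (by decide)
  have r11 : (prepReset.den s).reg 11 = s.reg 11 := den_reg (by decide)
  have r12 : (prepReset.den s).reg 12 = s.reg 12 := den_reg (by decide)
  have r13 : (prepReset.den s).reg 13 = s.reg 13 := den_reg (by decide)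
  have a2 : (prepReset.den s).arr 2 = s.arr 2 := den_arr (by decide)
  have a3 : (prepReset.den s).arr 3 = s.arr 3 := den_arr (by decide)
  generalize prepReset.den s = s₁ at *
  have hs1 := (h.arc_of h1 n1).2.1
  have hs2 := (h.arc_of h2 n2).2.1
  have hs3 := (h.arc_of h3 n3).2.1
  have t1 := h.tail_lt _ h1
  have t2 := h.tail_lt _ h2
  have t3 := h.tail_lt _ h3
  have e0 : (prepSeed.den s₁).reg 0 = s.reg 0 := by rw [← r0]; exact den_reg (by decide)
  -- The stars are written in reverse order, so the earlier ones overwrite the later ones. This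
  -- realises the priorities in `seed` when sources coincide.
  have e12 : (prepSeed.den s₁).arr 12 = Function.update (Function.update (Function.update
      (s₁.arr 12) (s.arr 3 (s.reg 13)) (s.arr 2 (s.reg 13) + 1))
      (s.arr 3 (s.reg 12)) (s.arr 2 (s.reg 12) + 1)) (s.arr 3 (s.reg 11)) (s.arr 2 (s.reg 11) + 1) := by
    simp [prepSeed, assignStar, den, Expr.eval, State.setReg, State.setArr, r11, r12, r13, a2, a3]
  have e8 : (prepSeed.den s₁).arr 8 = Function.update (s₁.arr 8) (s.arr 3 (s.reg 11)) 1 := by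
    simp [prepSeed, assignStar, den, Expr.eval, State.setReg, State.setArr, r11, a3]
  have e9 : (prepSeed.den s₁).arr 9 = Function.update (s₁.arr 9) (s.arr 3 (s.reg 11)) 1 := by
    simp [prepSeed, assignStar, den, Expr.eval, State.setReg, State.setArr, r11, a3]
  have e11 : (prepSeed.den s₁).arr 11 = s₁.arr 11 := den_arr (by decide)
  have e13 : (prepSeed.den s₁).arr 13 = Function.update (s₁.arr 13) (s.arr 3 (s.reg 11))
      (s.arr 2 (s.reg 11) + 1) := by
    simp [prepSeed, assignStar, den, Expr.eval, State.setReg, State.setArr, r11, r12, r13, a2, a3]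
  have e15 : (prepSeed.den s₁).reg 15 = s.arr 3 (s.reg 11) := by
    simp [prepSeed, assignStar, den, Expr.eval, State.setReg, State.setArr, r11, a3]
  generalize prepSeed.den s₁ = s₂ at *
  refine ⟨e15, ?_, ?_, ?_, ?_, ?_, ?_⟩
  · intro u
    unfold assigned
    rw [e0, e12]
    simp only [StarSystem.seed, hs1, hs2, hs3, Function.update_apply]
    by_cases c1 : u = s.arr 3 (s.reg 11)
    · subst c1; simp [t1]
    by_cases c2 : u = s.arr 3 (s.reg 12)
    · subst c2; simp [t2, c1]
    by_cases c3 : u = s.arr 3 (s.reg 13)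
    · subst c3; simp [t3, c1, c2]
    simp only [c1, c2, c3, if_false, hbase]
    by_cases hu : u < s.reg 0
    · rw [(hres u hu).2.2.2.2]
      by_cases c : s.reg 10 = 0 <;> simp [hu, c, assigned]
    · simp [hu, assigned]
  · intro v hv
    rw [e0] at hv
    rw [e8, Function.update_apply, (hres v hv).1]
    by_cases c : v = s.arr 3 (s.reg 11) <;> simp [c]
  · intro v hv
    rw [e0] at hv
    rw [e9, Function.update_apply, (hres v hv).2.1]
    by_cases c : v = s.arr 3 (s.reg 11) <;> simp [c]
  · intro v hv
    rw [e0] at hv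
    rw [e11, (hres v hv).2.2.1]
  · rw [e13, Function.update_self]
  · intro v hv hne
    rw [e0] at hv
    rw [e13, Function.update_of_ne hne, (hres v hv).2.2.2.1]

/-- The situation after stars have been selected and the reached vertices have been marked. -/
structure Grown (I : StarSystem ℕ ℕ) (fx : ℕ → Option ℕ) (t : ℕ) (s : State) (g : ℕ → ℕ) :
    Prop where
  mark : ∀ u < s.reg 0, s.arr 8 u ≠ 0 → u ∈ I.verts ∧ g u ∈ I.stars ∧ I.source (g u) = u ∧
    s.arr 13 u = g u + 1 ∧ (fx u = none ∨ fx u = some (g u)) ∧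
    ReflTransGen (I.SelectedArc g) u t
  reached : ∀ v < s.reg 0, s.arr 9 v ≠ 0 → ReflTransGen (I.SelectedArc g) t v
  target : s.arr 9 t ≠ 0
  closed : ∀ u < s.reg 0, s.arr 8 u ≠ 0 → s.arr 9 u ≠ 0 → ∀ v ∈ I.sinks (g u), s.arr 9 v ≠ 0
  all : (∀ u ∈ I.verts, ReflTransGen (I.AvailableArc fx) u t) → ∀ u ∈ I.verts, s.arr 8 u ≠ 0

theorem lt_eval_ne_zero {a b : ℕ} : (if a < b then 1 else 0) ≠ 0 ↔ a < b := by
  by_cases h : a < b <;> simp [h]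

/-- A backward closure from `t`: a vertex is marked, and the star recorded, when an available arc
leads to a marked vertex. Following the recorded stars therefore leads to `t`, which carries its
prescribed star from the start. The second clause says that unmarked vertices have no recorded star.
-/
theorem prepMark_spec {s : State} {I : StarSystem ℕ ℕ} (hI : I.IsInstance) (h : Represents s I)
    {fx : ℕ → Option ℕ} {F t : ℕ} (hs : Seeded I fx F t s) (ht : t ∈ I.verts)
    (hF : F ∈ I.stars) (hFs : I.source F = t) (hfx : fx t = some F) :
    (∀ u < s.reg 0, (prepMark.den s).arr 8 u ≠ 0 → u ∈ I.verts ∧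
      (prepMark.den s).arr 13 u - 1 ∈ I.stars ∧ I.source ((prepMark.den s).arr 13 u - 1) = u ∧
      (prepMark.den s).arr 13 u = (prepMark.den s).arr 13 u - 1 + 1 ∧
      (fx u = none ∨ fx u = some ((prepMark.den s).arr 13 u - 1)) ∧
      ReflTransGen (I.SelectedArc fun u => (prepMark.den s).arr 13 u - 1) u t) ∧
    (∀ u < s.reg 0, (prepMark.den s).arr 8 u = 0 → (prepMark.den s).arr 13 u = 0) ∧
    ((∀ u ∈ I.verts, ReflTransGen (I.AvailableArc fx) u t) →
      ∀ u ∈ I.verts, (prepMark.den s).arr 8 u ≠ 0) := by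
  obtain ⟨hinv, hcl⟩ := close_spec (x := 16) (y := 17) (A := 8) (B := 13) (s := s)
    (c := fun e => s.arr 3 e ≠ s.arr 4 e ∧
      (s.arr 12 (s.arr 3 e) = 0 ∨ s.arr 12 (s.arr 3 e) = s.arr 2 e + 1))
    (u := s.arr 4) (w := s.arr 3) (f := fun e => s.arr 2 e + 1)
    (cond := .lt (.eq arcTail arcHead) (.add (.eq (.load 12 arcTail) (.const 0))
      (.eq (.load 12 arcTail) (.add arcStar (.const 1))))) (src := arcHead) (dst := arcTail)
    (val := .add arcStar (.const 1)) (s' := prepMark.den s)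
    (by norm_num) (by norm_num) (by norm_num) (by norm_num) (by
      intro s' _ ha _
      have a2 := ha 2 (by norm_num) (by norm_num)
      have a3 := ha 3 (by norm_num) (by norm_num)
      have a4 := ha 4 (by norm_num) (by norm_num)
      have a12 := ha 12 (by norm_num) (by norm_num)
      simp only [Expr.eval, a2, a3, a4, a12, lt_eval_ne_zero, and_self, and_true]
      -- The two equality tests exclude each other, so their sum is `0` or `1`. It exceeds the loop
      -- test exactly if the arc is not a loop and one of the tests succeeds.
      by_cases c1 : s.arr 3 (s'.reg 17) = s.arr 4 (s'.reg 17) <;>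
        by_cases c2 : s.arr 12 (s.arr 3 (s'.reg 17)) = 0 <;>
        by_cases c3 : s.arr 12 (s.arr 3 (s'.reg 17)) = s.arr 2 (s'.reg 17) + 1 <;>
        simp_all) h.head_lt h.tail_lt rfl
  have htK := h.vert_lt ht
  have h13t : (prepMark.den s).arr 13 t = F + 1 := by
    rw [hinv.frame t (.inl ((hs.mark t htK).2 rfl)), hs.self]
  have hmt : (prepMark.den s).arr 8 t ≠ 0 := hinv.mono t ((hs.mark t htK).2 rfl)
  have hcompat : ∀ u < s.reg 0, ∀ G, (s.arr 12 u = 0 ∨ s.arr 12 u = G + 1) ↔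
      (fx u = none ∨ fx u = some G) := by
    intro u hu G
    rw [← hs.fx u, assigned, if_pos hu, ppred_eq_none, ppred_eq_some]
  generalize prepMark.den s = s' at *
  have hlink : ∀ a c, (s'.arr 8 a ≠ 0 ∧ ∃ e < s.reg 0, (s.arr 3 e ≠ s.arr 4 e ∧
      (s.arr 12 (s.arr 3 e) = 0 ∨ s.arr 12 (s.arr 3 e) = s.arr 2 e + 1)) ∧ s.arr 3 e = a ∧
      s.arr 4 e = c ∧ s'.arr 13 a = s.arr 2 e + 1) → a ∈ I.verts ∧
      s'.arr 13 a - 1 ∈ I.stars ∧ I.source (s'.arr 13 a - 1) = a ∧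
      s'.arr 13 a = s'.arr 13 a - 1 + 1 ∧ (fx a = none ∨ fx a = some (s'.arr 13 a - 1)) ∧
      I.SelectedArc (fun u => s'.arr 13 u - 1) a c := by
    rintro a c ⟨-, e, he, ⟨h1, h2⟩, rfl, rfl, h5⟩
    obtain ⟨b1, b2, b3⟩ := h.arc_of he h1
    have e1 : s'.arr 13 (s.arr 3 e) - 1 = s.arr 2 e := by omega
    refine ⟨b2 ▸ hI.source_mem _ b1, ?_, ?_, ?_, ?_, ?_⟩
    · rwa [e1]
    · rwa [e1]
    · rw [e1]; exact h5
    · rw [e1]; exact (hcompat _ (h.tail_lt e he) _).1 h2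
    · unfold StarSystem.SelectedArc; simp only [e1]; exact b3
  refine ⟨?_, ?_, ?_⟩
  · intro u hu hu'
    obtain ⟨a, ha, ha', hp⟩ := hinv.link u hu hu'
    obtain rfl := (hs.mark a ha).1 ha'
    have hp' := hp.imp fun x y hxy => (hlink x y hxy).2.2.2.2.2
    rcases hp.cases_head with rfl | ⟨c, hc, -⟩
    · rw [h13t]
      exact ⟨ht, by simpa using hF, by simpa using hFs, by simp, .inr (by simpa using hfx), .refl⟩
    · obtain ⟨b1, b2, b3, b4, b5, -⟩ := hlink u c hc
      exact ⟨b1, b2, b3, b4, b5, hp'⟩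
  · intro u hu hu'
    rw [hinv.frame u (.inr hu')]
    exact hs.other u hu fun e => hmt (e ▸ hu')
  · intro hall u hu
    have := hall u hu
    clear hu
    induction this using ReflTransGen.head_induction_on with
    | refl => exact hmt
    | @head a c hac _ ih =>
      obtain ⟨G, hG, rfl, hc, hco⟩ := hac
      obtain ⟨hne, e, he, e1, e2, e3⟩ := h.exists_arc hI hG hc
      have hlt := h.vert_lt (hI.source_mem G hG)
      have := hcl e he ⟨by rw [e2, e3]; exact hne, ?_⟩ (by rw [e3]; exact ih)
      · rwa [e2] at this
      · rw [e1, e2]; exact (hcompat _ hlt _).2 hco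

theorem prepReach_spec {s : State} {I : StarSystem ℕ ℕ} (hI : I.IsInstance) (h : Represents s I)
    {fx : ℕ → Option ℕ} {F t : ℕ} (hs : Seeded I fx F t s) (ht : t ∈ I.verts)
    (hF : F ∈ I.stars) (hFs : I.source F = t) (hfx : fx t = some F) :
    ∃ g, Grown I fx t (prepReach.den (prepMark.den s)) g := by
  obtain ⟨m1, m2, m3⟩ := prepMark_spec hI h hs ht hF hFs hfx
  have r0 : (prepMark.den s).reg 0 = s.reg 0 := den_reg (by decide)
  have a9 : (prepMark.den s).arr 9 = s.arr 9 := den_arr (by decide)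
  have hrep : Represents (prepMark.den s) I := h.congr r0 (den_arr (by decide))
    (den_arr (by decide)) (den_arr (by decide)) (den_arr (by decide))
  generalize prepMark.den s = s₁ at *
  have hr9 := hs.reached
  rw [← r0] at m1 m2 hr9
  rw [← a9] at hr9
  clear a9 r0 h hs
  obtain ⟨hinv, hcl⟩ := close_spec (x := 16) (y := 17) (A := 9) (B := 14) (s := s₁)
    (c := fun e => s₁.arr 3 e ≠ s₁.arr 4 e ∧ s₁.arr 13 (s₁.arr 3 e) = s₁.arr 2 e + 1)
    (u := s₁.arr 3) (w := s₁.arr 4) (f := fun e => 0)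
    (cond := .lt (.eq arcTail arcHead) (.eq (.load 13 arcTail) (.add arcStar (.const 1))))
    (src := arcTail) (dst := arcHead) (val := .const 0) (s' := prepReach.den s₁)
    (by norm_num) (by norm_num) (by norm_num) (by norm_num) (by
      intro s' _ ha _
      have a2 := ha 2 (by norm_num) (by norm_num)
      have a3 := ha 3 (by norm_num) (by norm_num)
      have a4 := ha 4 (by norm_num) (by norm_num)
      have a13 := ha 13 (by norm_num) (by norm_num)
      simp only [Expr.eval, a2, a3, a4, a13, lt_eval_ne_zero, and_self, and_true]
      by_cases c1 : s₁.arr 3 (s'.reg 17) = s₁.arr 4 (s'.reg 17) <;>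
        by_cases c3 : s₁.arr 13 (s₁.arr 3 (s'.reg 17)) = s₁.arr 2 (s'.reg 17) + 1 <;>
        simp_all) hrep.tail_lt hrep.head_lt rfl
  have r0 : (prepReach.den s₁).reg 0 = s₁.reg 0 := den_reg (by decide)
  have a8 : (prepReach.den s₁).arr 8 = s₁.arr 8 := den_arr (by decide)
  have a13 : (prepReach.den s₁).arr 13 = s₁.arr 13 := den_arr (by decide)
  have htK := hrep.vert_lt ht
  generalize prepReach.den s₁ = s₂ at *
  refine ⟨fun u => s₁.arr 13 u - 1, ?_, ?_, ?_, ?_, ?_⟩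
  · rw [r0, a8, a13]; exact m1
  · rw [r0]
    intro v hv hv'
    obtain ⟨a, ha, ha', hp⟩ := hinv.link v hv hv'
    obtain rfl := (hr9 a ha).1 ha'
    -- The links kept by the closure run from a marked vertex back to `t`, against the direction of
    -- the selected arcs.
    rw [← reflTransGen_swap]
    refine hp.imp ?_
    rintro x y ⟨-, e, he, ⟨h1, h2⟩, rfl, rfl, -⟩
    have := (hrep.arc_of he h1).2.2
    simp only [Function.swap, StarSystem.SelectedArc, h2]
    exact this
  · exact hinv.mono t ((hr9 t htK).2 rfl)
  · rw [r0, a8]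
    intro u hu hu8 hu9 v hv
    obtain ⟨b1, b2, b3, b4, -⟩ := m1 u hu hu8
    obtain ⟨hne, e, he, e1, e2, e3⟩ := hrep.exists_arc hI b2 hv
    rw [b3] at hne e2
    have := hcl e he ⟨by rw [e2, e3]; exact hne, by rw [e1, e2]; exact b4⟩ (by rw [e2]; exact hu9)
    rwa [e3] at this
  · rw [a8]; exact m3

/-- A star is kept as soon as one of its arcs shows a reason: its tail is `b` or unmarked, or its
head is unmarked. Since the mark belongs to the star, its arcs inside `U` are kept as well. -/
theorem prepKeep_spec {s : State} (h : ∀ v < s.reg 0, s.arr 11 v = 0) : ∀ F < s.reg 0,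
    ((prepKeep.den s).arr 11 F ≠ 0 ↔ ∃ e < s.reg 0, s.arr 2 e = F ∧ s.arr 3 e ≠ s.arr 4 e ∧
      (s.arr 3 e = s.reg 8 ∨ s.arr 9 (s.arr 3 e) = 0 ∨ s.arr 9 (s.arr 4 e) = 0)) := by
  refine count_induct (x := 17) (s := s) (P := fun j s' => ∀ F < s.reg 0,
    (s'.arr 11 F ≠ 0 ↔ ∃ e < j, s.arr 2 e = F ∧ s.arr 3 e ≠ s.arr 4 e ∧
      (s.arr 3 e = s.reg 8 ∨ s.arr 9 (s.arr 3 e) = 0 ∨ s.arr 9 (s.arr 4 e) = 0)))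
    (by simp [WellFormed, regs]) (by intro F hF; simp [State.setReg, h F hF]) ?_
  intro j s' hj hx _ hr ha hP F hF
  have a2 : s'.arr 2 = s.arr 2 := ha 2 (by decide)
  have a3 : s'.arr 3 = s.arr 3 := ha 3 (by decide)
  have a4 : s'.arr 4 = s.arr 4 := ha 4 (by decide)
  have a9 : s'.arr 9 = s.arr 9 := ha 9 (by decide)
  have r8 : s'.reg 8 = s.reg 8 := hr 8 (by decide)
  have hsplit : (∃ e < j + 1, s.arr 2 e = F ∧ s.arr 3 e ≠ s.arr 4 e ∧
      (s.arr 3 e = s.reg 8 ∨ s.arr 9 (s.arr 3 e) = 0 ∨ s.arr 9 (s.arr 4 e) = 0)) ↔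
      s'.arr 11 F ≠ 0 ∨ (s.arr 2 j = F ∧ s.arr 3 j ≠ s.arr 4 j ∧
      (s.arr 3 j = s.reg 8 ∨ s.arr 9 (s.arr 3 j) = 0 ∨ s.arr 9 (s.arr 4 j) = 0)) := by
    rw [hP F hF]
    constructor
    · rintro ⟨e, he, hh⟩
      rcases Nat.lt_succ_iff_lt_or_eq.1 he with hlt | rfl
      exacts [.inl ⟨e, hlt, hh⟩, .inr hh]
    · rintro (⟨e, he, hh⟩ | hh)
      exacts [⟨e, by omega, hh⟩, ⟨j, by omega, hh⟩]
  rw [hsplit]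
  simp only [den, Expr.eval, hx, a2, a3, a4, a9, r8, ite_one_zero_eq_zero, ite_not, Nat.add_eq_zero_iff]
  split_ifs with c1 c2
  · simp [State.setReg, c1]
  · have hno : ¬ (s.arr 3 j = s.reg 8 ∨ s.arr 9 (s.arr 3 j) = 0 ∨ s.arr 9 (s.arr 4 j) = 0) := by
      rintro (hc | hc | hc)
      exacts [c2.1 hc, c2.2.1 hc, c2.2.2 hc]
    simp [State.setReg, hno]
  · have hyes : s.arr 3 j = s.reg 8 ∨ s.arr 9 (s.arr 3 j) = 0 ∨ s.arr 9 (s.arr 4 j) = 0 := by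
      by_contra hc
      push Not at hc
      exact c2 hc
    simp only [State.setReg, State.setArr]
    by_cases c : F = s.arr 2 j
    · subst c
      simp [hyes, c1]
    · have : s.arr 2 j ≠ F := fun e => c e.symm
      simp [c, this]

/-- The vertices below `K` that are marked in the array `a`. -/
def marked (s : State) (a : ℕ) : Finset ℕ :=
  (Finset.range (s.reg 0)).filter fun v => s.arr a v ≠ 0

theorem mem_marked {s : State} {a v : ℕ} : v ∈ marked s a ↔ v < s.reg 0 ∧ s.arr a v ≠ 0 := by
  simp [marked]

theorem marked_congr {s s' : State} {a : ℕ} (h0 : s'.reg 0 = s.reg 0) (ha : s'.arr a = s.arr a) :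
    marked s' a = marked s a := by
  simp [marked, h0, ha]

def testCount : Prog :=
  .count 18 (.ite (.load 9 (.reg 18)) (.seq (.assign 20 (.add (.reg 20) (.const 1)))
      (.ite (.load 8 (.reg 18)) .skip (.assign 19 (.const 0)))) .skip)

def testArcs : Prog :=
  .count 17 (.ite (.eq arcTail (.reg 8)) (.ite (.load 9 arcHead) .skip
      (.assign 19 (.const 0))) .skip)

theorem testCount_spec {s : State} (h20 : s.reg 20 = 0) :
    (testCount.den s).reg 20 = (marked s 9).card ∧
    ((testCount.den s).reg 19 ≠ 0 ↔
      s.reg 19 ≠ 0 ∧ ∀ v < s.reg 0, s.arr 9 v ≠ 0 → s.arr 8 v ≠ 0) := by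
  refine count_induct (x := 18) (s := s) (P := fun j s' =>
    s'.reg 20 = ((Finset.range j).filter fun v => s.arr 9 v ≠ 0).card ∧
    (s'.reg 19 ≠ 0 ↔ s.reg 19 ≠ 0 ∧ ∀ v < j, s.arr 9 v ≠ 0 → s.arr 8 v ≠ 0))
    (by simp [WellFormed, regs]) (by simp [State.setReg, h20]) ?_
  intro j s' hj hx _ hr ha ⟨h1, h2⟩
  have a8 : s'.arr 8 = s.arr 8 := ha 8 (by decide)
  have a9 : s'.arr 9 = s.arr 9 := ha 9 (by decide)
  rw [Finset.range_add_one, Finset.filter_insert]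
  simp only [Nat.lt_succ_iff_lt_or_eq, or_imp, forall_and, forall_eq]
  simp only [den, Expr.eval, hx, a9]
  by_cases c1 : s.arr 9 j = 0
  · simp [c1, State.setReg, h1, h2]
  · by_cases c2 : s.arr 8 j = 0
    · simp [c1, c2, State.setReg, h1, hx, a8]
    · simp [c1, c2, State.setReg, h1, h2, hx, a8]

theorem testArcs_spec {s : State} : (testArcs.den s).reg 19 ≠ 0 ↔
    s.reg 19 ≠ 0 ∧ ∀ e < s.reg 0, s.arr 3 e = s.reg 8 → s.arr 9 (s.arr 4 e) ≠ 0 := by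
  refine count_induct (x := 17) (s := s) (P := fun j s' => (s'.reg 19 ≠ 0 ↔
    s.reg 19 ≠ 0 ∧ ∀ e < j, s.arr 3 e = s.reg 8 → s.arr 9 (s.arr 4 e) ≠ 0))
    (by simp [WellFormed, regs]) (by simp [State.setReg]) ?_
  intro j s' hj hx _ hr ha hP
  have a3 : s'.arr 3 = s.arr 3 := ha 3 (by decide)
  have a4 : s'.arr 4 = s.arr 4 := ha 4 (by decide)
  have a9 : s'.arr 9 = s.arr 9 := ha 9 (by decide)
  have r8 : s'.reg 8 = s.reg 8 := hr 8 (by decide)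
  simp only [Nat.lt_succ_iff_lt_or_eq, or_imp, forall_and, forall_eq]
  simp only [den, Expr.eval, hx, a3, a4, a9, r8, ite_one_zero_eq_zero, ite_not]
  by_cases c1 : s.arr 3 j = s.reg 8
  · by_cases c2 : s.arr 9 (s.arr 4 j) = 0
    · simp [c1, c2, State.setReg]
    · simp [c1, c2, State.setReg, hP]
  · simp [c1, State.setReg, hP]

theorem prepTest_spec {s : State} : (prepTest.den s).reg 20 = (marked s 9).card ∧
    ((prepTest.den s).reg 19 ≠ 0 ↔ (∀ v < s.reg 0, s.arr 9 v ≠ 0 → s.arr 8 v ≠ 0) ∧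
      (∀ e < s.reg 0, s.arr 3 e = s.reg 8 → s.arr 9 (s.arr 4 e) ≠ 0) ∧ s.arr 9 (s.reg 8) ≠ 0) := by
  have e : prepTest.den s = (Prog.ite (.load 9 (.reg 8)) .skip (.assign 19 (.const 0))).den
      (testArcs.den (testCount.den ((s.setReg 19 1).setReg 20 0))) := rfl
  rw [e]
  obtain ⟨h1, h2⟩ := testCount_spec (s := (s.setReg 19 1).setReg 20 0) (by simp [State.setReg])
  have h3 := testArcs_spec (s := testCount.den ((s.setReg 19 1).setReg 20 0))
  have t20 : (testArcs.den (testCount.den ((s.setReg 19 1).setReg 20 0))).reg 20 =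
    (testCount.den ((s.setReg 19 1).setReg 20 0)).reg 20 := den_reg (by decide)
  have q0 : (testCount.den ((s.setReg 19 1).setReg 20 0)).reg 0 = s.reg 0 :=
    (den_reg (by decide)).trans (by simp [State.setReg])
  have q8 : (testCount.den ((s.setReg 19 1).setReg 20 0)).reg 8 = s.reg 8 :=
    (den_reg (by decide)).trans (by simp [State.setReg])
  have qa : ∀ a, (testCount.den ((s.setReg 19 1).setReg 20 0)).arr a = s.arr a :=
    fun a => den_arr (by simp [testCount, arrs])
  have w8 : (testArcs.den (testCount.den ((s.setReg 19 1).setReg 20 0))).reg 8 = s.reg 8 :=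
    (den_reg (by decide)).trans q8
  have wa : ∀ a, (testArcs.den (testCount.den ((s.setReg 19 1).setReg 20 0))).arr a = s.arr a :=
    fun a => (den_arr (by simp [testArcs, arrs])).trans (qa a)
  generalize testCount.den ((s.setReg 19 1).setReg 20 0) = s₁ at *
  generalize testArcs.den s₁ = s₂ at *
  rw [q0, q8, qa 3, qa 4, qa 9, h2] at h3
  have hm : marked ((s.setReg 19 1).setReg 20 0) 9 = marked s 9 :=
    marked_congr (by simp [State.setReg]) rfl
  rw [hm] at h1
  simp only [State.setReg, ne_eq, Nat.reduceEqDiff, not_false_eq_true, Function.update_of_ne,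
    Function.update_self, one_ne_zero, true_and, OfNat.zero_ne_ofNat] at h3
  simp only [den, Expr.eval, w8, wa]
  split_ifs with c
  · simp [State.setReg, t20, h1, c]
  · refine ⟨t20.trans h1, ?_⟩
    rw [ne_eq, h3]
    simp only [ne_eq, c, not_false_eq_true, and_true]

/-- Computes the candidate for a perfect set that is determined by the assigned stars. -/
def prep : Prog :=
  .seq prepReset (.seq prepSeed (.seq prepMark (.seq prepReach (.seq prepKeep prepTest))))

/-- The candidate in the arrays: `g` selects on `U` a perfect set with supervertex `t`. -/
structure Candidate (I : StarSystem ℕ ℕ) (s : State) (U : Finset ℕ) (g : ℕ → ℕ) : Prop where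
  verts : U = marked s 9
  card : s.reg 20 = U.card
  perfect : I.IsPerfectChoice g U
  super : s.reg 15 ∈ U
  encloses : I.Encloses (s.reg 8) U
  stars : ∀ u ∈ U, s.arr 13 u = g u + 1

/-- The array `11` holds the stars that are kept with respect to `U`. -/
def KeepsStars (I : StarSystem ℕ ℕ) (s : State) (U : Finset ℕ) : Prop :=
  ∀ u v, u ≠ v → (I.KeptArc (s.reg 8) U u v ↔
    ∃ e < s.reg 0, s.arr 11 (s.arr 2 e) ≠ 0 ∧ s.arr 3 e = u ∧ s.arr 4 e = v)

/-- Soundness needs no complete selection: the test checks that all reached vertices carry a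
recorded star, which already makes the reached set a perfect choice. Completeness uses the full
selection: if the seed determines success, the backward closure marks all vertices, and the
resulting selection is one of the completions covered by `Determines`. -/
theorem prep_spec {s : State} {I : StarSystem ℕ ℕ} (hI : I.IsInstance) (h : Represents s I)
    (hb : s.reg 8 ∈ I.verts)
    {base : ℕ → Option ℕ} (hbase : ∀ u, base u = if s.reg 10 = 0 then none else assigned s 7 u)
    (h1 : s.reg 11 < s.reg 0) (h2 : s.reg 12 < s.reg 0) (h3 : s.reg 13 < s.reg 0)
    (n1 : s.arr 3 (s.reg 11) ≠ s.arr 4 (s.reg 11)) (n2 : s.arr 3 (s.reg 12) ≠ s.arr 4 (s.reg 12))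
    (n3 : s.arr 3 (s.reg 13) ≠ s.arr 4 (s.reg 13)) :
    ((prep.den s).reg 19 ≠ 0 → ∃ U g, Candidate I (prep.den s) U g ∧
      KeepsStars I (prep.den s) U) ∧
    (I.Determines (s.reg 8)
      (I.seed base (s.arr 2 (s.reg 11)) (s.arr 2 (s.reg 12)) (s.arr 2 (s.reg 13)))
      (I.source (s.arr 2 (s.reg 11))) → (prep.den s).reg 19 ≠ 0 ∧
        I.Succeeds (s.reg 8) (marked (prep.den s) 9)) := by
  obtain ⟨f1, f2, -⟩ := h.arc_of h1 n1
  have hs := prepSeed_spec h hbase h1 h2 h3 n1 n2 n3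
  have hfx : (I.seed base (s.arr 2 (s.reg 11)) (s.arr 2 (s.reg 12)) (s.arr 2 (s.reg 13)))
      (s.arr 3 (s.reg 11)) = some (s.arr 2 (s.reg 11)) := by simp [StarSystem.seed, f2]
  have ht : s.arr 3 (s.reg 11) ∈ I.verts := f2 ▸ hI.source_mem _ f1
  rw [f2]
  generalize I.seed base (s.arr 2 (s.reg 11)) (s.arr 2 (s.reg 12)) (s.arr 2 (s.reg 13)) = fx at *
  generalize s.arr 2 (s.reg 11) = F at *
  generalize s.arr 3 (s.reg 11) = t at *
  have e : prep.den s = prepTest.den (prepKeep.den (prepReach.den (prepMark.den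
    (prepSeed.den (prepReset.den s))))) := rfl
  rw [e]
  have z0 : (prepSeed.den (prepReset.den s)).reg 0 = s.reg 0 :=
    (den_reg (by decide)).trans (den_reg (by decide))
  have z8 : (prepSeed.den (prepReset.den s)).reg 8 = s.reg 8 :=
    (den_reg (by decide)).trans (den_reg (by decide))
  have hrep : Represents (prepSeed.den (prepReset.den s)) I := h.congr z0
    ((den_arr (by decide)).trans (den_arr (by decide)))
    ((den_arr (by decide)).trans (den_arr (by decide)))
    ((den_arr (by decide)).trans (den_arr (by decide)))
    ((den_arr (by decide)).trans (den_arr (by decide)))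
  generalize prepSeed.den (prepReset.den s) = s₁ at *
  rw [← z8] at hb ⊢
  clear hbase h1 h2 h3 n1 n2 n3 h e z8 z0
  obtain ⟨g, hg⟩ := prepReach_spec hI hrep hs ht f1 f2 hfx
  have y0 : (prepReach.den (prepMark.den s₁)).reg 0 = s₁.reg 0 :=
    (den_reg (by decide)).trans (den_reg (by decide))
  have y8 : (prepReach.den (prepMark.den s₁)).reg 8 = s₁.reg 8 :=
    (den_reg (by decide)).trans (den_reg (by decide))
  have y15 : (prepReach.den (prepMark.den s₁)).reg 15 = t :=
    ((den_reg (by decide)).trans (den_reg (by decide))).trans hs.target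
  have y11 : (prepReach.den (prepMark.den s₁)).arr 11 = s₁.arr 11 :=
    (den_arr (by decide)).trans (den_arr (by decide))
  have hkept := hs.kept
  rw [← y0, ← y11] at hkept
  have hrep2 : Represents (prepReach.den (prepMark.den s₁)) I := hrep.congr y0
    ((den_arr (by decide)).trans (den_arr (by decide)))
    ((den_arr (by decide)).trans (den_arr (by decide)))
    ((den_arr (by decide)).trans (den_arr (by decide)))
    ((den_arr (by decide)).trans (den_arr (by decide)))
  generalize prepReach.den (prepMark.den s₁) = s₂ at *
  rw [← y8] at hb ⊢
  clear hrep y0 y8 y11 hs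
  have hkeep := prepKeep_spec hkept
  have htK := hrep2.vert_lt ht
  -- the test phases change neither the candidate nor the arcs
  have x0 : (prepKeep.den s₂).reg 0 = s₂.reg 0 := den_reg (by decide)
  have x8 : (prepKeep.den s₂).reg 8 = s₂.reg 8 := den_reg (by decide)
  have xa : ∀ a, a ≠ 11 → (prepKeep.den s₂).arr a = s₂.arr a := fun a ha =>
    den_arr (by simp [prepKeep, arrs, ha])
  obtain ⟨w20, w19⟩ := prepTest_spec (s := prepKeep.den s₂)
  rw [x0, x8, xa 3 (by norm_num), xa 4 (by norm_num), xa 8 (by norm_num), xa 9 (by norm_num)] at w19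
  rw [marked_congr x0 (xa 9 (by norm_num))] at w20
  have v0 : (prepTest.den (prepKeep.den s₂)).reg 0 = s₂.reg 0 := (den_reg (by decide)).trans x0
  have v8 : (prepTest.den (prepKeep.den s₂)).reg 8 = s₂.reg 8 := (den_reg (by decide)).trans x8
  have v15 : (prepTest.den (prepKeep.den s₂)).reg 15 = t :=
    ((den_reg (by decide)).trans (den_reg (by decide))).trans y15
  have va : ∀ a, (prepTest.den (prepKeep.den s₂)).arr a = (prepKeep.den s₂).arr a := fun a =>
    den_arr (by simp [prepTest, arrs])
  have hm9 : marked (prepTest.den (prepKeep.den s₂)) 9 = marked s₂ 9 :=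
    marked_congr v0 ((va 9).trans (xa 9 (by norm_num)))
  rw [hm9]
  -- the meaning of the tests
  have hperf : (prepTest.den (prepKeep.den s₂)).reg 19 ≠ 0 →
      I.IsPerfectChoice g (marked s₂ 9) ∧ I.Encloses (s₂.reg 8) (marked s₂ 9) ∧
        ∀ u ∈ marked s₂ 9, s₂.arr 13 u = g u + 1 := by
    intro hok
    obtain ⟨k1, k2, k3⟩ := w19.1 hok
    have hmk : ∀ u ∈ marked s₂ 9, _ := fun u hu =>
      hg.mark u (mem_marked.1 hu).1 (k1 u (mem_marked.1 hu).1 (mem_marked.1 hu).2)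
    refine ⟨⟨fun u hu => (hmk u hu).1, fun u hu => (hmk u hu).2.1, fun u hu => (hmk u hu).2.2.1,
      ?_, ?_⟩, ⟨?_, ?_⟩, fun u hu => (hmk u hu).2.2.2.1⟩
    · intro u hu v hv
      obtain ⟨hu1, hu2⟩ := mem_marked.1 hu
      exact mem_marked.2 ⟨hrep2.vert_lt (hI.sinks_subset _ (hmk u hu).2.1 hv),
        hg.closed u hu1 (k1 u hu1 hu2) hu2 v hv⟩
    · intro u hu v hv
      exact (hmk u hu).2.2.2.2.2.trans (hg.reached v (mem_marked.1 hv).1 (mem_marked.1 hv).2)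
    · refine mem_marked.2 ⟨?_, k3⟩
      exact hrep2.vert_lt hb
    · intro G hG hGs v hv
      obtain ⟨-, e, he, e1, e2, e3⟩ := hrep2.exists_arc hI hG hv
      have := k2 e he (e2.trans hGs)
      rw [e3] at this
      exact mem_marked.2 ⟨hrep2.vert_lt (hI.sinks_subset _ hG hv), this⟩
  constructor
  · intro hok
    obtain ⟨p1, p2, p3⟩ := hperf hok
    refine ⟨marked s₂ 9, g, ⟨hm9.symm, w20, p1, ?_, ?_, ?_⟩, ?_⟩
    · rw [v15]; exact mem_marked.2 ⟨htK, hg.target⟩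
    · rw [v8]; exact p2
    · rw [va 13, xa 13 (by norm_num)]; exact p3
    · intro u v huv
      rw [v0, v8, va 2, va 3, va 4, va 11, xa 2 (by norm_num), xa 3 (by norm_num),
        xa 4 (by norm_num)]
      constructor
      · rintro ⟨G, hG, rfl, hv, hk⟩
        obtain ⟨hne, e, he, e1, e2, e3⟩ := hrep2.exists_arc hI hG hv
        refine ⟨e, he, (hkeep _ (hrep2.star_lt e he)).2 ?_, e2, e3⟩
        rw [e1]
        rcases hk with hk | hk | hk
        · exact ⟨e, he, e1, by rw [e2, e3]; exact hne, .inl (e2.trans hk)⟩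
        · refine ⟨e, he, e1, by rw [e2, e3]; exact hne, .inr (.inl ?_)⟩
          rw [e2]
          by_contra hc
          exact hk (mem_marked.2 ⟨hrep2.vert_lt (hI.source_mem G hG), hc⟩)
        · obtain ⟨x, hx, hxU⟩ := Finset.not_subset.1 hk
          obtain ⟨hne', e', he', e1', e2', e3'⟩ := hrep2.exists_arc hI hG hx
          refine ⟨e', he', e1', by rw [e2', e3']; exact hne', .inr (.inr ?_)⟩
          rw [e3']
          by_contra hc
          exact hxU (mem_marked.2 ⟨hrep2.vert_lt (hI.sinks_subset G hG hx), hc⟩)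
      · rintro ⟨e, he, hk, rfl, rfl⟩
        obtain ⟨b1, b2, b3⟩ := hrep2.arc_of he huv
        refine ⟨_, b1, b2, b3, ?_⟩
        obtain ⟨e', he', e1, hne, hk⟩ := (hkeep _ (hrep2.star_lt e he)).1 hk
        obtain ⟨c1, c2, c3⟩ := hrep2.arc_of he' hne
        rw [e1, b2] at c2
        rw [← c2] at hk
        rcases hk with hk | hk | hk
        · exact .inl hk
        · exact .inr (.inl fun hc => (mem_marked.1 hc).2 hk)
        · refine .inr (.inr fun hc => ?_)
          rw [e1] at c3
          exact (mem_marked.1 (hc c3)).2 hk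
  · rintro ⟨hall, hdet⟩
    have hmk := hg.all hall
    have hsel : I.IsSelection fx t g := by
      refine ⟨?_, ?_, ?_, ?_⟩ <;> intro u hu <;>
        obtain ⟨-, b1, b2, -, b3, b4⟩ := hg.mark u (hrep2.vert_lt hu) (hmk u hu)
      exacts [b1, b2, b3, b4]
    have hU : ∀ v, v ∈ marked s₂ 9 ↔ ReflTransGen (I.SelectedArc g) t v := by
      intro v
      rw [mem_marked]
      constructor
      · rintro ⟨hv, hv'⟩; exact hg.reached v hv hv'
      · intro hv
        refine ⟨hrep2.vert_lt (hsel.reach_mem hI ht hv), ?_⟩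
        have : v ∈ I.verts ∧ s₂.arr 9 v ≠ 0 := by
          refine hv.mem_of_closed (P := fun v => v ∈ I.verts ∧ s₂.arr 9 v ≠ 0) ⟨ht, hg.target⟩ ?_
          rintro a c ⟨ha, ha'⟩ hac
          exact ⟨hsel.selected_mem hI ha hac,
            hg.closed a (hrep2.vert_lt ha) (hmk a ha) ha' c hac⟩
        exact this.2
    have hsucc := hdet g _ hsel hU
    refine ⟨w19.2 ⟨?_, ?_, (mem_marked.1 hsucc.1.1).2⟩, hsucc⟩
    · intro v hv hv'
      exact hmk v (hsel.reach_mem hI ht ((hU v).1 (mem_marked.2 ⟨hv, hv'⟩)))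
    · intro e he hee
      -- The test does not exclude loops at `b`; they are harmless, as `b` itself is in the set.
      by_cases hne : s₂.arr 3 e = s₂.arr 4 e
      · rw [← hne, hee]; exact (mem_marked.1 hsucc.1.1).2
      · obtain ⟨b1, b2, b3⟩ := hrep2.arc_of he hne
        exact (mem_marked.1 (hsucc.1.2 _ b1 (b2.trans hee) b3)).2

/-! ### The second cut -/

def splitReset : Prog :=
  .seq (.count 18 (.store 10 (.reg 18) (.const 0))) (.store 10 (.reg 14) (.const 1))

/-- Marks in array `10` the vertices reached from the vertex in register `14` by kept stars. -/
def splitClose : Prog :=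
  close 16 17 10 14 (.lt (.eq arcTail arcHead) (.lt (.const 0) (.load 11 arcStar)))
    arcTail arcHead (.const 0)

def splitTest : Prog :=
  .seq (.assign 21 (.const 1)) (.seq (.count 18 (.ite (.load 5 (.reg 18))
    (.ite (.load 10 (.reg 18)) .skip (.assign 21 (.const 0))) .skip))
    (.ite (.reg 21) .skip (.assign 7 (.const 2))))

def split : Prog := .seq splitReset (.seq splitClose splitTest)

theorem splitReset_spec {s : State} : ∀ v < s.reg 0,
    ((splitReset.den s).arr 10 v ≠ 0 ↔ v = s.reg 14) := by
  have key := count_induct (x := 18) (s := s) (p := .store 10 (.reg 18) (.const 0))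
    (P := fun j s' => ∀ v < j, s'.arr 10 v = 0) (by simp [WellFormed, regs]) (by simp) (by
      intro j s' hj hx _ _ ha hP v hv
      rcases Nat.lt_succ_iff_lt_or_eq.1 hv with hlt | rfl
      · simp only [den, Expr.eval, State.setReg, State.setArr, Function.update_self, hx]
        rw [Function.update_of_ne (by omega), hP v hlt]
      · simp [den, Expr.eval, State.setReg, State.setArr, hx])
  have r14 : ((count 18 (.store 10 (.reg 18) (.const 0))).den s).reg 14 = s.reg 14 :=
    den_reg (by decide)
  intro v hv
  have e : splitReset.den s = ((count 18 (.store 10 (.reg 18) (.const 0))).den s).setArr 10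
    (((count 18 (.store 10 (.reg 18) (.const 0))).den s).reg 14) 1 := rfl
  rw [e, r14]
  generalize (count 18 (.store 10 (.reg 18) (.const 0))).den s = s₁ at key
  simp only [State.setArr, Function.update_self, Function.update_apply, key v hv]
  by_cases c : v = s.reg 14 <;> simp [c]

theorem splitTest_spec {s : State} :
    (splitTest.den s).reg 7 = if ∀ v < s.reg 0, s.arr 5 v ≠ 0 → s.arr 10 v ≠ 0 then s.reg 7
      else 2 := by
  have e : splitTest.den s = (Prog.ite (.reg 21) .skip (.assign 7 (.const 2))).den
    ((count 18 (.ite (.load 5 (.reg 18)) (.ite (.load 10 (.reg 18)) .skip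
      (.assign 21 (.const 0))) .skip)).den (s.setReg 21 1)) := rfl
  have key := count_induct (x := 18) (s := s.setReg 21 1) (p := .ite (.load 5 (.reg 18))
    (.ite (.load 10 (.reg 18)) .skip (.assign 21 (.const 0))) .skip)
    (P := fun j s' => (s'.reg 21 ≠ 0 ↔ ∀ v < j, s.arr 5 v ≠ 0 → s.arr 10 v ≠ 0))
    (by simp [WellFormed, regs]) (by simp [State.setReg]) (by
      intro j s' hj hx _ hr ha hP
      have a5 : s'.arr 5 = s.arr 5 := ha 5 (by decide)
      have a10 : s'.arr 10 = s.arr 10 := ha 10 (by decide)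
      simp only [Nat.lt_succ_iff_lt_or_eq, or_imp, forall_and, forall_eq]
      simp only [den, Expr.eval, hx, a5, a10]
      by_cases c1 : s.arr 5 j = 0
      · simp [c1, State.setReg, hP]
      · by_cases c2 : s.arr 10 j = 0 <;> simp [c1, c2, State.setReg, hP])
  have r7 : ((count 18 (.ite (.load 5 (.reg 18)) (.ite (.load 10 (.reg 18)) .skip
      (.assign 21 (.const 0))) .skip)).den (s.setReg 21 1)).reg 7 = s.reg 7 :=
    (den_reg (by decide)).trans (by simp [State.setReg])
  rw [show (s.setReg 21 1).reg 0 = s.reg 0 by simp [State.setReg]] at key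
  rw [e]
  generalize (count 18 (.ite (.load 5 (.reg 18)) (.ite (.load 10 (.reg 18)) .skip
      (.assign 21 (.const 0))) .skip)).den (s.setReg 21 1) = s₁ at *
  simp only [den, Expr.eval]
  by_cases c : s₁.reg 21 = 0
  · have hno : ¬ ∀ v < s.reg 0, s.arr 5 v ≠ 0 → s.arr 10 v ≠ 0 := fun h => key.2 h c
    rw [if_neg hno]
    simp [c, State.setReg]
  · rw [if_pos (key.1 c), ← r7]
    simp [c]

/-- The vertices marked in array `10` form a cut that no kept star crosses. -/
def SplitCut (I : StarSystem ℕ ℕ) (s : State) (U : Finset ℕ) : Prop :=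
  marked s 10 ∈ I.cuts ∧
    ∀ a c, a ∈ marked s 10 → I.KeptArc (s.reg 8) U a c → c ∈ marked s 10

/-- The forward closure from one vertex along kept arcs either is the whole vertex set or is a cut
closed under these arcs. Trying all starting vertices decides `Splits`. -/
theorem split_spec {s : State} {I : StarSystem ℕ ℕ} (hI : I.IsInstance) (h : Represents s I)
    {U : Finset ℕ} (hk : KeepsStars I s U) (hx : s.reg 14 ∈ I.verts) (h7 : s.reg 7 = 0) :
    ((split.den s).reg 7 ≠ 0 → (split.den s).reg 7 = 2 ∧ SplitCut I (split.den s) U) ∧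
    ((∃ v ∈ I.verts, ¬ ReflTransGen (I.KeptArc (s.reg 8) U) (s.reg 14) v) →
      (split.den s).reg 7 ≠ 0) := by
  have e : split.den s = splitTest.den (splitClose.den (splitReset.den s)) := rfl
  have hres := splitReset_spec (s := s)
  have r0 : (splitReset.den s).reg 0 = s.reg 0 := den_reg (by decide)
  have r8 : (splitReset.den s).reg 8 = s.reg 8 := den_reg (by decide)
  have r7 : (splitReset.den s).reg 7 = s.reg 7 := den_reg (by decide)
  have ra : ∀ a, a ≠ 10 → (splitReset.den s).arr a = s.arr a := fun a ha =>
    den_arr (by simp [splitReset, arrs, ha])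
  have hrep : Represents (splitReset.den s) I := h.congr r0 (ra 2 (by norm_num))
    (ra 3 (by norm_num)) (ra 4 (by norm_num)) (ra 5 (by norm_num))
  have hk1 : KeepsStars I (splitReset.den s) U := by
    unfold KeepsStars at hk ⊢
    rwa [r0, r8, ra 11 (by norm_num), ra 2 (by norm_num), ra 3 (by norm_num), ra 4 (by norm_num)]
  rw [e]
  rw [← r7] at h7
  rw [← r0] at hres
  rw [← r8]
  generalize splitReset.den s = s₁ at *
  generalize s.reg 14 = x at *
  clear ra r0 r8 r7 hk h e
  obtain ⟨hinv, hcl⟩ := close_spec (x := 16) (y := 17) (A := 10) (B := 14) (s := s₁)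
    (c := fun e => s₁.arr 3 e ≠ s₁.arr 4 e ∧ s₁.arr 11 (s₁.arr 2 e) ≠ 0)
    (u := s₁.arr 3) (w := s₁.arr 4) (f := fun e => 0)
    (cond := .lt (.eq arcTail arcHead) (.lt (.const 0) (.load 11 arcStar)))
    (src := arcTail) (dst := arcHead) (val := .const 0) (s' := splitClose.den s₁)
    (by norm_num) (by norm_num) (by norm_num) (by norm_num) (by
      intro s' _ ha _
      have a2 := ha 2 (by norm_num) (by norm_num)
      have a3 := ha 3 (by norm_num) (by norm_num)
      have a4 := ha 4 (by norm_num) (by norm_num)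
      have a11 := ha 11 (by norm_num) (by norm_num)
      simp only [Expr.eval, a2, a3, a4, a11, lt_eval_ne_zero, and_self, and_true]
      by_cases c1 : s₁.arr 3 (s'.reg 17) = s₁.arr 4 (s'.reg 17) <;>
        by_cases c3 : s₁.arr 11 (s₁.arr 2 (s'.reg 17)) = 0 <;>
        simp_all [Nat.pos_iff_ne_zero]) hrep.tail_lt hrep.head_lt rfl
  have z0 : (splitClose.den s₁).reg 0 = s₁.reg 0 := den_reg (by decide)
  have z8 : (splitClose.den s₁).reg 8 = s₁.reg 8 := den_reg (by decide)
  have z7 : (splitClose.den s₁).reg 7 = s₁.reg 7 := den_reg (by decide)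
  have z5 : (splitClose.den s₁).arr 5 = s₁.arr 5 := den_arr (by decide)
  have hxK := hrep.vert_lt hx
  have hT : ∀ v, v ∈ marked (splitClose.den s₁) 10 ↔
      ReflTransGen (I.KeptArc (s₁.reg 8) U) x v := by
    intro v
    rw [mem_marked, z0]
    constructor
    · rintro ⟨hv, hv'⟩
      obtain ⟨a, ha, ha', hp⟩ := hinv.link v hv hv'
      obtain rfl := (hres a ha).1 ha'
      rw [← reflTransGen_swap]
      refine hp.imp ?_
      rintro y z ⟨-, e, he, ⟨h1, h2⟩, rfl, rfl, -⟩
      exact (hk1 _ _ h1).2 ⟨e, he, h2, rfl, rfl⟩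
    · intro hv
      refine hv.mem_of_closed (P := fun v => v < s₁.reg 0 ∧ (splitClose.den s₁).arr 10 v ≠ 0)
        ⟨hxK, hinv.mono x ((hres x hxK).2 rfl)⟩ ?_
      rintro a c ⟨ha, ha'⟩ hac
      obtain ⟨F, hF, hs, hc⟩ := hac.arc
      have hne : a ≠ c := by
        rintro rfl
        exact hI.source_notMem_sinks F hF (hs ▸ hc)
      obtain ⟨e, he, e1, rfl, rfl⟩ := (hk1 _ _ hne).1 hac
      exact ⟨hrep.head_lt e he, hcl e he ⟨hne, e1⟩ ha'⟩
  have hsub : marked (splitClose.den s₁) 10 ⊆ I.verts := by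
    intro v hv
    exact ((hT v).1 hv).mem_of_closed hx fun a c _ hac => (StarSystem.arc_mem hI hac.arc).2
  have ht7 := splitTest_spec (s := splitClose.den s₁)
  have y0 : (splitTest.den (splitClose.den s₁)).reg 0 = s₁.reg 0 := (den_reg (by decide)).trans z0
  have y8 : (splitTest.den (splitClose.den s₁)).reg 8 = s₁.reg 8 := (den_reg (by decide)).trans z8
  have ya : (splitTest.den (splitClose.den s₁)).arr 10 = (splitClose.den s₁).arr 10 :=
    den_arr (by decide)
  have hm : marked (splitTest.den (splitClose.den s₁)) 10 = marked (splitClose.den s₁) 10 :=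
    marked_congr (y0.trans z0.symm) ya
  rw [z0, z5, z7, h7] at ht7
  have hfull : (∀ v < s₁.reg 0, s₁.arr 5 v ≠ 0 → (splitClose.den s₁).arr 10 v ≠ 0) ↔
      I.verts ⊆ marked (splitClose.den s₁) 10 := by
    constructor
    · intro hh v hv
      obtain ⟨h1, h2⟩ := (hrep.verts v).1 hv
      exact mem_marked.2 ⟨z0 ▸ h1, hh v h1 h2⟩
    · intro hh v h1 h2
      exact (mem_marked.1 (hh ((hrep.verts v).2 ⟨h1, h2⟩))).2
  constructor
  · intro hne
    by_cases hc : ∀ v < s₁.reg 0, s₁.arr 5 v ≠ 0 → (splitClose.den s₁).arr 10 v ≠ 0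
    · rw [if_pos hc] at ht7; exact absurd ht7 hne
    · rw [if_neg hc] at ht7
      refine ⟨ht7, ?_, ?_⟩
      · rw [hm]
        simp only [StarSystem.cuts, Finset.mem_filter, Finset.mem_powerset]
        exact ⟨hsub, ⟨x, (hT x).2 .refl⟩, fun e => hc (hfull.2 e.ge)⟩
      · rw [hm, y8]
        intro a c ha hac
        exact (hT c).2 (((hT a).1 ha).tail hac)
  · rintro ⟨v, hv, hv'⟩
    rw [if_neg fun hc => hv' ((hT v).1 (hfull.1 hc hv))] at ht7
    rw [ht7]; norm_num

/-! ### The search for a good step -/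

/-- A loop that searches until register `7` is set. -/
theorem count_find {p : Prog} {x : ℕ} {s : State} (J : State → Prop) (G : ℕ → Prop)
    (hwf : (count x p).WellFormed) (hx : x ≠ 7) (hJ : ∀ s' i, J s' → J (s'.setReg x i)) (hs : J s)
    (hstep : ∀ i < s.reg 0, ∀ s', s'.reg x = i → (∀ y, y ∉ x :: p.regs → s'.reg y = s.reg y) →
      J s' → J (p.den s') ∧ (s'.reg 7 ≠ 0 → (p.den s').reg 7 ≠ 0) ∧
        (G i → (p.den s').reg 7 ≠ 0)) :
    J ((count x p).den s) ∧ (s.reg 7 ≠ 0 → ((count x p).den s).reg 7 ≠ 0) ∧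
      ((∃ i < s.reg 0, G i) → ((count x p).den s).reg 7 ≠ 0) := by
  refine count_induct (x := x) (s := s) (P := fun j s' => J s' ∧ (s.reg 7 ≠ 0 → s'.reg 7 ≠ 0) ∧
    ((∃ i < j, G i) → s'.reg 7 ≠ 0)) hwf ⟨hJ _ _ hs, ?_, by simp⟩ ?_
  · simp [State.setReg, hx.symm]
  · intro j s' hj hxj _ hr _ ⟨h1, h2, h3⟩
    obtain ⟨g1, g2, g3⟩ := hstep j hj s' hxj hr h1
    have e : ((p.den s').setReg x (j + 1)).reg 7 = (p.den s').reg 7 := by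
      simp [State.setReg, hx.symm]
    rw [e]
    refine ⟨hJ _ _ g1, fun h => g2 (h2 h), ?_⟩
    rintro ⟨i, hi, hG⟩
    rcases Nat.lt_succ_iff_lt_or_eq.1 hi with hlt | rfl
    exacts [g2 (h3 ⟨i, hlt, hG⟩), g3 hG]

def splitBody : Prog := .ite (.reg 7) .skip (.ite (.load 5 (.reg 14)) split .skip)

/-- Tests whether the three assigned stars determine a good step. -/
def attempt : Prog :=
  .seq prep (.ite (.reg 19) (.ite (.lt (.const 3) (.reg 20)) (.assign 7 (.const 1))
    (.count 14 splitBody)) .skip)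

/-- The arrays hold a perfect set with one or two cuts, as a good step requires. -/
def Found (I : StarSystem ℕ ℕ) (s : State) : Prop :=
  ∃ U g, Candidate I s U g ∧
    ((s.reg 7 = 1 ∧ 4 ≤ U.card) ∨ (s.reg 7 = 2 ∧ SplitCut I s U))

theorem Candidate.congr {I : StarSystem ℕ ℕ} {s s' : State} {U : Finset ℕ} {g : ℕ → ℕ}
    (h : Candidate I s U g) (h0 : s'.reg 0 = s.reg 0) (h8 : s'.reg 8 = s.reg 8)
    (h15 : s'.reg 15 = s.reg 15) (h20 : s'.reg 20 = s.reg 20) (h9 : s'.arr 9 = s.arr 9)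
    (h13 : s'.arr 13 = s.arr 13) : Candidate I s' U g := by
  refine ⟨(marked_congr h0 h9).symm ▸ h.verts, h20.trans h.card, h.perfect, h15 ▸ h.super,
    h8 ▸ h.encloses, ?_⟩
  rw [h13]; exact h.stars

theorem SplitCut.congr {I : StarSystem ℕ ℕ} {s s' : State} {U : Finset ℕ} (h : SplitCut I s U)
    (h0 : s'.reg 0 = s.reg 0) (h8 : s'.reg 8 = s.reg 8) (h10 : s'.arr 10 = s.arr 10) :
    SplitCut I s' U := by
  unfold SplitCut
  rwa [marked_congr h0 h10, h8]

theorem Found.setReg {I : StarSystem ℕ ℕ} {s : State} (h : Found I s) {x : ℕ} (i : ℕ)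
    (hx : x ∉ [0, 7, 8, 15, 20]) : Found I (s.setReg x i) := by
  obtain ⟨U, g, h1, h2⟩ := h
  simp only [List.mem_cons, List.not_mem_nil, or_false, not_or] at hx
  have e : ∀ y, y ≠ x → (s.setReg x i).reg y = s.reg y := fun y hy => by
    simp [State.setReg, hy]
  refine ⟨U, g, h1.congr (e 0 (by omega)) (e 8 (by omega)) (e 15 (by omega)) (e 20 (by omega))
    rfl rfl, ?_⟩
  rw [e 7 (by omega)]
  exact h2.imp id fun h => ⟨h.1, h.2.congr (e 0 (by omega)) (e 8 (by omega)) rfl⟩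

theorem splitLoop_spec {s : State} {I : StarSystem ℕ ℕ} (hI : I.IsInstance) (h : Represents s I)
    {U : Finset ℕ} {g : ℕ → ℕ} (hcand : Candidate I s U g) (hk : KeepsStars I s U)
    (h7 : s.reg 7 = 0) :
    (((count 14 splitBody).den s).reg 7 ≠ 0 → Found I ((count 14 splitBody).den s)) ∧
      (I.Splits (s.reg 8) U → ((count 14 splitBody).den s).reg 7 ≠ 0) := by
  obtain ⟨k1, -, k3⟩ := count_find (p := splitBody) (x := 14) (s := s)
    (J := fun s' => s'.reg 0 = s.reg 0 ∧ s'.reg 8 = s.reg 8 ∧ s'.reg 15 = s.reg 15 ∧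
      s'.reg 20 = s.reg 20 ∧ (∀ a, a ≠ 10 → a ≠ 14 → s'.arr a = s.arr a) ∧
      (s'.reg 7 ≠ 0 → s'.reg 7 = 2 ∧ SplitCut I s' U))
    (G := fun i => i ∈ I.verts ∧ ∃ v ∈ I.verts, ¬ ReflTransGen (I.KeptArc (s.reg 8) U) i v)
    (by refine ⟨by norm_num, by decide, ?_⟩
        simp [splitBody, split, splitReset, splitClose, splitTest, close, WellFormed, regs])
    (by norm_num)
    (by
      rintro s' i ⟨h0, h8, h15, h20, ha, hc⟩
      refine ⟨h0, h8, h15, h20, ha, fun hne => ?_⟩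
      obtain ⟨c1, c2⟩ := hc hne
      exact ⟨c1, c2.congr rfl rfl rfl⟩)
    ⟨rfl, rfl, rfl, rfl, fun _ _ _ => rfl, fun hne => absurd h7 hne⟩
    (by
      rintro i hi s' hxi - ⟨h0, h8, h15, h20, ha, hc⟩
      by_cases c7 : s'.reg 7 = 0
      · by_cases c5 : s'.arr 5 i = 0
        · have e : splitBody.den s' = s' := by simp [splitBody, den, Expr.eval, c7, hxi, c5]
          rw [e]
          refine ⟨⟨h0, h8, h15, h20, ha, hc⟩, id, ?_⟩
          rintro ⟨hv, -⟩
          have := ((h.verts i).1 hv).2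
          rw [← ha 5 (by norm_num) (by norm_num)] at this
          exact absurd c5 this
        · have e : splitBody.den s' = split.den s' := by
            simp [splitBody, den, Expr.eval, c7, hxi, c5]
          have hrep : Represents s' I := h.congr h0 (ha 2 (by norm_num) (by norm_num))
            (ha 3 (by norm_num) (by norm_num)) (ha 4 (by norm_num) (by norm_num))
            (ha 5 (by norm_num) (by norm_num))
          have hk' : KeepsStars I s' U := by
            unfold KeepsStars at hk ⊢
            rwa [h0, h8, ha 11 (by norm_num) (by norm_num), ha 2 (by norm_num) (by norm_num),
              ha 3 (by norm_num) (by norm_num), ha 4 (by norm_num) (by norm_num)]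
          have hv : s'.reg 14 ∈ I.verts := by
            rw [hxi]; exact (hrep.verts i).2 ⟨by omega, c5⟩
          obtain ⟨q1, q2⟩ := split_spec hI hrep hk' hv c7
          rw [e]
          refine ⟨⟨(den_reg (by decide)).trans h0, (den_reg (by decide)).trans h8,
            (den_reg (by decide)).trans h15, (den_reg (by decide)).trans h20,
            fun a h1 h2 => (den_arr ?_).trans (ha a h1 h2), q1⟩, fun hc => absurd c7 hc, ?_⟩
          · simp [split, splitReset, splitClose, splitTest, close, arrs, h1, h2]
          · rintro ⟨-, hG⟩
            rw [h8, hxi] at q2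
            exact q2 hG
      · have e : splitBody.den s' = s' := by simp [splitBody, den, Expr.eval, c7]
        rw [e]
        exact ⟨⟨h0, h8, h15, h20, ha, hc⟩, id, fun _ => c7⟩)
  obtain ⟨h0, h8, h15, h20, ha, hc⟩ := k1
  constructor
  · intro hne
    exact ⟨U, g, hcand.congr h0 h8 h15 h20 (ha 9 (by norm_num) (by norm_num))
      (ha 13 (by norm_num) (by norm_num)), .inr (hc hne)⟩
  · rintro ⟨i, hi, v, hv, hno⟩
    exact k3 ⟨i, h.vert_lt hi, hi, v, hv, hno⟩

/-- The first part holds for any seed, so the search may stop at a seed that succeeds by luck. The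
second part makes sure that a determining seed is never missed, whichever completion was computed.
-/
theorem attempt_spec {s : State} {I : StarSystem ℕ ℕ} (hI : I.IsInstance) (h : Represents s I)
    (hb : s.reg 8 ∈ I.verts) (h7 : s.reg 7 = 0)
    {base : ℕ → Option ℕ} (hbase : ∀ u, base u = if s.reg 10 = 0 then none else assigned s 7 u)
    (h1 : s.reg 11 < s.reg 0) (h2 : s.reg 12 < s.reg 0) (h3 : s.reg 13 < s.reg 0)
    (n1 : s.arr 3 (s.reg 11) ≠ s.arr 4 (s.reg 11)) (n2 : s.arr 3 (s.reg 12) ≠ s.arr 4 (s.reg 12))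
    (n3 : s.arr 3 (s.reg 13) ≠ s.arr 4 (s.reg 13)) :
    ((attempt.den s).reg 7 ≠ 0 → Found I (attempt.den s)) ∧
    (I.Determines (s.reg 8)
      (I.seed base (s.arr 2 (s.reg 11)) (s.arr 2 (s.reg 12)) (s.arr 2 (s.reg 13)))
      (I.source (s.arr 2 (s.reg 11))) → (attempt.den s).reg 7 ≠ 0) := by
  obtain ⟨p1, p2⟩ := prep_spec hI h hb hbase h1 h2 h3 n1 n2 n3
  have r0 : (prep.den s).reg 0 = s.reg 0 := den_reg (by decide)
  have r7 : (prep.den s).reg 7 = 0 := (den_reg (by decide)).trans h7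
  have r8 : (prep.den s).reg 8 = s.reg 8 := den_reg (by decide)
  have hrep : Represents (prep.den s) I := h.congr r0 (den_arr (by decide)) (den_arr (by decide))
    (den_arr (by decide)) (den_arr (by decide))
  have e : attempt.den s = (Prog.ite (.reg 19) (.ite (.lt (.const 3) (.reg 20))
    (.assign 7 (.const 1)) (.count 14 splitBody)) .skip).den (prep.den s) := rfl
  rw [e]
  generalize prep.den s = s₁ at *
  by_cases c19 : s₁.reg 19 = 0
  · have e : (Prog.ite (.reg 19) (.ite (.lt (.const 3) (.reg 20))
      (.assign 7 (.const 1)) (.count 14 splitBody)) .skip).den s₁ = s₁ := by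
      simp [den, Expr.eval, c19]
    rw [e]
    exact ⟨fun hc => absurd r7 hc, fun hd => absurd c19 (p2 hd).1⟩
  · obtain ⟨U, g, hcand, hk⟩ := p1 c19
    by_cases c20 : 3 < s₁.reg 20
    · have e : (Prog.ite (.reg 19) (.ite (.lt (.const 3) (.reg 20))
        (.assign 7 (.const 1)) (.count 14 splitBody)) .skip).den s₁ = s₁.setReg 7 1 := by
        simp [den, Expr.eval, c19, c20]
      rw [e]
      refine ⟨fun _ => ⟨U, g, hcand.congr rfl rfl rfl rfl rfl rfl, .inl ⟨rfl, ?_⟩⟩,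
        fun _ => one_ne_zero⟩
      rw [← hcand.card]; exact c20
    · have e : (Prog.ite (.reg 19) (.ite (.lt (.const 3) (.reg 20))
        (.assign 7 (.const 1)) (.count 14 splitBody)) .skip).den s₁ =
          (count 14 splitBody).den s₁ := by
        simp only [den, Expr.eval]
        simp [c19, c20]
      rw [e]
      obtain ⟨q1, q2⟩ := splitLoop_spec hI hrep hcand hk r7
      refine ⟨q1, fun hd => q2 ?_⟩
      obtain ⟨-, -, hs | hs⟩ := p2 hd
      · rw [← hcand.verts, ← hcand.card] at hs
        omega
      · rw [← hcand.verts] at hs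
        rw [r8]; exact hs

def loopAt (x : ℕ) : Expr := .eq (.load 3 (.reg x)) (.load 4 (.reg x))

def searchBody : Prog :=
  .ite (.reg 7) .skip (.ite (loopAt 11) .skip (.ite (loopAt 12) .skip
    (.ite (loopAt 13) .skip attempt)))

/-- Register `10` matters only as zero (empty base) or nonzero (the path as base). Running it up to
`K` repeats work, but all loops keep the same form. -/
def search : Prog := .count 10 (.count 11 (.count 12 (.count 13 searchBody)))

/-- What the search keeps. -/
structure SearchInv (I : StarSystem ℕ ℕ) (s s' : State) : Prop where
  size : s'.reg 0 = s.reg 0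
  last : s'.reg 8 = s.reg 8
  arr : ∀ a ∈ [2, 3, 4, 5, 7], s'.arr a = s.arr a
  found : s'.reg 7 ≠ 0 → Found I s'

theorem SearchInv.setReg {I : StarSystem ℕ ℕ} {s s' : State} (h : SearchInv I s s') {x : ℕ} (i : ℕ)
    (hx : x ∉ [0, 7, 8, 15, 20]) : SearchInv I s (s'.setReg x i) := by
  have hx' := hx
  simp only [List.mem_cons, List.not_mem_nil, or_false, not_or] at hx'
  have e : ∀ y, y ≠ x → (s'.setReg x i).reg y = s'.reg y := fun y hy => by
    simp [State.setReg, hy]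
  refine ⟨(e 0 (by omega)).trans h.size, (e 8 (by omega)).trans h.last, h.arr, fun hne => ?_⟩
  rw [e 7 (by omega)] at hne
  exact (h.found hne).setReg i hx

/-- The stars of three arcs, with the given base assignment, determine a good step. -/
def GoodArcs (I : StarSystem ℕ ℕ) (s : State) (p e₁ e₂ e₃ : ℕ) : Prop :=
  s.arr 3 e₁ ≠ s.arr 4 e₁ ∧ s.arr 3 e₂ ≠ s.arr 4 e₂ ∧ s.arr 3 e₃ ≠ s.arr 4 e₃ ∧
    I.Determines (s.reg 8) (I.seed (fun u => if p = 0 then none else assigned s 7 u)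
      (s.arr 2 e₁) (s.arr 2 e₂) (s.arr 2 e₃)) (I.source (s.arr 2 e₁))

theorem searchBody_spec {s s' : State} {I : StarSystem ℕ ℕ} (hI : I.IsInstance)
    (h : Represents s I) (hb : s.reg 8 ∈ I.verts) (hJ : SearchInv I s s')
    (h1 : s'.reg 11 < s.reg 0) (h2 : s'.reg 12 < s.reg 0) (h3 : s'.reg 13 < s.reg 0) :
    SearchInv I s (searchBody.den s') ∧ (s'.reg 7 ≠ 0 → (searchBody.den s').reg 7 ≠ 0) ∧
      (GoodArcs I s (s'.reg 10) (s'.reg 11) (s'.reg 12) (s'.reg 13) →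
        (searchBody.den s').reg 7 ≠ 0) := by
  have a2 := hJ.arr 2 (by simp)
  have a3 := hJ.arr 3 (by simp)
  have a4 := hJ.arr 4 (by simp)
  have a5 := hJ.arr 5 (by simp)
  have a7 := hJ.arr 7 (by simp)
  by_cases c7 : s'.reg 7 = 0
  · by_cases n : s.arr 3 (s'.reg 11) ≠ s.arr 4 (s'.reg 11) ∧
        s.arr 3 (s'.reg 12) ≠ s.arr 4 (s'.reg 12) ∧ s.arr 3 (s'.reg 13) ≠ s.arr 4 (s'.reg 13)
    · obtain ⟨n1, n2, n3⟩ := n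
      have e : searchBody.den s' = attempt.den s' := by
        simp only [searchBody, loopAt, den, Expr.eval, a3, a4]
        simp [c7, n1, n2, n3]
      have hrep : Represents s' I := h.congr hJ.size a2 a3 a4 a5
      obtain ⟨q1, q2⟩ := attempt_spec hI hrep (by rw [hJ.last]; exact hb) c7
        (base := fun u => if s'.reg 10 = 0 then none else assigned s' 7 u) (fun _ => rfl)
        (hJ.size ▸ h1) (hJ.size ▸ h2) (hJ.size ▸ h3) (by rwa [a3, a4]) (by rwa [a3, a4])
        (by rwa [a3, a4])
      rw [e]
      refine ⟨⟨(den_reg (by decide)).trans hJ.size, (den_reg (by decide)).trans hJ.last, ?_, q1⟩,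
        fun hc => absurd c7 hc, ?_⟩
      · intro a ha
        rw [← hJ.arr a ha]
        refine den_arr ?_
        simp only [List.mem_cons, List.not_mem_nil, or_false] at ha
        rcases ha with rfl | rfl | rfl | rfl | rfl <;> decide
      · rintro ⟨-, -, -, hd⟩
        refine q2 ?_
        have : assigned s' 7 = assigned s 7 := by
          funext u; simp [assigned, hJ.size, a7]
        rw [a2, hJ.last, this]
        exact hd
    · have e : searchBody.den s' = s' := by
        simp only [searchBody, loopAt, den, Expr.eval, a3, a4]
        by_cases m1 : s.arr 3 (s'.reg 11) = s.arr 4 (s'.reg 11) <;>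
          by_cases m2 : s.arr 3 (s'.reg 12) = s.arr 4 (s'.reg 12) <;>
          by_cases m3 : s.arr 3 (s'.reg 13) = s.arr 4 (s'.reg 13) <;>
          simp_all
      rw [e]
      exact ⟨hJ, id, fun hg => absurd ⟨hg.1, hg.2.1, hg.2.2.1⟩ n⟩
  · have e : searchBody.den s' = s' := by simp [searchBody, den, Expr.eval, c7]
    rw [e]
    exact ⟨hJ, id, fun _ => c7⟩

theorem search_spec {s : State} {I : StarSystem ℕ ℕ} (hI : I.IsInstance) (h : Represents s I)
    (hb : s.reg 8 ∈ I.verts) (h7 : s.reg 7 = 0) : SearchInv I s (search.den s) ∧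
      ((∃ p < s.reg 0, ∃ e₁ < s.reg 0, ∃ e₂ < s.reg 0, ∃ e₃ < s.reg 0, GoodArcs I s p e₁ e₂ e₃) →
        (search.den s).reg 7 ≠ 0) := by
  have wf4 : (count 13 searchBody).WellFormed := by
    refine ⟨by norm_num, by decide, ?_⟩
    simp [searchBody, attempt, prep, prepReset, prepSeed, assignStar, prepMark, prepReach, prepKeep,
      prepTest, splitBody, split, splitReset, splitClose, splitTest, close, WellFormed, regs]
  have wf3 : (count 12 (count 13 searchBody)).WellFormed := ⟨by norm_num, by decide, wf4⟩
  have wf2 : (count 11 (count 12 (count 13 searchBody))).WellFormed :=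
    ⟨by norm_num, by decide, wf3⟩
  have wf1 : search.WellFormed := ⟨by norm_num, by decide, wf2⟩
  have l4 : ∀ s', SearchInv I s s' → s'.reg 11 < s.reg 0 → s'.reg 12 < s.reg 0 →
      SearchInv I s ((count 13 searchBody).den s') ∧
        (s'.reg 7 ≠ 0 → ((count 13 searchBody).den s').reg 7 ≠ 0) ∧
        ((∃ e₃ < s'.reg 0, GoodArcs I s (s'.reg 10) (s'.reg 11) (s'.reg 12) e₃) →
          ((count 13 searchBody).den s').reg 7 ≠ 0) := by
    intro s' hJ h1 h2
    refine count_find (SearchInv I s) _ wf4 (by norm_num)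
      (fun s' i hJ => hJ.setReg i (by decide)) hJ ?_
    intro i hi s'' hx hr hJ'
    have r10 := hr 10 (by decide)
    have r11 := hr 11 (by decide)
    have r12 := hr 12 (by decide)
    rw [hJ.size] at hi
    have := searchBody_spec hI h hb hJ' (r11 ▸ h1) (r12 ▸ h2) (hx ▸ hi)
    rwa [r10, r11, r12, hx] at this
  have l3 : ∀ s', SearchInv I s s' → s'.reg 11 < s.reg 0 →
      SearchInv I s ((count 12 (count 13 searchBody)).den s') ∧
        (s'.reg 7 ≠ 0 → ((count 12 (count 13 searchBody)).den s').reg 7 ≠ 0) ∧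
        ((∃ e₂ < s'.reg 0, ∃ e₃ < s.reg 0, GoodArcs I s (s'.reg 10) (s'.reg 11) e₂ e₃) →
          ((count 12 (count 13 searchBody)).den s').reg 7 ≠ 0) := by
    intro s' hJ h1
    refine count_find (SearchInv I s) _ wf3 (by norm_num)
      (fun s' i hJ => hJ.setReg i (by decide)) hJ ?_
    intro i hi s'' hx hr hJ'
    have r10 := hr 10 (by decide)
    have r11 := hr 11 (by decide)
    rw [hJ.size] at hi
    have := l4 s'' hJ' (r11 ▸ h1) (hx ▸ hi)
    rwa [r10, r11, hx, hJ'.size] at this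
  have l2 : ∀ s', SearchInv I s s' →
      SearchInv I s ((count 11 (count 12 (count 13 searchBody))).den s') ∧
        (s'.reg 7 ≠ 0 → ((count 11 (count 12 (count 13 searchBody))).den s').reg 7 ≠ 0) ∧
        ((∃ e₁ < s'.reg 0, ∃ e₂ < s.reg 0, ∃ e₃ < s.reg 0, GoodArcs I s (s'.reg 10) e₁ e₂ e₃) →
          ((count 11 (count 12 (count 13 searchBody))).den s').reg 7 ≠ 0) := by
    intro s' hJ
    refine count_find (SearchInv I s) _ wf2 (by norm_num)
      (fun s' i hJ => hJ.setReg i (by decide)) hJ ?_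
    intro i hi s'' hx hr hJ'
    have r10 := hr 10 (by decide)
    rw [hJ.size] at hi
    have := l3 s'' hJ' (hx ▸ hi)
    rwa [r10, hx, hJ'.size] at this
  have l1 := count_find (s := s) (SearchInv I s)
    (fun p => ∃ e₁ < s.reg 0, ∃ e₂ < s.reg 0, ∃ e₃ < s.reg 0, GoodArcs I s p e₁ e₂ e₃)
    wf1 (by norm_num) (fun s' i hJ => hJ.setReg i (by decide))
    ⟨rfl, rfl, fun _ _ => rfl, fun hc => absurd h7 hc⟩ (by
      intro i hi s'' hx hr hJ'
      have := l2 s'' hJ'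
      rwa [hx, hJ'.size] at this)
  exact ⟨l1.1, l1.2.2⟩

/-- The search succeeds in every system with more than one vertex. -/
theorem search_complete {s : State} {I : StarSystem ℕ ℕ} (hI : I.IsInstance) (h : Represents s I)
    {p : ℕ → ℕ} {k : ℕ} (ht : I.IsTrail (assigned s 7) (s.reg 8) p k) (hcard : I.verts.card ≠ 1)
    (h7 : s.reg 7 = 0) : (search.den s).reg 7 ≠ 0 := by
  have hb : s.reg 8 ∈ I.verts := ht.last ▸ ht.mem k le_rfl
  refine (search_spec hI h hb h7).2 ?_
  obtain ⟨base, hbase, F₁, hF₁, F₂, hF₂, F₃, hF₃, hdet⟩ := ht.exists_determines hI hcard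
  have harc : ∀ F ∈ I.stars, ∃ e < s.reg 0, s.arr 2 e = F ∧ s.arr 3 e ≠ s.arr 4 e := by
    intro F hF
    obtain ⟨v, hv⟩ := hI.sinks_nonempty F hF
    obtain ⟨hne, e, he, e1, e2, e3⟩ := h.exists_arc hI hF hv
    exact ⟨e, he, e1, by rw [e2, e3]; exact hne⟩
  obtain ⟨e₁, he₁, rfl, n1⟩ := harc F₁ hF₁
  obtain ⟨e₂, he₂, rfl, n2⟩ := harc F₂ hF₂
  obtain ⟨e₃, he₃, rfl, n3⟩ := harc F₃ hF₃
  -- The value `1` of register `10`, which stands for the path, must occur in the loop.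
  have hK : 1 < s.reg 0 := by
    have h1 : I.verts ⊆ Finset.range (s.reg 0) := fun v hv => Finset.mem_range.2 (h.vert_lt hv)
    have h2 := Finset.card_le_card h1
    have h3 : 0 < I.verts.card := Finset.card_pos.2 ⟨_, hb⟩
    rw [Finset.card_range] at h2
    omega
  rcases hbase with rfl | rfl
  · exact ⟨1, hK, e₁, he₁, e₂, he₂, e₃, he₃, n1, n2, n3, by simpa using hdet⟩
  · exact ⟨0, by omega, e₁, he₁, e₂, he₂, e₃, he₃, n1, n2, n3, by simpa using hdet⟩

/-! ### Output -/

/-- The word written so far. -/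
def written (s : State) : List ℕ := (List.range (s.reg 22)).map (s.arr 1)

def push (e : Expr) : Prog :=
  .seq (.store 1 (.reg 22) e) (.assign 22 (.add (.reg 22) (.const 1)))

/-- Two passes over the array, because the length is written before the entries. -/
def pushList (a : ℕ) (val : Expr) : Prog :=
  .seq (.assign 24 (.const 0)) (.seq (.count 18 (.ite (.load a (.reg 18))
    (.assign 24 (.add (.reg 24) (.const 1))) .skip)) (.seq (push (.reg 24))
      (.count 18 (.ite (.load a (.reg 18)) (push val) .skip))))

theorem push_written {s : State} {e : Expr} :
    written ((push e).den s) = written s ++ [e.eval s] := by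
  simp only [written, push, den, Expr.eval, State.setReg, State.setArr, Function.update_self,
    List.range_succ, List.map_append, List.map_cons, List.map_nil]
  congr 1
  refine List.map_congr_left fun i hi => ?_
  rw [Function.update_of_ne (List.mem_range.1 hi).ne]

theorem written_congr {s s' : State} (h1 : s'.reg 22 = s.reg 22) (h2 : s'.arr 1 = s.arr 1) :
    written s' = written s := by
  simp [written, h1, h2]

/-- The marked vertices in increasing order. -/
def markedList (s : State) (a : ℕ) : List ℕ :=
  (List.range (s.reg 0)).filter fun v => s.arr a v ≠ 0

theorem toFinset_markedList {s : State} {a : ℕ} : (markedList s a).toFinset = marked s a := by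
  ext v; simp [markedList, mem_marked]

theorem nodup_markedList {s : State} {a : ℕ} : (markedList s a).Nodup :=
  List.nodup_range.filter _

theorem pushList_written {s : State} {a : ℕ} {val : Expr} {f : ℕ → ℕ} (ha : a ≠ 1)
    (hval : ∀ s' : State, (∀ b, b ≠ 1 → s'.arr b = s.arr b) → val.eval s' = f (s'.reg 18)) :
    written ((pushList a val).den s) =
      written s ++ (markedList s a).length :: (markedList s a).map f := by
  have e : (pushList a val).den s = (count 18 (.ite (.load a (.reg 18)) (push val) .skip)).den
      ((push (.reg 24)).den ((count 18 (.ite (.load a (.reg 18))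
        (.assign 24 (.add (.reg 24) (.const 1))) .skip)).den (s.setReg 24 0))) := rfl
  have key1 := count_induct (x := 18) (s := s.setReg 24 0) (p := .ite (.load a (.reg 18))
    (.assign 24 (.add (.reg 24) (.const 1))) .skip)
    (P := fun j s' => s'.reg 24 = ((List.range j).filter fun v => s.arr a v ≠ 0).length)
    (by simp [WellFormed, regs]) (by simp [State.setReg]) (by
      intro j s' hj hx _ hr ha' hP
      have aa : s'.arr a = s.arr a := ha' a (by simp [arrs])
      rw [List.range_succ, List.filter_append, List.length_append, ← hP]
      simp only [den, Expr.eval, hx, aa]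
      by_cases c : s.arr a j = 0 <;> simp [c, State.setReg])
  rw [show (s.setReg 24 0).reg 0 = s.reg 0 by simp [State.setReg]] at key1
  have r0 : ((count 18 (.ite (.load a (.reg 18)) (.assign 24 (.add (.reg 24) (.const 1)))
      .skip)).den (s.setReg 24 0)).reg 0 = s.reg 0 :=
    (den_reg (by simp [regs])).trans (by simp [State.setReg])
  have r22 : ((count 18 (.ite (.load a (.reg 18)) (.assign 24 (.add (.reg 24) (.const 1)))
      .skip)).den (s.setReg 24 0)).reg 22 = s.reg 22 :=
    (den_reg (by simp [regs])).trans (by simp [State.setReg])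
  have ra : ∀ b, ((count 18 (.ite (.load a (.reg 18)) (.assign 24 (.add (.reg 24) (.const 1)))
      .skip)).den (s.setReg 24 0)).arr b = s.arr b := fun b => den_arr (by simp [arrs])
  rw [e]
  generalize (count 18 (.ite (.load a (.reg 18)) (.assign 24 (.add (.reg 24) (.const 1)))
      .skip)).den (s.setReg 24 0) = s₁ at *
  have w1 := push_written (s := s₁) (e := .reg 24)
  have q0 : ((push (.reg 24)).den s₁).reg 0 = s.reg 0 :=
    (den_reg (by simp [push, regs])).trans r0
  have qa : ∀ b, b ≠ 1 → ((push (.reg 24)).den s₁).arr b = s.arr b := fun b hb =>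
    (den_arr (by simp [push, arrs, hb])).trans (ra b)
  rw [written_congr r22 (ra 1)] at w1
  generalize (push (.reg 24)).den s₁ = s₂ at *
  have key2 := count_induct (x := 18) (s := s₂) (p := .ite (.load a (.reg 18)) (push val) .skip)
    (P := fun j s' => written s' = written s₂ ++
      ((List.range j).filter fun v => s.arr a v ≠ 0).map f)
    (by simp [WellFormed, regs, push]) (by simp [written, State.setReg]) (by
      intro j s' hj hx _ hr ha' hP
      have aa : ∀ b, b ≠ 1 → s'.arr b = s.arr b := fun b hb =>
        (ha' b (by simp [push, arrs, hb])).trans (qa b hb)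
      rw [List.range_succ, List.filter_append, List.map_append, ← List.append_assoc, ← hP]
      by_cases c : s.arr a j = 0
      · have e : (Prog.ite (.load a (.reg 18)) (push val) .skip).den s' = s' := by
          simp [den, Expr.eval, hx, aa a ha, c]
        rw [e]
        simp [c, written, State.setReg]
      · have e : (Prog.ite (.load a (.reg 18)) (push val) .skip).den s' = (push val).den s' := by
          simp [den, Expr.eval, hx, aa a ha, c]
        rw [e]
        have e' : written (((push val).den s').setReg 18 (j + 1)) = written ((push val).den s') :=
          written_congr (by simp [State.setReg]) rfl
        rw [e', push_written, hval s' aa, hx]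
        simp [c])
  rw [q0] at key2
  rw [key2, w1, List.append_assoc]
  congr 1
  simp only [Expr.eval, key1]
  rfl

/-- The word of one step. -/
def stepWord (s : Step ℕ ℕ) : List ℕ :=
  s.stars.length :: (s.stars ++ s.super :: s.cuts.length :: s.cuts.flatMap fun S => S.length :: S)

/-- Register `7` doubles as the number of cuts. The first cut is always `{b}`, written as the length
`1` and the letter `b`; the second is taken from array `10`. -/
def emit : Prog :=
  .seq (pushList 9 (.sub (.load 13 (.reg 18)) (.const 1))) (.seq (push (.reg 15))
    (.seq (push (.reg 7)) (.seq (push (.const 1)) (.seq (push (.reg 8))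
      (.seq (.ite (.lt (.const 1) (.reg 7)) (pushList 10 (.reg 18)) .skip)
        (.assign 23 (.add (.reg 23) (.const 1))))))))

theorem emit_written {s : State} (h7 : s.reg 7 = 1 ∨ s.reg 7 = 2) :
    written (emit.den s) = written s ++ stepWord ⟨(markedList s 9).map fun v => s.arr 13 v - 1,
      s.reg 15, [s.reg 8] :: if s.reg 7 = 1 then [] else [markedList s 10]⟩ := by
  have w1 := pushList_written (s := s) (a := 9) (val := .sub (.load 13 (.reg 18)) (.const 1))
    (f := fun v => s.arr 13 v - 1) (by norm_num)
    (fun s' ha => by simp [Expr.eval, ha 13 (by norm_num)])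
  have e : emit.den s = (Prog.seq (.ite (.lt (.const 1) (.reg 7)) (pushList 10 (.reg 18)) .skip)
        (.assign 23 (.add (.reg 23) (.const 1)))).den ((push (.reg 8)).den ((push (.const 1)).den
          ((push (.reg 7)).den ((push (.reg 15)).den
            ((pushList 9 (.sub (.load 13 (.reg 18)) (.const 1))).den s))))) := rfl
  have hp : ∀ (e : Expr) (s : State) y, y ≠ 22 → ((push e).den s).reg y = s.reg y :=
    fun e s y hy => den_reg (by simp [push, regs, hy])
  have hpa : ∀ (e : Expr) (s : State) b, b ≠ 1 → ((push e).den s).arr b = s.arr b :=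
    fun e s b hb => den_arr (by simp [push, arrs, hb])
  have hl : ∀ y, y ≠ 22 → y ≠ 18 → y ≠ 24 →
      ((pushList 9 (.sub (.load 13 (.reg 18)) (.const 1))).den s).reg y = s.reg y :=
    fun y h1 h2 h3 => den_reg (by simp [pushList, push, regs, h1, h2, h3])
  have hla : ∀ b, b ≠ 1 →
      ((pushList 9 (.sub (.load 13 (.reg 18)) (.const 1))).den s).arr b = s.arr b :=
    fun b h1 => den_arr (by simp [pushList, push, arrs, h1])
  have w5 : written ((push (.reg 8)).den ((push (.const 1)).den ((push (.reg 7)).den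
      ((push (.reg 15)).den ((pushList 9 (.sub (.load 13 (.reg 18)) (.const 1))).den s))))) =
      written s ++ (markedList s 9).length :: ((markedList s 9).map fun v => s.arr 13 v - 1) ++
        [s.reg 15, s.reg 7, 1, s.reg 8] := by
    simp only [push_written, w1, Expr.eval, hp _ _ 7 (by norm_num), hp _ _ 8 (by norm_num),
      hl 7 (by norm_num) (by norm_num) (by norm_num), hl 8 (by norm_num) (by norm_num) (by norm_num),
      hl 15 (by norm_num) (by norm_num) (by norm_num)]
    simp
  have z0 : ((push (.reg 8)).den ((push (.const 1)).den ((push (.reg 7)).den ((push (.reg 15)).den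
      ((pushList 9 (.sub (.load 13 (.reg 18)) (.const 1))).den s))))).reg 0 = s.reg 0 := by
    simp only [hp _ _ 0 (by norm_num), hl 0 (by norm_num) (by norm_num) (by norm_num)]
  have z7 : ((push (.reg 8)).den ((push (.const 1)).den ((push (.reg 7)).den ((push (.reg 15)).den
      ((pushList 9 (.sub (.load 13 (.reg 18)) (.const 1))).den s))))).reg 7 = s.reg 7 := by
    simp only [hp _ _ 7 (by norm_num), hl 7 (by norm_num) (by norm_num) (by norm_num)]
  have z10 : ((push (.reg 8)).den ((push (.const 1)).den ((push (.reg 7)).den ((push (.reg 15)).den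
      ((pushList 9 (.sub (.load 13 (.reg 18)) (.const 1))).den s))))).arr 10 = s.arr 10 := by
    simp only [hpa _ _ 10 (by norm_num), hla 10 (by norm_num)]
  rw [e]
  generalize ((push (.reg 8)).den ((push (.const 1)).den ((push (.reg 7)).den ((push (.reg 15)).den
    ((pushList 9 (.sub (.load 13 (.reg 18)) (.const 1))).den s))))) = s₅ at *
  have hm : markedList s₅ 10 = markedList s 10 := by simp [markedList, z0, z10]
  have key : written ((Prog.seq (.ite (.lt (.const 1) (.reg 7)) (pushList 10 (.reg 18)) .skip)
      (.assign 23 (.add (.reg 23) (.const 1)))).den s₅) =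
      written ((Prog.ite (.lt (.const 1) (.reg 7)) (pushList 10 (.reg 18)) .skip).den s₅) :=
    written_congr (by simp [den, State.setReg]) rfl
  rw [key]
  rcases h7 with h7 | h7
  · have e' : (Prog.ite (.lt (.const 1) (.reg 7)) (pushList 10 (.reg 18)) .skip).den s₅ = s₅ := by
      simp [den, Expr.eval, z7, h7]
    rw [e', w5, h7]
    simp [stepWord]
  · have e' : (Prog.ite (.lt (.const 1) (.reg 7)) (pushList 10 (.reg 18)) .skip).den s₅ =
        (pushList 10 (.reg 18)).den s₅ := by
      simp only [den, Expr.eval, z7, h7]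
      simp
    rw [e', pushList_written (f := fun v => v) (by norm_num) (fun s' _ => rfl), w5, hm, h7]
    simp [stepWord]

/-! ### Contraction -/

def renameArcs : Prog :=
  .count 17 (.seq (.ite (.load 9 arcTail) (.store 3 (.reg 17) (.reg 15)) .skip)
    (.ite (.load 9 arcHead) (.store 4 (.reg 17) (.reg 15)) .skip))

def renameVerts : Prog :=
  .seq (.count 18 (.ite (.load 9 (.reg 18)) (.store 5 (.reg 18) (.const 0)) .skip))
    (.store 5 (.reg 15) (.const 1))

theorem renameArcs_spec {s : State} : ∀ e < s.reg 0,
    (renameArcs.den s).arr 3 e = (if s.arr 9 (s.arr 3 e) ≠ 0 then s.reg 15 else s.arr 3 e) ∧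
    (renameArcs.den s).arr 4 e = if s.arr 9 (s.arr 4 e) ≠ 0 then s.reg 15 else s.arr 4 e := by
  have key := count_induct (x := 17) (s := s)
    (p := .seq (.ite (.load 9 arcTail) (.store 3 (.reg 17) (.reg 15)) .skip)
      (.ite (.load 9 arcHead) (.store 4 (.reg 17) (.reg 15)) .skip))
    -- The invariant covers the entries not yet visited too, since round `j` reads the original ends
    -- of entry `j`.
    (P := fun j s' => ∀ e, (s'.arr 3 e = if e < j ∧ s.arr 9 (s.arr 3 e) ≠ 0 then s.reg 15
      else s.arr 3 e) ∧ s'.arr 4 e = if e < j ∧ s.arr 9 (s.arr 4 e) ≠ 0 then s.reg 15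
      else s.arr 4 e) (by simp [WellFormed, regs]) (by simp [State.setReg]) (by
      intro j s' hj hx _ hr ha hP e
      have a9 : s'.arr 9 = s.arr 9 := ha 9 (by decide)
      have r15 : s'.reg 15 = s.reg 15 := hr 15 (by decide)
      obtain ⟨p3, p4⟩ := hP j
      obtain ⟨q3, q4⟩ := hP e
      simp only [lt_irrefl, false_and, if_false] at p3 p4
      have h3 : (Prog.seq (.ite (.load 9 arcTail) (.store 3 (.reg 17) (.reg 15)) .skip)
          (.ite (.load 9 arcHead) (.store 4 (.reg 17) (.reg 15)) .skip)).den s' =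
          { reg := s'.reg, arr := Function.update (Function.update s'.arr 3
              (if s.arr 9 (s.arr 3 j) = 0 then s'.arr 3 else
                Function.update (s'.arr 3) j (s.reg 15))) 4
              (if s.arr 9 (s.arr 4 j) = 0 then s'.arr 4 else
                Function.update (s'.arr 4) j (s.reg 15)) } := by
        simp only [den, Expr.eval, hx, a9, p3, r15]
        by_cases c1 : s.arr 9 (s.arr 3 j) = 0 <;> by_cases c2 : s.arr 9 (s.arr 4 j) = 0 <;>
          simp [c1, c2, State.setArr, hx, a9, p4, r15]
      rw [h3]
      simp only [State.setReg]
      by_cases he : e = j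
      · subst he
        constructor
        · by_cases c1 : s.arr 9 (s.arr 3 e) = 0 <;> simp [c1, p3]
        · by_cases c1 : s.arr 9 (s.arr 4 e) = 0 <;> simp [c1, p4]
      · have : e < j + 1 ↔ e < j := by omega
        simp only [this, ← q3, ← q4]
        constructor
        · by_cases c1 : s.arr 9 (s.arr 3 j) = 0 <;> simp [c1, he]
        · by_cases c1 : s.arr 9 (s.arr 4 j) = 0 <;> simp [c1, he])
  intro e he
  have := key e
  simp only [he, true_and] at this
  exact this

theorem renameVerts_spec {s : State} : ∀ v < s.reg 0,
    ((renameVerts.den s).arr 5 v ≠ 0 ↔ v = s.reg 15 ∨ (s.arr 9 v = 0 ∧ s.arr 5 v ≠ 0)) := by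
  have key := count_induct (x := 18) (s := s)
    (p := .ite (.load 9 (.reg 18)) (.store 5 (.reg 18) (.const 0)) .skip)
    (P := fun j s' => ∀ v, s'.arr 5 v = if v < j ∧ s.arr 9 v ≠ 0 then 0 else s.arr 5 v)
    (by simp [WellFormed, regs]) (by simp [State.setReg]) (by
      intro j s' hj hx _ hr ha hP v
      have a9 : s'.arr 9 = s.arr 9 := ha 9 (by decide)
      have hv := hP v
      simp only [den, Expr.eval, hx, a9]
      by_cases e : v = j
      · subst e
        by_cases c : s.arr 9 v = 0
        · simp [c, State.setReg, hv]
        · simp [c, State.setReg, State.setArr]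
      · have : v < j + 1 ↔ v < j := by omega
        simp only [this, ← hv]
        by_cases c : s.arr 9 j = 0 <;> simp [c, State.setReg, State.setArr, e])
  have r15 : ((count 18 (.ite (.load 9 (.reg 18)) (.store 5 (.reg 18) (.const 0)) .skip)).den
      s).reg 15 = s.reg 15 := den_reg (by decide)
  intro v hv
  have e : renameVerts.den s = ((count 18 (.ite (.load 9 (.reg 18)) (.store 5 (.reg 18)
    (.const 0)) .skip)).den s).setArr 5 (((count 18 (.ite (.load 9 (.reg 18))
      (.store 5 (.reg 18) (.const 0)) .skip)).den s).reg 15) 1 := rfl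
  rw [e, r15]
  generalize (count 18 (.ite (.load 9 (.reg 18)) (.store 5 (.reg 18) (.const 0)) .skip)).den s = s₁
    at *
  have hv' := key v
  by_cases c : v = s.reg 15
  · simp [State.setArr, c]
  · by_cases c9 : s.arr 9 v = 0 <;> simp [State.setArr, c, hv', hv, c9]

/-- The step that the arrays hold. -/
def foundStep (s : State) : Step ℕ ℕ :=
  ⟨(markedList s 9).map fun v => s.arr 13 v - 1, s.reg 15,
    [s.reg 8] :: if s.reg 7 = 1 then [] else [markedList s 10]⟩

theorem Candidate.toFinset_stars {s : State} {I : StarSystem ℕ ℕ} {U : Finset ℕ} {g : ℕ → ℕ}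
    (h : Candidate I s U g) : (foundStep s).stars.toFinset = U.image g := by
  ext F
  simp only [foundStep, List.mem_toFinset, List.mem_map, Finset.mem_image]
  refine exists_congr fun v => ?_
  rw [← List.mem_toFinset, toFinset_markedList, ← h.verts]
  refine and_congr_right fun hv => ?_
  rw [h.stars v hv, Nat.add_sub_cancel]

/-- `{b}` is internal because the perfect set encloses `b`. The set in array `10`, if used, is
closed under kept arcs, hence crossed only by stars of the perfect set's interior with a source
other than `b`: it is internal and star-disjoint from `{b}`. -/
theorem Found.isGoodStep {s : State} {I : StarSystem ℕ ℕ} (hb : s.reg 8 ∈ I.verts)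
    (hcard : I.verts.card ≠ 1) (h : Found I s) : I.IsGoodStep (foundStep s) := by
  obtain ⟨U, g, hc, hor⟩ := h
  have hmem : ∀ v ∈ markedList s 9, v ∈ U := fun v hv => by
    rwa [hc.verts, ← toFinset_markedList, List.mem_toFinset]
  have hcut : ({s.reg 8} : Finset ℕ) ∈ I.cuts ∧ I.IsInternal (U.image g) {s.reg 8} :=
    ⟨StarSystem.singleton_mem_cuts hb hcard, hc.encloses.isInternal hc.perfect⟩
  refine ⟨?_, ?_, ?_, ?_, ?_⟩
  · refine List.Nodup.map_on (fun u hu v hv e => ?_) nodup_markedList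
    rw [hc.stars u (hmem u hu), hc.stars v (hmem v hv), Nat.add_sub_cancel, Nat.add_sub_cancel] at e
    rw [← hc.perfect.source u (hmem u hu), ← hc.perfect.source v (hmem v hv), e]
  · rw [hc.toFinset_stars]
    exact hc.perfect.isPerfect ⟨_, hc.super⟩
  · rw [hc.toFinset_stars, hc.perfect.sources_image]
    exact hc.super
  · rw [hc.toFinset_stars]
    intro S hS
    simp only [foundStep, List.mem_cons] at hS
    rcases hS with rfl | hS
    · simpa using hcut
    · rcases hor with ⟨h7, -⟩ | ⟨h7, h1, h2⟩
      · simp [h7] at hS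
      · simp only [h7, OfNat.ofNat_ne_one, if_false, List.mem_singleton] at hS
        rw [hS, toFinset_markedList]
        exact ⟨h1, StarSystem.isInternal_of_closed hc.perfect h2⟩
  · rcases hor with ⟨h7, h4⟩ | ⟨h7, h1, h2⟩
    · left
      rw [hc.verts, ← toFinset_markedList, List.toFinset_card_of_nodup nodup_markedList] at h4
      simpa [foundStep, h7] using h4
    · right
      refine ⟨[s.reg 8], markedList s 10, by simp [foundStep, h7], ?_⟩
      rw [toFinset_markedList]
      simpa using StarSystem.starDisjoint_of_closed h2

/-- Renaming the ends of the arcs and the vertices contracts the perfect set. -/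
theorem Represents.contract {s s' : State} {I : StarSystem ℕ ℕ} (hI : I.IsInstance)
    (h : Represents s I) {Q : Finset ℕ} {t : ℕ} (ht : t ∈ I.sources Q) (hQ : Q ⊆ I.stars)
    (h9 : ∀ v < s.reg 0, s.arr 9 v ≠ 0 ↔ v ∈ I.sources Q)
    (h0 : s'.reg 0 = s.reg 0) (h2 : s'.arr 2 = s.arr 2)
    (h3 : ∀ e < s.reg 0, s'.arr 3 e = if s.arr 9 (s.arr 3 e) ≠ 0 then t else s.arr 3 e)
    (h4 : ∀ e < s.reg 0, s'.arr 4 e = if s.arr 9 (s.arr 4 e) ≠ 0 then t else s.arr 4 e)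
    (h5 : ∀ v < s.reg 0, s'.arr 5 v ≠ 0 ↔ v = t ∨ (s.arr 9 v = 0 ∧ s.arr 5 v ≠ 0)) :
    Represents s' (I.contract Q t) := by
  have hsub := StarSystem.sources_subset hI hQ
  have htK := h.vert_lt (hsub ht)
  have c3 : ∀ e < s.reg 0, s'.arr 3 e = I.collapse Q t (s.arr 3 e) := fun e he => by
    rw [h3 e he, StarSystem.collapse]
    exact if_congr (h9 _ (h.tail_lt e he)) rfl rfl
  have c4 : ∀ e < s.reg 0, s'.arr 4 e = I.collapse Q t (s.arr 4 e) := fun e he => by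
    rw [h4 e he, StarSystem.collapse]
    exact if_congr (h9 _ (h.head_lt e he)) rfl rfl
  have clt : ∀ v < s.reg 0, I.collapse Q t v < s.reg 0 := fun v hv => by
    unfold StarSystem.collapse
    split_ifs
    exacts [htK, hv]
  refine ⟨fun v => ?_, fun F u v huv => ?_, ?_, ?_, ?_⟩
  · rw [StarSystem.mem_contract_verts, h0]
    constructor
    · rintro ⟨w, hw, rfl⟩
      have hwK := h.vert_lt hw
      refine ⟨clt w hwK, (h5 _ (clt w hwK)).2 ?_⟩
      by_cases hwQ : w ∈ I.sources Q
      · exact .inl (StarSystem.collapse_of_mem hwQ)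
      · rw [StarSystem.collapse_of_notMem hwQ]
        exact .inr ⟨not_not.1 fun hc => hwQ ((h9 w hwK).1 hc), ((h.verts w).1 hw).2⟩
    · rintro ⟨hv, hv5⟩
      rcases (h5 v hv).1 hv5 with rfl | ⟨a9, a5⟩
      · exact ⟨v, hsub ht, StarSystem.collapse_of_mem ht⟩
      · exact ⟨v, (h.verts v).2 ⟨hv, a5⟩,
          StarSystem.collapse_of_notMem fun hc => (h9 v hv).2 hc a9⟩
  · rw [h0, StarSystem.mem_contract_stars, StarSystem.contract_source,
      StarSystem.mem_contract_sinks, h2]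
    constructor
    · rintro ⟨e, he, rfl, rfl, rfl⟩
      rw [c3 e he, c4 e he] at huv ⊢
      obtain ⟨f1, f2, f3⟩ := h.arc_of he fun hc => huv (by rw [hc])
      rw [f2]
      exact ⟨⟨f1, _, f3, huv.symm⟩, rfl, huv.symm, _, f3, rfl⟩
    · rintro ⟨⟨hF, -⟩, rfl, -, w, hw, rfl⟩
      obtain ⟨-, e, he, e1, e2, e3⟩ := h.exists_arc hI hF hw
      exact ⟨e, he, e1, by rw [c3 e he, e2], by rw [c4 e he, e3]⟩
  · rw [h0, h2]; exact h.star_lt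
  · rw [h0]
    intro e he
    rw [c3 e he]; exact clt _ (h.tail_lt e he)
  · rw [h0]
    intro e he
    rw [c4 e he]; exact clt _ (h.head_lt e he)

/-- Writes and contracts the step that has been found. -/
def finish : Prog := .seq emit (.seq renameArcs renameVerts)

theorem finish_spec {s : State} {I : StarSystem ℕ ℕ} (hI : I.IsInstance) (h : Represents s I)
    (hf : Found I s) :
    Represents (finish.den s) (I.contract (foundStep s).stars.toFinset (foundStep s).super) ∧
      written (finish.den s) = written s ++ stepWord (foundStep s) ∧
      (finish.den s).reg 23 = s.reg 23 + 1 := by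
  have h7 : s.reg 7 = 1 ∨ s.reg 7 = 2 := by
    obtain ⟨U, g, -, h | h⟩ := hf
    exacts [.inl h.1, .inr h.1]
  have e : finish.den s = renameVerts.den (renameArcs.den (emit.den s)) := rfl
  have w1 := emit_written h7
  have r0 : (emit.den s).reg 0 = s.reg 0 := den_reg (by decide)
  have r15 : (emit.den s).reg 15 = s.reg 15 := den_reg (by decide)
  have r23 : (emit.den s).reg 23 = s.reg 23 + 1 := by
    -- The same program bracketed differently, so that only the last assignment touches register
    -- `23`.
    let p : Prog := .seq (pushList 9 (.sub (.load 13 (.reg 18)) (.const 1)))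
      (.seq (push (.reg 15)) (.seq (push (.reg 7)) (.seq (push (.const 1)) (.seq (push (.reg 8))
        (.ite (.lt (.const 1) (.reg 7)) (pushList 10 (.reg 18)) .skip)))))
    have e' : emit.den s = (Prog.assign 23 (.add (.reg 23) (.const 1))).den (p.den s) := rfl
    have hp : (p.den s).reg 23 = s.reg 23 := den_reg (by decide)
    rw [e']
    generalize p.den s = s' at hp
    simp [den, Expr.eval, State.setReg, hp]
  have ra : ∀ a, a ≠ 1 → (emit.den s).arr a = s.arr a := fun a ha =>
    den_arr (by simp [emit, push, pushList, arrs, ha])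
  rw [e]
  generalize emit.den s = s₁ at *
  have k1 := renameArcs_spec (s := s₁)
  have q : ∀ x ∈ [0, 15, 22, 23], (renameArcs.den s₁).reg x = s₁.reg x := by
    intro x hx
    refine den_reg ?_
    simp only [List.mem_cons, List.not_mem_nil, or_false] at hx
    rcases hx with rfl | rfl | rfl | rfl <;> decide
  have qa : ∀ a, a ≠ 3 → a ≠ 4 → (renameArcs.den s₁).arr a = s₁.arr a := fun a h3 h4 =>
    den_arr (by simp [renameArcs, arrs, h3, h4])
  generalize renameArcs.den s₁ = s₂ at *
  have k2 := renameVerts_spec (s := s₂)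
  have z : ∀ x ∈ [0, 15, 22, 23], (renameVerts.den s₂).reg x = s₁.reg x := by
    intro x hx
    refine (den_reg ?_).trans (q x hx)
    simp only [List.mem_cons, List.not_mem_nil, or_false] at hx
    rcases hx with rfl | rfl | rfl | rfl <;> decide
  have za : ∀ a, a ≠ 5 → (renameVerts.den s₂).arr a = s₂.arr a := fun a h5 =>
    den_arr (by simp [renameVerts, arrs, h5])
  generalize renameVerts.den s₂ = s₃ at *
  refine ⟨?_, ?_, (z 23 (by decide)).trans r23⟩
  · obtain ⟨U, g, hc, -⟩ := hf
    have hsrc : I.sources (foundStep s).stars.toFinset = U := by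
      rw [hc.toFinset_stars, hc.perfect.sources_image]
    have hQ := (hc.perfect.isPerfect ⟨_, hc.super⟩).1.1
    rw [← hc.toFinset_stars] at hQ
    have h15 : s₂.reg 15 = s.reg 15 := (q 15 (by decide)).trans r15
    have h0 : s₂.reg 0 = s.reg 0 := (q 0 (by decide)).trans r0
    refine h.contract hI (by rw [hsrc]; exact hc.super) hQ (fun v hv => ?_)
      ((z 0 (by decide)).trans r0) ?_ ?_ ?_ ?_
    · rw [hsrc, hc.verts, mem_marked]
      simp [hv]
    · rw [za 2 (by norm_num), qa 2 (by norm_num) (by norm_num), ra 2 (by norm_num)]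
    · intro e he
      rw [za 3 (by norm_num), (k1 e (by omega)).1, ra 9 (by norm_num), ra 3 (by norm_num), r15]
      rfl
    · intro e he
      rw [za 4 (by norm_num), (k1 e (by omega)).2, ra 9 (by norm_num), ra 4 (by norm_num), r15]
      rfl
    · intro v hv
      rw [k2 v (by omega), qa 9 (by norm_num) (by norm_num), qa 5 (by norm_num) (by norm_num),
        ra 9 (by norm_num), ra 5 (by norm_num), h15]
      rfl
  · rw [written_congr (z 22 (by decide))
      ((za 1 (by norm_num)).trans (qa 1 (by norm_num) (by norm_num))), w1]
    rfl

/-- One iteration: finds, writes and contracts a good step if there is more than one vertex. -/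
def iterate : Prog :=
  .seq (.assign 7 (.const 0)) (.seq path (.seq search (.ite (.reg 7) finish .skip)))

/-- With one vertex left nothing can be found, since a perfect set has at least two vertices; the
iteration then keeps the representation and the output. So running a fixed number of iterations is
harmless. -/
theorem iterate_spec {s : State} {I : StarSystem ℕ ℕ} (hI : I.IsInstance) (h : Represents s I) :
    (I.verts.card = 1 → Represents (iterate.den s) I ∧ written (iterate.den s) = written s ∧
      (iterate.den s).reg 23 = s.reg 23) ∧
    (I.verts.card ≠ 1 → ∃ st : Step ℕ ℕ, I.IsGoodStep st ∧
      Represents (iterate.den s) (I.contract st.stars.toFinset st.super) ∧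
      written (iterate.den s) = written s ++ stepWord st ∧
      (iterate.den s).reg 23 = s.reg 23 + 1) := by
  have e : iterate.den s = (Prog.ite (.reg 7) finish .skip).den
    (search.den (path.den (s.setReg 7 0))) := rfl
  have hrep : Represents (s.setReg 7 0) I := h.congr rfl rfl rfl rfl rfl
  obtain ⟨p, k, ht⟩ := path_spec hI hrep
  have hrep1 : Represents (path.den (s.setReg 7 0)) I := hrep.congr (den_reg (by decide))
    (den_arr (by decide)) (den_arr (by decide)) (den_arr (by decide)) (den_arr (by decide))
  have h7 : (path.den (s.setReg 7 0)).reg 7 = 0 := (den_reg (by decide)).trans rfl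
  have w1 : written (path.den (s.setReg 7 0)) = written s :=
    written_congr (den_reg (by decide)) (den_arr (by decide))
  have r23 : (path.den (s.setReg 7 0)).reg 23 = s.reg 23 := den_reg (by decide)
  rw [e]
  generalize path.den (s.setReg 7 0) = s₁ at *
  have hb : s₁.reg 8 ∈ I.verts := ht.last ▸ ht.mem k le_rfl
  have hS := (search_spec hI hrep1 hb h7).1
  have hcomp := fun hc => search_complete hI hrep1 ht hc h7
  have w2 : written (search.den s₁) = written s₁ :=
    written_congr (den_reg (by decide)) (den_arr (by decide))
  have z23 : (search.den s₁).reg 23 = s₁.reg 23 := den_reg (by decide)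
  generalize search.den s₁ = s₂ at *
  have hrep2 : Represents s₂ I := hrep1.congr hS.size (hS.arr 2 (by decide)) (hS.arr 3 (by decide))
    (hS.arr 4 (by decide)) (hS.arr 5 (by decide))
  constructor
  · intro hcard
    have h7' : s₂.reg 7 = 0 := by
      by_contra hc
      obtain ⟨U, g, hcand, -⟩ := hS.found hc
      have h1 := hcand.perfect.one_lt_card hI hcand.super
      have h2 := Finset.card_le_card hcand.perfect.subset
      omega
    have e' : (Prog.ite (.reg 7) finish .skip).den s₂ = s₂ := by simp [den, Expr.eval, h7']
    rw [e']
    exact ⟨hrep2, w2.trans w1, z23.trans r23⟩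
  · intro hcard
    have h7' := hcomp hcard
    have e' : (Prog.ite (.reg 7) finish .skip).den s₂ = finish.den s₂ := by
      simp [den, Expr.eval, h7']
    obtain ⟨f1, f2, f3⟩ := finish_spec hI hrep2 (hS.found h7')
    rw [e']
    exact ⟨foundStep s₂, (hS.found h7').isGoodStep (hS.last ▸ hb) hcard, f1,
      by rw [f2, w2, w1], by rw [f3, z23, r23]⟩

/-- Repeats the iteration until a single vertex is left. -/
def contractAll : Prog := .count 6 iterate

theorem contractAll_wellFormed : contractAll.WellFormed := by
  refine ⟨by norm_num, by decide, ?_⟩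
  simp [iterate, path, pathInit, pathScan, pathGrow, search, searchBody, attempt, prep, prepReset,
    prepSeed, assignStar, prepMark, prepReach, prepKeep, prepTest, splitBody, split, splitReset,
    splitClose, splitTest, close, finish, emit, push, pushList, renameArcs, renameVerts, WellFormed,
    regs]

theorem contractAll_spec {s : State} {I : StarSystem ℕ ℕ} (hI : I.IsInstance)
    (h : Represents s I) : ∃ l, I.IsRun l ∧
      written (contractAll.den s) = written s ++ l.flatMap stepWord ∧
      (contractAll.den s).reg 23 = s.reg 23 + l.length := by
  have key := count_induct (x := 6) (s := s) (p := iterate)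
    -- The steps so far are stored as a prefix that turns every run of the current system `I'` into
    -- a run of `I`. Each iteration with more than one vertex removes at least one, so `K`
    -- iterations suffice.
    (P := fun j s' => ∃ l I', (∀ l', StarSystem.IsRun I' l' → I.IsRun (l ++ l')) ∧
      written s' = written s ++ l.flatMap stepWord ∧ s'.reg 23 = s.reg 23 + l.length ∧
      Represents s' I' ∧ I'.IsInstance ∧ I'.verts.card ≤ max 1 (s.reg 0 - j))
    contractAll_wellFormed
    ⟨[], I, fun l' => id, by simp [written, State.setReg], by simp [State.setReg],
      h.congr rfl rfl rfl rfl rfl, hI, by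
        have h1 : I.verts ⊆ Finset.range (s.reg 0) := fun v hv => Finset.mem_range.2 (h.vert_lt hv)
        have h2 := Finset.card_le_card h1
        rw [Finset.card_range] at h2
        omega⟩ (by
      rintro j s' hj - h0 - - ⟨l, I', hl, hw, h23, hrep, hI', hcard⟩
      have w' : written ((iterate.den s').setReg 6 (j + 1)) = written (iterate.den s') :=
        written_congr rfl rfl
      have r' : ((iterate.den s').setReg 6 (j + 1)).reg 23 = (iterate.den s').reg 23 := rfl
      obtain ⟨g1, g2⟩ := iterate_spec hI' hrep
      rw [w', r']
      by_cases hc : I'.verts.card = 1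
      · obtain ⟨f1, f2, f3⟩ := g1 hc
        exact ⟨l, I', hl, f2.trans hw, f3.trans h23, f1.congr rfl rfl rfl rfl rfl, hI', by omega⟩
      · obtain ⟨st, f0, f1, f2, f3⟩ := g2 hc
        refine ⟨l ++ [st], _, fun l' hl' => ?_, ?_, ?_, f1.congr rfl rfl rfl rfl rfl,
          StarSystem.contract_isInstance hI' _ _, ?_⟩
        · rw [List.append_assoc]
          exact hl _ ⟨hc, f0, hl'⟩
        · rw [f2, hw]; simp
        · rw [f3, h23]; simp [add_assoc]
        · have h1 := StarSystem.contract_card hI' f0.2.1.1 f0.2.2.1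
          have h2 := StarSystem.IsPerfect.two_le_card hI' f0.2.1 f0.2.2.1
          have h3 : 0 < I'.verts.card := Finset.card_pos.2 hI'.stronglyConnected.1
          omega)
  obtain ⟨l, I', hl, hw, h23, -, hI', hcard⟩ := key
  have h3 : 0 < I'.verts.card := Finset.card_pos.2 hI'.stronglyConnected.1
  refine ⟨l, ?_, hw, h23⟩
  have := hl [] (show I'.verts.card = 1 by omega)
  simpa using this

end RAM

/-! ### Input -/

def starsWord (L : List (ℕ × List ℕ)) : List ℕ := L.flatMap fun F => F.1 :: F.2.length :: F.2

theorem listedWord_length (n : ℕ) (L : List (ℕ × List ℕ)) :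
    L.length + 2 ≤ (listedWord n L).length := by
  simp [listedWord]

theorem listed_getD {L L' : List (ℕ × List ℕ)} {m : ℕ} {F : ℕ × List ℕ} (h : L.drop m = F :: L') :
    m < L.length ∧ F ∈ L ∧ L.getD m (0, []) = F ∧ L.drop (m + 1) = L' := by
  have hm : m < L.length := by
    by_contra hc
    rw [List.drop_eq_nil_of_le (by omega)] at h
    simp at h
  rw [List.drop_eq_getElem_cons hm, List.cons.injEq] at h
  refine ⟨hm, h.1 ▸ List.getElem_mem hm, ?_, h.2⟩
  rw [List.getD_eq_getElem _ _ hm, h.1]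

theorem listed_mem {n : ℕ} {L : List (ℕ × List ℕ)} (hI : (listedSystem n L).IsInstance)
    {F : ℕ × List ℕ} (hF : F ∈ L) : F.1 < n ∧ (∀ v ∈ F.2, v < n) ∧ F.2 ≠ [] := by
  obtain ⟨i, hi, rfl⟩ := List.mem_iff_getElem.1 hF
  have hs : i ∈ (listedSystem n L).stars := Finset.mem_range.2 hi
  have h1 := hI.source_mem i hs
  have h2 := hI.sinks_subset i hs
  have h3 := hI.sinks_nonempty i hs
  simp only [listedSystem, List.getD_eq_getElem _ _ hi, Finset.mem_range] at h1 h2 h3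
  refine ⟨h1, fun v hv => Finset.mem_range.1 (h2 (List.mem_toFinset.2 hv)), ?_⟩
  rintro e
  simp [e] at h3

/-- A system with more than one vertex has at least as many stars as vertices. -/
theorem StarSystem.IsInstance.card_le {V ι : Type*} [DecidableEq V] [DecidableEq ι]
    {I : StarSystem V ι} (hI : I.IsInstance) (h : I.verts.card ≠ 1) :
    I.verts.card ≤ I.stars.card := by
  refine le_trans (Finset.card_le_card fun u hu => ?_) (Finset.card_image_le (f := I.source))
  have h1 : 1 < I.verts.card := by
    have := Finset.card_pos.2 ⟨u, hu⟩
    omega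
  obtain ⟨v, hv, huv⟩ := Finset.exists_mem_ne h1 u
  rcases (hI.stronglyConnected.2 u hu v hv).cases_head with e | ⟨w, ⟨-, -, F, hF, e, -⟩, -⟩
  · exact absurd e huv.symm
  · exact Finset.mem_image.2 ⟨F, hF, e⟩

/-- All loops run up to the length of the word, so it must bound the number of vertices. Since `n`
is a single letter, this needs strong connectivity: for `n ≠ 1` every vertex is the source of a
star, and every star has letters of its own. -/
theorem listed_le {n : ℕ} {L : List (ℕ × List ℕ)} (hI : (listedSystem n L).IsInstance) :
    n ≤ (listedWord n L).length := by
  have hl := listedWord_length n L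
  by_cases h : (listedSystem n L).verts.card = 1
  · simp only [listedSystem, Finset.card_range] at h
    omega
  · have := hI.card_le h
    simp only [listedSystem, Finset.card_range] at this
    omega

namespace RAM

open Prog

/-- Reads one letter: the source of a star, the number of its sinks, or a sink. -/
def parseLetter : Prog :=
  .ite (.lt (.reg 1) (.const 2)) .skip
    (.ite (.eq (.reg 2) (.const 0)) (.seq (.assign 4 (.load 0 (.reg 1))) (.assign 2 (.const 1)))
      (.ite (.eq (.reg 2) (.const 1)) (.seq (.assign 3 (.load 0 (.reg 1))) (.assign 2 (.const 2)))
        (.seq (.store 2 (.reg 1) (.reg 5)) (.seq (.store 3 (.reg 1) (.reg 4))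
          (.seq (.store 4 (.reg 1) (.load 0 (.reg 1))) (.seq (.assign 3 (.sub (.reg 3) (.const 1)))
            (.ite (.reg 3) .skip
              (.seq (.assign 2 (.const 0)) (.assign 5 (.add (.reg 5) (.const 1)))))))))))

def parse : Prog := .count 1 parseLetter

/-- The first `m` stars and the sinks `D` of the next star have been stored. -/
structure Parsed (L : List (ℕ × List ℕ)) (K m : ℕ) (D : List ℕ) (j : ℕ) (s : State) : Prop where
  arcs : ∀ F u v, u ≠ v → ((∃ e < K, s.arr 2 e = F ∧ s.arr 3 e = u ∧ s.arr 4 e = v) ↔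
    (F < m ∧ (L.getD F (0, [])).1 = u ∧ v ∈ (L.getD F (0, [])).2) ∨
      (F = m ∧ (L.getD m (0, [])).1 = u ∧ v ∈ D))
  lt : ∀ e, s.arr 2 e < K ∧ s.arr 3 e < K ∧ s.arr 4 e < K
  fresh : ∀ e, j ≤ e → s.arr 3 e = 0 ∧ s.arr 4 e = 0

/-- What is known before the letter number `j` is read; `w` is the rest of the word. -/
def ParseInv (L : List (ℕ × List ℕ)) (K : ℕ) (w : List ℕ) (j : ℕ) (s : State) : Prop :=
  ∃ m D, m ≤ L.length ∧ s.reg 5 = m ∧ Parsed L K m D j s ∧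
    ((s.reg 2 = 0 ∧ D = [] ∧ w = starsWord (L.drop m)) ∨
      ∃ F L', L.drop m = F :: L' ∧ s.reg 4 = F.1 ∧
        ((s.reg 2 = 1 ∧ D = [] ∧ w = F.2.length :: (F.2 ++ starsWord L')) ∨
          ∃ r, s.reg 2 = 2 ∧ F.2 = D ++ r ∧ r ≠ [] ∧ s.reg 3 = r.length ∧ w = r ++ starsWord L'))

theorem Parsed.congr {L : List (ℕ × List ℕ)} {K m : ℕ} {D : List ℕ} {j j' : ℕ} {s s' : State}
    (h : Parsed L K m D j s) (hj : j ≤ j') (ha : s'.arr = s.arr) : Parsed L K m D j' s' := by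
  refine ⟨?_, ?_, ?_⟩ <;> rw [ha]
  exacts [h.arcs, h.lt, fun e he => h.fresh e (hj.trans he)]

theorem Parsed.store {L L' : List (ℕ × List ℕ)} {K m : ℕ} {D : List ℕ} {j : ℕ} {s s' : State}
    (h : Parsed L K m D j s) {F : ℕ × List ℕ} {v : ℕ} (hj : j < K) (hF : L.drop m = F :: L')
    (hm : m < K) (hu : F.1 < K) (hv : v < K)
    (h2 : s'.arr 2 = Function.update (s.arr 2) j m)
    (h3 : s'.arr 3 = Function.update (s.arr 3) j F.1)
    (h4 : s'.arr 4 = Function.update (s.arr 4) j v) : Parsed L K m (D ++ [v]) (j + 1) s' := by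
  have hg := (listed_getD hF).2.2.1
  refine ⟨fun G x y hxy => ?_, fun e => ?_, fun e he => ?_⟩
  · have hold := h.arcs G x y hxy
    rw [h2, h3, h4, List.mem_append, List.mem_singleton, hg]
    rw [hg] at hold
    constructor
    · rintro ⟨e, he, e2, e3, e4⟩
      by_cases c : e = j
      · subst c
        rw [Function.update_self] at e2 e3 e4
        exact .inr ⟨e2.symm, e3, .inr e4.symm⟩
      · rw [Function.update_of_ne c] at e2 e3 e4
        rcases hold.1 ⟨e, he, e2, e3, e4⟩ with h | ⟨h1, h2, h3⟩
        exacts [.inl h, .inr ⟨h1, h2, .inl h3⟩]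
    · have lift : (∃ e < K, s.arr 2 e = G ∧ s.arr 3 e = x ∧ s.arr 4 e = y) →
          ∃ e < K, Function.update (s.arr 2) j m e = G ∧ Function.update (s.arr 3) j F.1 e = x ∧
            Function.update (s.arr 4) j v e = y := by
        rintro ⟨e, he, e2, e3, e4⟩
        -- An arc is stored at the position of its sink in the word. Position `j` still holds the
        -- loop from `0` to `0`, so no recorded arc is overwritten.
        have c : e ≠ j := by
          rintro rfl
          obtain ⟨f1, f2⟩ := h.fresh e le_rfl
          exact hxy (by rw [← e3, ← e4, f1, f2])
        exact ⟨e, he, by rwa [Function.update_of_ne c], by rwa [Function.update_of_ne c],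
          by rwa [Function.update_of_ne c]⟩
      rintro (h | ⟨h1, h2, h3 | h3⟩)
      · exact lift (hold.2 (.inl h))
      · exact lift (hold.2 (.inr ⟨h1, h2, h3⟩))
      · exact ⟨j, hj, by simp [h1], by simp [h2], by simp [h3]⟩
  · obtain ⟨l2, l3, l4⟩ := h.lt e
    rw [h2, h3, h4]
    by_cases c : e = j
    · subst c; simp [hm, hu, hv]
    · simp [c, l2, l3, l4]
  · rw [h3, h4, Function.update_of_ne (by omega), Function.update_of_ne (by omega)]
    exact h.fresh e (by omega)

/-- A completely stored star. -/
theorem Parsed.next {L L' : List (ℕ × List ℕ)} {K m : ℕ} {j : ℕ} {s : State} {F : ℕ × List ℕ}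
    (h : Parsed L K m F.2 j s) (hF : L.drop m = F :: L') : Parsed L K (m + 1) [] j s := by
  refine ⟨fun G x y hxy => ?_, h.lt, h.fresh⟩
  rw [h.arcs G x y hxy, (listed_getD hF).2.2.1]
  constructor
  · rintro (⟨h1, h2⟩ | ⟨rfl, h2⟩)
    · exact .inl ⟨by omega, h2⟩
    · exact .inl ⟨by omega, by rwa [(listed_getD hF).2.2.1]⟩
  · rintro (⟨h1, h2⟩ | h)
    · rcases Nat.lt_succ_iff_lt_or_eq.1 h1 with h1 | rfl
      · exact .inl ⟨h1, h2⟩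
      · rw [(listed_getD hF).2.2.1] at h2
        exact .inr ⟨rfl, h2⟩
    · simp at h

/-- Register `2` tells whether a source, a number of sinks, or a sink is expected. Nonempty sink
lists are essential: the end of a star is noticed only after one of its sinks has been read. -/
theorem parseLetter_spec {L : List (ℕ × List ℕ)} {K j a : ℕ} {w : List ℕ} {s : State}
    (hL : ∀ F ∈ L, F.1 < K ∧ (∀ v ∈ F.2, v < K) ∧ F.2 ≠ []) (hK : L.length ≤ K) (hj : j < K)
    (h2 : 2 ≤ j) (hx : s.reg 1 = j) (ha : s.arr 0 j = a) (h : ParseInv L K (a :: w) j s) :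
    ParseInv L K w (j + 1) (parseLetter.den s) := by
  have hlt : ¬ j < 2 := by omega
  obtain ⟨m, D, hm, h5, hP, ⟨z, rfl, hw⟩ | ⟨F, L', hF, h4, ⟨z, rfl, hw⟩ | ⟨r, z, hr, hr0, h3, hw⟩⟩⟩ := h
  · have e : parseLetter.den s = (s.setReg 4 a).setReg 2 1 := by
      simp [parseLetter, den, Expr.eval, hx, hlt, z, ha]
    rw [e]
    rcases hd : L.drop m with _ | ⟨F, L'⟩
    · simp [hd, starsWord] at hw
    · rw [hd] at hw
      simp only [starsWord, List.flatMap_cons, List.cons_append, List.cons.injEq] at hw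
      refine ⟨m, [], hm, h5, hP.congr (by omega) rfl, .inr ⟨F, L', hd, ?_, .inl ⟨rfl, rfl, hw.2⟩⟩⟩
      simp [State.setReg, hw.1]
  · have e : parseLetter.den s = (s.setReg 3 a).setReg 2 2 := by
      simp [parseLetter, den, Expr.eval, hx, hlt, z, ha]
    rw [e]
    simp only [List.cons.injEq] at hw
    refine ⟨m, [], hm, h5, hP.congr (by omega) rfl, .inr ⟨F, L', hF, h4, .inr ⟨F.2, rfl, rfl,
      (hL F (listed_getD hF).2.1).2.2, ?_, hw.2⟩⟩⟩
    simp [State.setReg, hw.1]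
  · obtain ⟨hmL, hFL, hg, hd⟩ := listed_getD hF
    obtain ⟨b1, b2, -⟩ := hL F hFL
    obtain ⟨v, r, rfl⟩ := List.exists_cons_of_ne_nil hr0
    simp only [List.cons_append, List.cons.injEq] at hw
    obtain ⟨rfl, rfl⟩ := hw
    let s₁ : State := (((s.setArr 2 j m).setArr 3 j F.1).setArr 4 j a).setReg 3 r.length
    have e : parseLetter.den s =
        if r.length = 0 then (s₁.setReg 2 0).setReg 5 (m + 1) else s₁ := by
      simp [parseLetter, den, Expr.eval, hx, hlt, z, s₁, State.setArr, State.setReg, h5, h4, ha, h3]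
    have hP' : Parsed L K m (D ++ [a]) (j + 1) s₁ := by
      refine hP.store hj hF (by omega) b1 (b2 a (by rw [hr]; simp)) ?_ ?_ ?_ <;>
        simp [s₁, State.setArr, State.setReg]
    rw [e]
    rcases r with _ | ⟨v, r⟩
    · rw [if_pos List.length_nil]
      rw [← hr] at hP'
      refine ⟨m + 1, [], hmL, by simp [State.setReg], (hP'.next hF).congr le_rfl rfl,
        .inl ⟨by simp [State.setReg], rfl, ?_⟩⟩
      rw [hd]; rfl
    · rw [if_neg (by simp : ¬ (v :: r).length = 0)]
      refine ⟨m, D ++ [a], hm, ?_, hP', .inr ⟨F, L', hF, ?_, .inr ⟨v :: r, ?_, by simp [hr],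
        by simp, ?_, rfl⟩⟩⟩
      · simp [s₁, State.setReg, State.setArr, h5]
      · simp [s₁, State.setReg, State.setArr, h4]
      · simp [s₁, State.setReg, State.setArr, z]
      · simp [s₁, State.setReg]

theorem parse_spec {n : ℕ} {L : List (ℕ × List ℕ)} (hI : (listedSystem n L).IsInstance) :
    Parsed L (listedWord n L).length L.length [] (listedWord n L).length
      (parse.den (start (listedWord n L))) := by
  set w := listedWord n L with hw
  have hl : L.length + 2 ≤ w.length := listedWord_length n L
  have hn : n ≤ w.length := listed_le hI
  have hL : ∀ F ∈ L, F.1 < w.length ∧ (∀ v ∈ F.2, v < w.length) ∧ F.2 ≠ [] := fun F hF => by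
    obtain ⟨h1, h2, h3⟩ := listed_mem hI hF
    exact ⟨by omega, fun v hv => (h2 v hv).trans_le hn, h3⟩
  have key := count_induct (x := 1) (s := start w) (p := parseLetter)
    -- The first two letters, the numbers of vertices and stars, are skipped; hence the rest of the
    -- word starts at `max j 2`.
    (P := fun j s' => ParseInv L w.length (w.drop (max j 2)) j s')
    (by refine ⟨by norm_num, by decide, ?_⟩
        simp [parseLetter, WellFormed])
    (by
      refine ⟨0, [], Nat.zero_le _, rfl, ⟨?_, ?_, ?_⟩, .inl ⟨rfl, rfl, rfl⟩⟩
      · intro F u v huv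
        simp only [State.setReg, start, OfNat.ofNat_ne_zero, if_false, Nat.not_lt_zero, false_and,
          List.not_mem_nil, and_false, or_false, iff_false]
        rintro ⟨-, -, -, rfl, rfl⟩
        exact huv rfl
      · intro e
        simp only [State.setReg, start, OfNat.ofNat_ne_zero, if_false]
        omega
      · intro e _
        simp [State.setReg, start])
    (by
      intro j s' hj hx _ _ ha hP
      have a0 : s'.arr 0 j = w.getD j 0 := by rw [ha 0 (by decide)]; rfl
      have hj' : j < w.length := hj
      have lift : ∀ s'', ParseInv L w.length (w.drop (max (j + 1) 2)) (j + 1) s'' →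
        ParseInv L w.length (w.drop (max (j + 1) 2)) (j + 1) (s''.setReg 1 (j + 1)) := by
        rintro s'' ⟨m, D, hm, h5, hp, h⟩
        exact ⟨m, D, hm, h5, hp.congr le_rfl rfl, h⟩
      refine lift _ ?_
      by_cases h2 : j < 2
      · have e : parseLetter.den s' = s' := by simp [parseLetter, den, Expr.eval, hx, h2]
        rw [e]
        obtain ⟨m, D, hm, h5, hp, h⟩ := hP
        refine ⟨m, D, hm, h5, hp.congr (by omega) rfl, ?_⟩
        rwa [show max (j + 1) 2 = max j 2 by omega]
      · rw [show max j 2 = j by omega, List.drop_eq_getElem_cons hj'] at hP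
        rw [show max (j + 1) 2 = j + 1 by omega]
        exact parseLetter_spec hL (by omega) hj' (by omega) hx
          (by rw [a0, List.getD_eq_getElem _ _ hj']) hP)
  have e0 : (start w).reg 0 = w.length := rfl
  rw [e0, List.drop_eq_nil_of_le (le_max_left _ _)] at key
  -- The word is used up, so the parser cannot be inside a star: a number of sinks or a further sink
  -- would still have to follow.
  obtain ⟨m, D, hm, -, hP, ⟨-, rfl, hw'⟩ | ⟨F, L', -, -, ⟨-, -, hw'⟩ | ⟨r, -, -, hr, -, hw'⟩⟩⟩ := key
  · have : m = L.length := by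
      rcases hd : L.drop m with _ | ⟨F, L'⟩
      · have := List.drop_eq_nil_iff.1 hd
        omega
      · simp [hd, starsWord] at hw'
    exact this ▸ hP
  · simp at hw'
  · have := (List.append_eq_nil_iff.1 hw'.symm).1
    exact absurd this hr

/-- Marks the vertices of the input system. -/
def alive : Prog := .count 18 (.store 5 (.reg 18) (.lt (.reg 18) (.load 0 (.const 0))))

theorem alive_spec {s : State} : ∀ v < s.reg 0, ((alive.den s).arr 5 v ≠ 0 ↔ v < s.arr 0 0) := by
  refine count_induct (x := 18) (s := s)
    (p := .store 5 (.reg 18) (.lt (.reg 18) (.load 0 (.const 0))))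
    (P := fun j s' => ∀ v < j, s'.arr 5 v ≠ 0 ↔ v < s.arr 0 0) (by simp [WellFormed, regs])
    (by simp) ?_
  intro j s' hj hx _ _ ha hP v hv
  have a0 : s'.arr 0 = s.arr 0 := ha 0 (by decide)
  rcases Nat.lt_succ_iff_lt_or_eq.1 hv with hlt | rfl
  · rw [← hP v hlt]
    simp [den, Expr.eval, State.setReg, State.setArr, hx, hlt.ne]
  · simp [den, Expr.eval, State.setReg, State.setArr, hx, a0]

/-- The output position starts at `1`: cell `0` is reserved for the number of steps, which is known
only at the end. -/
def load : Prog := .seq parse (.seq alive (.assign 22 (.const 1)))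

theorem load_spec {n : ℕ} {L : List (ℕ × List ℕ)} (hI : (listedSystem n L).IsInstance) :
    Represents (load.den (start (listedWord n L))) (listedSystem n L) := by
  have hP := parse_spec hI
  have r0 : (parse.den (start (listedWord n L))).reg 0 = (listedWord n L).length :=
    den_reg (by decide)
  have a0 : (parse.den (start (listedWord n L))).arr 0 0 = n := by
    rw [den_arr (by decide)]; rfl
  have e : load.den (start (listedWord n L)) =
    (alive.den (parse.den (start (listedWord n L)))).setReg 22 1 := rfl
  rw [e]
  generalize parse.den (start (listedWord n L)) = s at *
  have hA := alive_spec (s := s)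
  have z0 : (alive.den s).reg 0 = s.reg 0 := den_reg (by decide)
  have za : ∀ a, a ≠ 5 → (alive.den s).arr a = s.arr a := fun a h =>
    den_arr (by simp [alive, arrs, h])
  generalize alive.den s = s' at *
  have z0' : (s'.setReg 22 1).reg 0 = (listedWord n L).length := z0.trans r0
  have hn := listed_le hI
  refine ⟨fun v => ?_, fun F u v huv => ?_, ?_, ?_, ?_⟩
  · rw [z0']
    simp only [State.setReg, listedSystem, Finset.mem_range]
    constructor
    · intro hv
      exact ⟨by omega, (hA v (by omega)).2 (by omega)⟩
    · rintro ⟨h1, h2⟩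
      have := (hA v (by omega)).1 h2
      omega
  · rw [z0']
    simp only [State.setReg, za 2 (by norm_num), za 3 (by norm_num), za 4 (by norm_num)]
    rw [hP.arcs F u v huv]
    simp [listedSystem]
  · rw [z0']
    simp only [State.setReg, za 2 (by norm_num)]
    exact fun e _ => (hP.lt e).1
  · rw [z0']
    simp only [State.setReg, za 3 (by norm_num)]
    exact fun e _ => (hP.lt e).2.1
  · rw [z0']
    simp only [State.setReg, za 4 (by norm_num)]
    exact fun e _ => (hP.lt e).2.2

/-! ### The algorithm -/

def algorithm : Prog := .seq load (.seq contractAll (.store 1 (.const 0) (.reg 23)))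

theorem algorithm_wellFormed : algorithm.WellFormed := by
  refine ⟨?_, contractAll_wellFormed, trivial⟩
  refine ⟨⟨by norm_num, by decide, ?_⟩, ?_⟩ <;> simp [parseLetter, alive, WellFormed, regs]

theorem runWord_eq (l : List (Step ℕ ℕ)) : runWord l = l.length :: l.flatMap stepWord := rfl

theorem algorithm_spec {n : ℕ} {L : List (ℕ × List ℕ)} (hI : (listedSystem n L).IsInstance) :
    ∃ run, (listedSystem n L).IsRun run ∧
      written (algorithm.den (start (listedWord n L))) = runWord run := by
  obtain ⟨l, hl, hw, h23⟩ := contractAll_spec hI (load_spec hI)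
  refine ⟨l, hl, ?_⟩
  have w0 : written (load.den (start (listedWord n L))) = [0] := by
    have a1 : (load.den (start (listedWord n L))).arr 1 = fun _ => 0 := by
      rw [den_arr (by decide)]; rfl
    have r22 : (load.den (start (listedWord n L))).reg 22 = 1 := rfl
    simp [written, a1, r22]
  have r23 : (load.den (start (listedWord n L))).reg 23 = 0 := by
    rw [den_reg (by decide)]; rfl
  have e : algorithm.den (start (listedWord n L)) =
    (contractAll.den (load.den (start (listedWord n L)))).setArr 1 0
      ((contractAll.den (load.den (start (listedWord n L)))).reg 23) := rfl
  rw [w0] at hw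
  rw [r23, zero_add] at h23
  rw [e, h23, runWord_eq]
  generalize contractAll.den (load.den (start (listedWord n L))) = s at *
  -- The written word begins with the reserved letter `0`, so it is nonempty and the final store
  -- replaces exactly this letter by the number of steps.
  have hpos : s.reg 22 ≠ 0 := by
    intro hc
    simp [written, hc] at hw
  obtain ⟨k, hk⟩ := Nat.exists_eq_succ_of_ne_zero hpos
  simp only [written, hk, Nat.succ_eq_add_one, List.range_succ_eq_map, List.map_cons,
    List.map_map, List.singleton_append, List.cons.injEq] at hw
  rw [← hw.2]
  simp [written, State.setArr, hk, List.range_succ_eq_map, Function.comp_def]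

/-- The program whose last command puts the length of the output into register `0`. -/
theorem exists_polynomial_time : ∃ (prog : Cmd) (p : Polynomial ℕ), ∀ (n : ℕ)
    (L : List (ℕ × List ℕ)), (listedSystem n L).IsInstance → ∃ (run : List (Step ℕ ℕ)) (t : ℕ),
      prog.Computes (listedWord n L) (runWord run) t ∧ t ≤ p.eval (listedWord n L).length ∧
      (listedSystem n L).IsRun run := by
  -- The last command lies outside the counting-loop language, whose well-formed programs never
  -- write register `0`. It costs the two additional steps.
  refine ⟨.seq algorithm.compile (.assign 0 (.reg 22)), algorithm.time + 2, fun n L hI => ?_⟩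
  obtain ⟨run, hrun, hw⟩ := algorithm_spec hI
  obtain ⟨t, ht, hex⟩ := exec_compile algorithm_wellFormed (start (listedWord n L))
  refine ⟨run, t + 2, ⟨_, .seq hex (.assign _ _ _), ?_⟩, ?_, hrun⟩
  · rw [← hw]
    simp [State.output, written, State.setReg, Expr.eval]
  · have e2 : (2 : Polynomial ℕ).eval (listedWord n L).length = 2 := Polynomial.eval_ofNat ..
    rw [Polynomial.eval_add, e2]
    exact Nat.add_le_add_right ht 2

end RAM

/-! ### Digraphs -/

section Digraph

variable {n : ℕ} {E : List (ℕ × ℕ)}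

theorem arcStars_getD {i : ℕ} (hi : i < E.length) :
    (arcStars E).getD i (0, []) = ((E.getD i (0, 0)).1, [(E.getD i (0, 0)).2]) := by
  rw [List.getD_eq_getElem _ _ (by simpa [arcStars] using hi), List.getD_eq_getElem _ _ hi]
  simp [arcStars]

theorem listedSystem_arcStars_arc {R : Finset ℕ} (hR : R ⊆ Finset.range E.length) {u v : ℕ} :
    (listedSystem n (arcStars E)).Arc R u v ↔ (u, v) ∈ pickedArcs E R := by
  simp only [StarSystem.Arc, pickedArcs, Finset.mem_image]
  refine exists_congr fun i => and_congr_right fun hi => ?_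
  have := arcStars_getD (Finset.mem_range.1 (hR hi))
  simp only [listedSystem, this, List.toFinset_cons, List.toFinset_nil, insert_empty_eq,
    Finset.mem_singleton, Prod.ext_iff, eq_comm]

theorem stars_arcStars : (listedSystem n (arcStars E)).stars = Finset.range E.length := by
  simp [listedSystem, arcStars]

theorem isFeasible_arcStars {R : Finset ℕ} : (listedSystem n (arcStars E)).IsFeasible R ↔
    R ⊆ Finset.range E.length ∧ SpansStrongly n (pickedArcs E R) := by
  rw [StarSystem.IsFeasible, stars_arcStars]
  refine and_congr_right fun hR => ?_
  have : (listedSystem n (arcStars E)).Arc R = fun u v => (u, v) ∈ pickedArcs E R := by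
    funext u v
    exact propext (listedSystem_arcStars_arc hR)
  rw [this]
  rfl

theorem pickedArcs_filter {A : Finset (ℕ × ℕ)} (hA : A ⊆ E.toFinset) :
    pickedArcs E ((Finset.range E.length).filter fun i => E.getD i (0, 0) ∈ A) = A := by
  ext a
  simp only [pickedArcs, Finset.mem_image, Finset.mem_filter, Finset.mem_range]
  constructor
  · rintro ⟨i, ⟨-, h⟩, rfl⟩
    exact h
  · intro ha
    obtain ⟨i, hi, rfl⟩ := List.mem_iff_getElem.1 (List.mem_toFinset.1 (hA ha))
    have e := List.getD_eq_getElem E (0, 0) hi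
    exact ⟨i, ⟨hi, e ▸ ha⟩, e⟩

theorem pickedArcs_subset {R : Finset ℕ} (hR : R ⊆ Finset.range E.length) :
    pickedArcs E R ⊆ E.toFinset := by
  intro a ha
  obtain ⟨i, hi, rfl⟩ := Finset.mem_image.1 ha
  have hi' := Finset.mem_range.1 (hR hi)
  rw [List.mem_toFinset, List.getD_eq_getElem _ _ hi']
  exact List.getElem_mem hi'

theorem IsListedDigraph.isInstance (h : IsListedDigraph n E) :
    (listedSystem n (arcStars E)).IsInstance := by
  have hst : ∀ i ∈ (listedSystem n (arcStars E)).stars, E.getD i (0, 0) ∈ E ∧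
      (listedSystem n (arcStars E)).source i = (E.getD i (0, 0)).1 ∧
      (listedSystem n (arcStars E)).sinks i = {(E.getD i (0, 0)).2} := by
    intro i hi
    rw [stars_arcStars] at hi
    have hi' := Finset.mem_range.1 hi
    refine ⟨?_, ?_, ?_⟩
    · rw [List.getD_eq_getElem _ _ hi']
      exact List.getElem_mem hi'
    · simp only [listedSystem, arcStars_getD hi']
    · simp only [listedSystem, arcStars_getD hi', List.toFinset_cons, List.toFinset_nil,
        insert_empty_eq]
  refine ⟨fun i hi => ?_, fun i hi => ?_, fun i hi => ?_, fun i hi => ?_, ?_⟩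
  · obtain ⟨h1, h2, -⟩ := hst i hi
    rw [h2]
    exact Finset.mem_range.2 (h.arc_mem _ h1).1
  · obtain ⟨h1, -, h3⟩ := hst i hi
    rw [h3, Finset.singleton_subset_iff]
    exact Finset.mem_range.2 (h.arc_mem _ h1).2.1
  · rw [(hst i hi).2.2]
    exact Finset.singleton_nonempty _
  · obtain ⟨h1, h2, h3⟩ := hst i hi
    rw [h2, h3, Finset.mem_singleton]
    exact (h.arc_mem _ h1).2.2
  · refine (isFeasible_arcStars.2 ⟨stars_arcStars.le, ?_⟩).2
    have e : pickedArcs E (Finset.range E.length) = E.toFinset := by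
      have := pickedArcs_filter (E := E) subset_rfl
      rw [Finset.filter_true_of_mem] at this
      · exact this
      · intro i hi
        have hi' := Finset.mem_range.1 hi
        rw [List.mem_toFinset, List.getD_eq_getElem _ _ hi']
        exact List.getElem_mem hi'
    rw [stars_arcStars, e]
    exact h.stronglyConnected

/-- A strongly connected spanning subgraph is a feasible solution with the same number of stars. -/
theorem IsListedDigraph.exists_isFeasible (h : IsListedDigraph n E) {A : Finset (ℕ × ℕ)}
    (hA : A ⊆ E.toFinset) (hs : SpansStrongly n A) :
    ∃ R, (listedSystem n (arcStars E)).IsFeasible R ∧ R.card = A.card := by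
  refine ⟨_, isFeasible_arcStars.2 ⟨Finset.filter_subset _ _, (pickedArcs_filter hA).symm ▸ hs⟩, ?_⟩
  conv_rhs => rw [← pickedArcs_filter hA]
  rw [pickedArcs, Finset.card_image_of_injOn]
  intro i hi j hj e
  have hi' := Finset.mem_range.1 (Finset.mem_filter.1 hi).1
  have hj' := Finset.mem_range.1 (Finset.mem_filter.1 hj).1
  simp only [List.getD_eq_getElem _ _ hi', List.getD_eq_getElem _ _ hj'] at e
  -- Distinct positions hold distinct arcs because the list has no repetitions; otherwise a subgraph
  -- could correspond to more stars than it has arcs.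
  exact (h.nodup.getElem_inj_iff).1 e

end Digraph

/-! ### The main theorem -/

theorem mainTheorem2 :
    ∃ (prog : RAM.Cmd) (p : Polynomial ℕ),
      -- Star Strong Connectivity
      (∀ (n : ℕ) (L : List (ℕ × List ℕ)), (listedSystem n L).IsInstance →
        ∃ (run : List (Step ℕ ℕ)) (t : ℕ),
          prog.Computes (listedWord n L) (runWord run) t ∧
          t ≤ p.eval (listedWord n L).length ∧
          (listedSystem n L).IsRun run ∧
          (listedSystem n L).IsFeasible (chosen run) ∧
          (∀ R, (listedSystem n L).IsFeasible R →
            ((chosen run).card : ℝ) ≤ 8 / 5 * (R.card : ℝ)) ∧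
          (listedSystem n L).IsDualFeasible StarSystem.singletonDual ∧
          (listedSystem n L).IsDualFeasible ((listedSystem n L).internalDual run) ∧
          (∀ R, (listedSystem n L).IsFeasible R →
            (listedSystem n L).dualValue StarSystem.singletonDual ≤ (R.card : ℝ) ∧
            (listedSystem n L).dualValue ((listedSystem n L).internalDual run) ≤ (R.card : ℝ)) ∧
          ((chosen run).card : ℝ) ≤ 8 / 5 *
            (3 / 4 * (listedSystem n L).dualValue StarSystem.singletonDual +
              1 / 4 * (listedSystem n L).dualValue ((listedSystem n L).internalDual run))) ∧
      -- Minimum Strongly Connected Spanning Subgraph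
      (∀ (n : ℕ) (E : List (ℕ × ℕ)), IsListedDigraph n E →
        ∃ (run : List (Step ℕ ℕ)) (t : ℕ),
          prog.Computes (listedWord n (arcStars E)) (runWord run) t ∧
          t ≤ p.eval (listedWord n (arcStars E)).length ∧
          (listedSystem n (arcStars E)).IsRun run ∧
          pickedArcs E (chosen run) ⊆ E.toFinset ∧
          SpansStrongly n (pickedArcs E (chosen run)) ∧
          ∀ A : Finset (ℕ × ℕ), A ⊆ E.toFinset → SpansStrongly n A →
            ((pickedArcs E (chosen run)).card : ℝ) ≤ 8 / 5 * (A.card : ℝ)) := by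
  obtain ⟨prog, p, hp⟩ := RAM.exists_polynomial_time
  refine ⟨prog, p, fun n L hI => ?_, fun n E hE => ?_⟩
  · obtain ⟨run, t, h1, h2, h3⟩ := hp n L hI
    exact ⟨run, t, h1, h2, h3, h3.isFeasible hI, fun R hR => h3.card_chosen_le_feasible hI hR,
      StarSystem.singletonDual_feasible, h3.internalDual_feasible,
      fun R hR => ⟨StarSystem.singletonDual_feasible.value_le hR,
        h3.internalDual_feasible.value_le hR⟩, h3.card_chosen_le hI⟩
  · obtain ⟨run, t, h1, h2, h3⟩ := hp n (arcStars E) hE.isInstance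
    obtain ⟨hsub, hspan⟩ := isFeasible_arcStars.1 (h3.isFeasible hE.isInstance)
    refine ⟨run, t, h1, h2, h3, pickedArcs_subset hsub, hspan, fun A hA hs => ?_⟩
    obtain ⟨R, hR, hcard⟩ := hE.exists_isFeasible hA hs
    -- Passing from positions to arcs cannot increase the size of the solution, so injectivity is
    -- not needed on this side.
    refine le_trans (Nat.cast_le.2 Finset.card_image_le) ?_
    rw [← hcard]
    exact h3.card_chosen_le_feasible hE.isInstance hR
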